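/- **Setting.** A $q$-ary constraint graph $G=(V,E,\Sigma,\Pi)$ consists of a finite $q$-uniform hypergraph $(V,E)$ with $E\neq\emptyset$ (parallel hyperedges are allowed), a finite alphabet $\Sigma$, and for each hyperedge $e\in E$ a constraint $\pi_e\subseteq\Sigma^e$. An assignment $\psi\colon V\to\Sigma$ satisfies $e=\{v_1,\dots,v_q\}$ if $(\psi(v_1),\dots,\psi(v_q))\in\pi_e$, and satisfies $G$ if it satisfies every $e\in E$; $\mathrm{val}_G(\psi)$ is the fraction of hyperedges satisfied by $\psi$. A reconfiguration sequence from $\psi^{\mathsf{ini}}$ to $\psi^{\mathsf{tar}}$ is a sequence of assignments $(\psi^{(1)},\dots,\psi^{(T)})$ with $\psi^{(1)}=\psi^{\mathsf{ini}}$ and $\psi^{(T)}=\psi^{\mathsf{tar}}$ in which neighbouring assignments differ in at most one vertex, and $$\mathrm{val}_G(\psi^{\mathsf{ini}}\leftrightsquigarrow\psi^{\mathsf{tar}})=\max_{(\psi^{(1)},\dots,\psi^{(T)})}\ \min_{1\le t\le T}\mathrm{val}_G(\psi^{(t)}),$$ the maximum being over all reconfiguration sequences from $\psi^{\mathsf{ini}}$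 to $\psi^{\mathsf{tar}}$. An instance of Maxmin $q$-CSP$_W$ Reconfiguration is a triple $(G,\psi^{\mathsf{ini}},\psi^{\mathsf{tar}})$ where $G$ is a $q$-ary constraint graph with $|\Sigma|=W$ and $\psi^{\mathsf{ini}},\psi^{\mathsf{tar}}$ are assignments; BCSP means $2$-CSP. **Proposition 3.8 (Composition).** Let $\delta_0=\frac1{400}$, $\rho=\frac1{10\,000}$, $\tilde W_0=8$ and $\tilde\kappa=\frac{\delta_0^2\rho^2}{64}\in(0,1)$. There is an algorithm that takes an instance $(G,\psi^{\mathsf{ini}},\psi^{\mathsf{tar}})$ of Maxmin BCSP$_W$ Reconfiguration, with any alphabet size $W\in\mathbb N$, where $\psi^{\mathsf{ini}}$ and $\psi^{\mathsf{tar}}$ satisfy $G$, and that produces an instance $(G',\psi'^{\mathsf{ini}},\psi'^{\mathsf{tar}})$ of Maxmin $4$-CSP$_{\tilde W_0}$ Reconfiguration, where $\psi'^{\mathsf{ini}}$ and $\psi'^{\mathsf{tar}}$ satisfy $G'$. For every fixed $W$ it runs in time polynomial in the length of the input, and the following hold. * (Perfect completeness) If $\mathrm{val}_G(\psi^{\mathsf{ini}}\leftrightsquigarrow\psi^{\mathsf{tar}})=1$,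 then $\mathrm{val}_{G'}(\psi'^{\mathsf{ini}}\leftrightsquigarrow\psi'^{\mathsf{tar}})=1$. * (Soundness) For every real $\epsilon$, if $\mathrm{val}_G(\psi^{\mathsf{ini}}\leftrightsquigarrow\psi^{\mathsf{tar}})<1-\epsilon$, then $\mathrm{val}_{G'}(\psi'^{\mathsf{ini}}\leftrightsquigarrow\psi'^{\mathsf{tar}})<1-\tilde\kappa\cdot\epsilon$. -/

import Mathlib

/-- A `q`-ary constraint graph `G = (V, E, A, Π)`. Each hyperedge `e : E` is given by a listing of
its `q` distinct vertices (the underlying hypergraph is `q`-uniform; parallel hyperedges are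
allowed), and its constraint is the set of acceptable `q`-tuples of values. -/
structure ConstraintGraph (q : ℕ) (V E A : Type) where
  vertex : E → Fin q → V
  vertex_injective : ∀ e, Function.Injective (vertex e)
  constraint : E → Finset (Fin q → A)

namespace ConstraintGraph

variable {q : ℕ} {V E A : Type}

/-- The assignment `ψ` satisfies the hyperedge `e`. -/
def SatisfiesEdge (G : ConstraintGraph q V E A) (ψ : V → A) (e : E) : Prop :=
  (fun i => ψ (G.vertex e i)) ∈ G.constraint e

/-- The assignment `ψ` satisfies all hyperedges of `G`. -/
def Satisfies (G : ConstraintGraph q V E A) (ψ : V → A) : Prop :=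
  ∀ e, G.SatisfiesEdge ψ e

/-- `val_G(ψ)`: the fraction of hyperedges satisfied by `ψ`. -/
noncomputable def value (G : ConstraintGraph q V E A) (ψ : V → A) : ℝ :=
  (Nat.card {e : E // G.SatisfiesEdge ψ e} : ℝ) / (Nat.card E : ℝ)

/-- `(s 0, …, s T)` is a reconfiguration sequence from `ψini` to `ψtar` over `V → A`:
neighbouring assignments differ in at most one vertex. -/
def IsReconfSeq [Fintype V] [DecidableEq A] (ψini ψtar : V → A) {T : ℕ}
    (s : Fin (T + 1) → V → A) : Prop :=
  s 0 = ψini ∧ s (Fin.last T) = ψtar ∧ ∀ t : Fin T, hammingDist (s t.castSucc) (s t.succ) ≤ 1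

/-- `val_G` of a sequence: the minimum of `val_G` over its members. -/
noncomputable def seqValue (G : ConstraintGraph q V E A) {T : ℕ} (s : Fin (T + 1) → V → A) : ℝ :=
  ⨅ t, G.value (s t)

/-- The values of all reconfiguration sequences from `ψini` to `ψtar`. -/
def reconfValueSet [Fintype V] [DecidableEq A] (G : ConstraintGraph q V E A)
    (ψini ψtar : V → A) : Set ℝ :=
  {r | ∃ (T : ℕ) (s : Fin (T + 1) → V → A), IsReconfSeq ψini ψtar s ∧ G.seqValue s = r}

/-- `val_G(ψini ↭ ψtar)`: the maximum value of a reconfiguration sequence from `ψini` to `ψtar`.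
The supremum is attained, see `reconfValue_isGreatest`. -/
noncomputable def reconfValue [Fintype V] [DecidableEq A] (G : ConstraintGraph q V E A)
    (ψini ψtar : V → A) : ℝ :=
  sSup (G.reconfValueSet ψini ψtar)

theorem exists_isReconfSeq (n : ℕ) [DecidableEq A] (ψini ψtar : Fin n → A) :
    ∃ (T : ℕ) (s : Fin (T + 1) → Fin n → A), IsReconfSeq ψini ψtar s := by
  refine ⟨n, fun t v => if (v : ℕ) < t then ψtar v else ψini v, ?_, ?_, ?_⟩
  · funext v; simp
  · funext v; simp
  · intro t
    unfold hammingDist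
    refine Finset.card_le_one.2 ?_
    intro a ha b hb
    simp only [Finset.mem_filter, Finset.mem_univ, true_and, Fin.val_castSucc, Fin.val_succ]
      at ha hb
    ext
    split_ifs at ha hb <;> first | omega | simp_all

theorem seqValue_mem (G : ConstraintGraph q V E A) {T : ℕ} (s : Fin (T + 1) → V → A) :
    ∃ t, G.value (s t) = G.seqValue s :=
  exists_eq_ciInf_of_finite

theorem reconfValue_isGreatest {n : ℕ} [DecidableEq A] [Finite A]
    (G : ConstraintGraph q (Fin n) E A) (ψini ψtar : Fin n → A) :
    IsGreatest (G.reconfValueSet ψini ψtar) (G.reconfValue ψini ψtar) := by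
  have hfin : (G.reconfValueSet ψini ψtar).Finite := by
    refine (Set.finite_range fun ψ : Fin n → A => G.value ψ).subset ?_
    rintro r ⟨T, s, -, rfl⟩
    obtain ⟨t, ht⟩ := G.seqValue_mem s
    exact ⟨s t, ht⟩
  obtain ⟨T, s, hs⟩ := exists_isReconfSeq n ψini ψtar
  have hne : (G.reconfValueSet ψini ψtar).Nonempty := ⟨_, T, s, hs, rfl⟩
  exact ⟨hne.csSup_mem hfin, fun r hr => le_csSup hfin.bddAbove hr⟩

end ConstraintGraph

/-- An instance `(G, ψini, ψtar)` of Maxmin `q`-CSP`_W` Reconfiguration in which `ψini` and `ψtar`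
satisfy `G`. The finitely many vertices, hyperedges and alphabet symbols are numbered. There is at
least one hyperedge, so that the fraction of satisfied hyperedges makes sense. -/
structure CSPReconfInstance (q W : ℕ) where
  numVertices : ℕ
  numEdges : ℕ
  numEdges_pos : 0 < numEdges
  graph : ConstraintGraph q (Fin numVertices) (Fin numEdges) (Fin W)
  ini : Fin numVertices → Fin W
  tar : Fin numVertices → Fin W
  ini_satisfies : graph.Satisfies ini
  tar_satisfies : graph.Satisfies tar

/-- The bit string that writes each number `k` of a list as `1 ⋯ 1 0` with `k` ones. -/
def unaryString (l : List ℕ) : List Bool :=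
  l.flatMap fun k => List.replicate k true ++ [false]

namespace CSPReconfInstance

variable {q W : ℕ}

/-- `val_G(ψini ↭ ψtar)`. -/
noncomputable def optValue (I : CSPReconfInstance q W) : ℝ :=
  I.graph.reconfValue I.ini I.tar

/-- A hyperedge as a list of numbers: its `q` vertices, then the truth table (`W ^ q` entries `0`
or `1`) of its constraint. -/
def edgeCode (I : CSPReconfInstance q W) (e : Fin I.numEdges) : List ℕ :=
  List.ofFn (fun i => (I.graph.vertex e i : ℕ)) ++
    List.ofFn (fun j : Fin (W ^ q) =>
      if (finFunctionFinEquiv.symm j : Fin q → Fin W) ∈ I.graph.constraint e then 1 else 0)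

/-- An instance as a list of numbers: alphabet size, numbers of vertices and hyperedges, the
hyperedges, and the values of the two assignments at all vertices. -/
def code (I : CSPReconfInstance q W) : List ℕ :=
  [W, I.numVertices, I.numEdges] ++ (List.ofFn I.edgeCode).flatten ++
    List.ofFn (fun v => (I.ini v : ℕ)) ++ List.ofFn (fun v => (I.tar v : ℕ))

/-- The bit string representing an instance. Both assignments are listed in full, so the length is
at least the number of vertices, and writing the vertices in unary rather than in binary changes
the length only polynomially. -/
def encode (I : CSPReconfInstance q W) : List Bool :=
  unaryString I.code

end CSPReconfInstance

theorem unaryString_injective : Function.Injective unaryString := by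
  have key : ∀ (a b : ℕ) (x y : List Bool),
      List.replicate a true ++ [false] ++ x = List.replicate b true ++ [false] ++ y →
        a = b ∧ x = y := by
    intro a
    induction a with
    | zero =>
      intro b x y h
      cases b <;> simp_all [List.replicate_succ]
    | succ a ih =>
      intro b x y h
      cases b with
      | zero => simp [List.replicate_succ] at h
      | succ b =>
        have := ih b x y (by simpa [List.replicate_succ] using h)
        simpa using this
  intro l
  induction l with
  | nil => intro l' h; cases l' <;> simp_all [unaryString]
  | cons a l ih =>
    intro l' h
    cases l' with
    | nil => simp [unaryString] at h
    | cons b l' =>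
      have h' : List.replicate a true ++ [false] ++ unaryString l =
          List.replicate b true ++ [false] ++ unaryString l' := by
        simpa [unaryString] using h
      obtain ⟨h1, h2⟩ := key _ _ _ _ h'
      rw [h1, ih h2]

theorem CSPReconfInstance.encode_injective (q : ℕ) :
    Function.Injective (fun I : (W : ℕ) × CSPReconfInstance q W => I.2.encode) := by
  rintro ⟨W, I⟩ ⟨W', I'⟩ h
  have h : I.code = I'.code := unaryString_injective h
  obtain ⟨n, m, hm, G, a, b, ha, hb⟩ := I
  obtain ⟨n', m', hm', G', a', b', ha', hb'⟩ := I'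
  simp only [CSPReconfInstance.code, List.cons_append, List.nil_append, List.cons.injEq] at h
  obtain ⟨rfl, rfl, rfl, h⟩ := h
  have h1 := List.append_inj' h (by simp)
  have h2 := List.append_inj' h1.1 (by simp)
  have hA : a = a' := by
    funext v
    exact Fin.ext (congrFun (List.ofFn_injective h2.2) v)
  have hB : b = b' := by
    funext v
    exact Fin.ext (congrFun (List.ofFn_injective h1.2) v)
  have hE := List.ofFn_injective (List.eq_iff_flatten_eq.2 ⟨h2.1, by
    simp only [List.map_ofFn]
    congr 1
    funext e
    simp [CSPReconfInstance.edgeCode]⟩)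
  have hG : G = G' := by
    obtain ⟨p, hp, c⟩ := G
    obtain ⟨p', hp', c'⟩ := G'
    have hpc : ∀ e, p e = p' e ∧ c e = c' e := by
      intro e
      have he := List.append_inj (congrFun hE e) (by simp)
      refine ⟨?_, ?_⟩
      · funext i
        exact Fin.ext (congrFun (List.ofFn_injective he.1) i)
      · ext t
        have ht := congrFun (List.ofFn_injective he.2) (finFunctionFinEquiv t)
        simp only [Equiv.symm_apply_apply] at ht
        by_cases h1 : t ∈ c e <;> by_cases h2 : t ∈ c' e <;> simp_all
    obtain rfl : p = p' := funext fun e => (hpc e).1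
    obtain rfl : c = c' := funext fun e => (hpc e).2
    rfl
  subst hA hB hG
  rfl

/-- One Turing machine (Mathlib's finite multi-stack model) computes `f W` for every alphabet size
`W`, and for each fixed `W` its number of steps is bounded by a polynomial in the length of the
input. -/
def PolyTimeForFixedAlphabet {q q' W' : ℕ}
    (f : (W : ℕ) → CSPReconfInstance q W → CSPReconfInstance q' W') : Prop :=
  ∃ (M : Turing.TM2ComputableAux Bool Bool) (p : ℕ → Polynomial ℕ),
    ∀ (W : ℕ) (I : CSPReconfInstance q W),
      Nonempty (Turing.TM2OutputsInTime M.tm (I.encode.map M.inputAlphabet.symm)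
        (some ((f W I).encode.map M.outputAlphabet.symm)) ((p W).eval I.encode.length))

/-- The constant `δ₀` of the reconfigurability of Hadamard codes. -/
noncomputable def delta0 : ℝ := 1 / 400

/-- The rejection rate `ρ` of the assignment tester. -/
noncomputable def rho : ℝ := 1 / 10000

/-- The alphabet size of the instances produced. -/
def tildeW0 : ℕ := 8

/-- The factor by which the gap may shrink. -/
noncomputable def tildeKappa : ℝ := delta0 ^ 2 * rho ^ 2 / 64

/-! Symbols are replaced by long codes, and a selector decides which of two copies counts. For `Ω =
Fin (W ^ 2)`, the pairs of symbols, a word has a bit for every function `f : Ω → ZMod 2`; the long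
code of `p` has the bits `f p`. Each vertex of `G` gets a selector and two words. Each hyperedge of
`G`, for each choice of two selector values, gets a word `B` for its pair of values, a table `C` of
products, and a three-bit local view for each of six tests and each triple of functions. A new
hyperedge joins two selectors, a view and one queried entry: if the selectors have its values, the
view must pass the test and contain the entry. The three bits account for the alphabet size `8`.

Completeness: whatever is not selected is unconstrained. A change of the value of a vertex is
prepared out of sight and takes effect by one flip of a selector (`Agrees.exists_reachable`); at the
end all copies are equalized and the selectors return to `0` (`Agrees.reachable_code`).

Soundness: at each vertex of `G`, `decode` reads the symbol whose long code is closer than a quarter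
to the selected word, with a default if there is none. Code words of distinct symbols differ on at
least half of the functions, so this is unambiguous, and one change upstairs alters at most one
decoded value. Reconfiguration sequences thus decode to reconfiguration sequences. If the decoded
assignment violates `e`, some test fails for at least a hundredth of the triples (`tests_sound`):
otherwise the linearity test makes `B` close to some `dot S`, the product tests reduce `S` to a
single point `p`, and the remaining tests show that `p` is allowed by `e` and matches both words.
Each failure violates one of `72` hyperedges per triple, so the gap shrinks at most by the factor
`7200` (`one_sub_value_decode_le`), far less than `tildeKappa` permits.

Running time: the number `2 ^ W ^ 2` of functions depends on `W` only. The entries of the new code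
are values of arithmetic expressions. These are compiled to stack programs and then to a machine,
with polynomial bounds by structural induction (`Ex.good`, `Gen.good`). -/

/-! ### Stack programs and their compilation to multi-stack machines -/

namespace StackProg

/-- The contents of the Boolean stacks of a program. -/
abbrev Store := ℕ → List Bool

/-- Structured programs on Boolean stacks. `loop r ct cf again` pops stack `r` repeatedly; it runs
`ct` after popping `true`, runs `cf` after popping `false`, and ends when the stack is empty, or
after `cf` unless `again` holds. -/
inductive Cmd
  | skip
  | push (r : ℕ) (b : Bool)
  | pop (r : ℕ)
  | seq (c d : Cmd)
  | loop (r : ℕ) (ct cf : Cmd) (again : Bool)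

open Cmd Function

/-- `Run c s s' t`: the program `c` takes the store `s` to `s'` in `t` steps. -/
inductive Run : Cmd → Store → Store → ℕ → Prop
  | skip (s) : Run skip s s 0
  | push (r b s) : Run (push r b) s (update s r (b :: s r)) 1
  | pop (r s) : Run (pop r) s (update s r (s r).tail) 1
  | seq {c d s₁ s₂ s₃ t₁ t₂} : Run c s₁ s₂ t₁ → Run d s₂ s₃ t₂ → Run (seq c d) s₁ s₃ (t₁ + t₂)
  | loop_nil {r ct cf again s} : s r = [] → Run (loop r ct cf again) s (update s r []) 1
  | loop_true {r ct cf again s₁ s₂ s₃ l t₁ t₂} : s₁ r = true :: l →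
      Run ct (update s₁ r l) s₂ t₁ → Run (loop r ct cf again) s₂ s₃ t₂ →
      Run (loop r ct cf again) s₁ s₃ (1 + (t₁ + (1 + t₂)))
  | loop_again {r ct cf s₁ s₂ s₃ l t₁ t₂} : s₁ r = false :: l →
      Run cf (update s₁ r l) s₂ t₁ → Run (loop r ct cf true) s₂ s₃ t₂ →
      Run (loop r ct cf true) s₁ s₃ (1 + (t₁ + (1 + t₂)))
  | loop_exit {r ct cf s₁ s₂ l t₁} : s₁ r = false :: l →
      Run cf (update s₁ r l) s₂ t₁ → Run (loop r ct cf false) s₁ s₂ (1 + (t₁ + 1))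

/-- Jump instructions with absolute addresses; `pop` branches on empty stack, `true`, `false`. -/
inductive Instr
  | push (r : ℕ) (b : Bool)
  | pop (r : ℕ) (e t f : ℕ)
  | jump (l : ℕ)

/-- The number of instructions of the compiled program. -/
def Cmd.size : Cmd → ℕ
  | skip => 0
  | push _ _ => 1
  | pop _ => 1
  | seq c d => c.size + d.size
  -- One pop and two jumps surround the two bodies.
  | loop _ ct cf _ => ct.size + cf.size + 3

/-- The instructions of a program that is placed at address `a`. -/
def Cmd.code (a : ℕ) : Cmd → List Instr
  | skip => []
  | push r b => [.push r b]
  | pop r => [.pop r (a + 1) (a + 1) (a + 1)]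
  | seq c d => c.code a ++ d.code (a + c.size)
  | loop r ct cf again =>
      [.pop r (a + (ct.size + cf.size + 3)) (a + 1) (a + ct.size + 2)] ++ ct.code (a + 1) ++
        [.jump a] ++ cf.code (a + ct.size + 2) ++
        [.jump (if again then a else a + (ct.size + cf.size + 3))]

theorem Cmd.length_code (c : Cmd) (a : ℕ) : (c.code a).length = c.size := by
  induction c generalizing a <;> simp_all [Cmd.code, Cmd.size]; omega

/-- An upper bound on the stacks that a program uses. -/
def Cmd.width : Cmd → ℕ
  | skip => 0
  | push r _ => r
  | pop r => r
  | seq c d => max c.width d.width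
  | loop r ct cf _ => max r (max ct.width cf.width)

section Machine

variable (R : ℕ) (P : List Instr)

/-- The statement of one instruction. -/
def Instr.stmt (l : ℕ) :
    Option Instr → Turing.TM2.Stmt (fun _ : Fin (R + 1) => Bool) (Fin (P.length + 1)) (Option Bool)
  | some (.push r b) =>
      .push (Fin.ofNat (R + 1) r) (fun _ => b) (.goto fun _ => Fin.ofNat (P.length + 1) (l + 1))
  | some (.pop r e t f) =>
      .pop (Fin.ofNat (R + 1) r) (fun _ o => o) (.goto fun v => match v with
        | none => Fin.ofNat (P.length + 1) e
        | some true => Fin.ofNat (P.length + 1) t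
        | some false => Fin.ofNat (P.length + 1) f)
  | some (.jump l) => .goto fun _ => Fin.ofNat (P.length + 1) l
  -- The address behind the last instruction halts. The register is reset because a halting
  -- configuration has to carry the initial state.
  | none => .load (fun _ => none) .halt

/-- The statements of all addresses. -/
def stmts (l : Fin (P.length + 1)) :
    Turing.TM2.Stmt (fun _ : Fin (R + 1) => Bool) (Fin (P.length + 1)) (Option Bool) :=
  Instr.stmt R P l P[(l : ℕ)]?

/-- The machine that executes the instructions, with input on stack `0` and output on stack `1`. -/
def machine : Turing.FinTM2 where
  K := Fin (R + 1)
  k₀ := Fin.ofNat (R + 1) 0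
  k₁ := Fin.ofNat (R + 1) 1
  Γ _ := Bool
  Λ := Fin (P.length + 1)
  main := Fin.ofNat (P.length + 1) 0
  σ := Option Bool
  initialState := none
  m := stmts R P

/-- The configuration of the machine at address `l`. -/
def config (l : ℕ) (v : Option Bool) (s : Store) :
    Turing.TM2.Cfg (fun _ : Fin (R + 1) => Bool) (Fin (P.length + 1)) (Option Bool) where
  l := some (Fin.ofNat (P.length + 1) l)
  var := v
  stk k := s k.val

/-- In `t` steps the machine gets from address `a` and store `s` to address `b` and store `s'`. -/
def Reach (t : ℕ) (a : ℕ) (s : Store) (b : ℕ) (s' : Store) : Prop :=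
  -- The register is left open on both sides: a pop overwrites it before branching on it.
  ∀ v, ∃ v', (flip bind (Turing.TM2.step (stmts R P)))^[t] (some (config R P a v s)) =
    some (config R P b v' s')

variable {R P}

theorem Reach.refl (a : ℕ) (s : Store) : Reach R P 0 a s a s := fun v => ⟨v, rfl⟩

theorem Reach.trans {t₁ t₂ a b c : ℕ} {s₁ s₂ s₃ : Store} (h₁ : Reach R P t₁ a s₁ b s₂)
    (h₂ : Reach R P t₂ b s₂ c s₃) : Reach R P (t₁ + t₂) a s₁ c s₃ := by
  intro v
  obtain ⟨v₁, h₁⟩ := h₁ v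
  obtain ⟨v₂, h₂⟩ := h₂ v₁
  exact ⟨v₂, by rw [Nat.add_comm t₁, Function.iterate_add_apply, h₁, h₂]⟩

theorem restrict_update {r : ℕ} (hr : r ≤ R) (s : Store) (l : List Bool) :
    (fun k : Fin (R + 1) => update s r l k.val) =
      update (fun k : Fin (R + 1) => s k.val) (Fin.ofNat (R + 1) r) l := by
  funext k
  have : (Fin.ofNat (R + 1) r).val = r := Nat.mod_eq_of_lt (by omega)
  by_cases h : k = Fin.ofNat (R + 1) r
  · subst h; rw [this]; simp
  · rw [update_of_ne h, update_of_ne]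
    intro h'
    exact h (Fin.ext (h'.trans this.symm))

theorem step_config {a : ℕ} (ha : a ≤ P.length) (v : Option Bool) (s : Store) :
    Turing.TM2.step (stmts R P) (config R P a v s) =
      some (Turing.TM2.stepAux (Instr.stmt R P a P[a]?) v (fun k => s k.val)) := by
  have : (Fin.ofNat (P.length + 1) a).val = a := Nat.mod_eq_of_lt (by omega)
  simp only [config, Turing.TM2.step, stmts, this]

theorem ofNat_stack {r : ℕ} (hr : r ≤ R) (s : Store) : s (Fin.ofNat (R + 1) r).val = s r := by
  congr 1
  exact Nat.mod_eq_of_lt (by omega)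

theorem reach_push {a r : ℕ} {b : Bool} (h : P[a]? = some (.push r b)) (hr : r ≤ R) (s : Store) :
    Reach R P 1 a s (a + 1) (update s r (b :: s r)) := by
  intro v
  refine ⟨v, ?_⟩
  refine (step_config (List.getElem?_eq_some_iff.1 h).1.le v s).trans ?_
  simp only [h, Instr.stmt, Turing.TM2.stepAux, config, restrict_update hr, ofNat_stack hr]

theorem reach_jump {a l : ℕ} (h : P[a]? = some (.jump l)) (s : Store) :
    Reach R P 1 a s l s := by
  intro v
  refine ⟨v, ?_⟩
  refine (step_config (List.getElem?_eq_some_iff.1 h).1.le v s).trans ?_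
  simp only [h, Instr.stmt, Turing.TM2.stepAux, config]

theorem reach_pop {a r e t f : ℕ} (h : P[a]? = some (.pop r e t f)) (hr : r ≤ R) (s : Store) :
    Reach R P 1 a s (match (s r).head? with | none => e | some true => t | some false => f)
      (update s r (s r).tail) := by
  intro v
  refine ⟨(s r).head?, ?_⟩
  refine (step_config (List.getElem?_eq_some_iff.1 h).1.le v s).trans ?_
  simp only [h, Instr.stmt, Turing.TM2.stepAux, config, restrict_update hr, ofNat_stack hr]
  rcases (s r).head? with _ | _ | _ <;> rfl

/-- Induction on the run, for all addresses at which the code may sit. A further round of a loop is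
a run of the same loop at the same address, so the jump back leads to the situation of the induction
hypothesis. -/
theorem Run.reach {c : Cmd} {s s' : Store} {t : ℕ} (h : Run c s s' t) :
    ∀ a, (∀ i < c.size, P[a + i]? = (c.code a)[i]?) → c.width ≤ R →
      Reach R P t a s (a + c.size) s' := by
  -- The addresses of the five pieces of a loop: pop, first body, jump back, second body, final
  -- jump.
  have loopCode : ∀ {a r : ℕ} {ct cf : Cmd} {again : Bool},
      (∀ i < (loop r ct cf again).size, P[a + i]? = ((loop r ct cf again).code a)[i]?) →
      P[a]? = some (.pop r (a + (ct.size + cf.size + 3)) (a + 1) (a + ct.size + 2)) ∧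
      (∀ i < ct.size, P[a + 1 + i]? = (ct.code (a + 1))[i]?) ∧
      P[a + 1 + ct.size]? = some (.jump a) ∧
      (∀ i < cf.size, P[a + ct.size + 2 + i]? = (cf.code (a + ct.size + 2))[i]?) ∧
      P[a + ct.size + 2 + cf.size]? =
        some (.jump (if again then a else a + (ct.size + cf.size + 3))) := by
    intro a r ct cf again h
    simp only [Cmd.size, Cmd.code] at h
    refine ⟨?_, ?_, ?_, ?_, ?_⟩
    · simpa using h 0 (by omega)
    · intro i hi
      rw [add_assoc, h (1 + i) (by omega)]
      simp [List.getElem?_append, Cmd.length_code, hi, add_comm 1 i]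
    · rw [add_assoc, h (1 + ct.size) (by omega)]
      simp [Cmd.length_code, add_comm 1]
    · intro i hi
      rw [show a + ct.size + 2 + i = a + (i + ct.size + 2) by omega, h _ (by omega)]
      simp [List.getElem?_append, Cmd.length_code]
      have h1 : ¬ (i + ct.size + 1 < ct.size) := by omega
      have h2 : i + ct.size + 1 - ct.size = i + 1 := by omega
      simp [h1, h2, List.getElem?_append, Cmd.length_code, hi]
    · rw [show a + ct.size + 2 + cf.size = a + (cf.size + ct.size + 2) by omega, h _ (by omega)]
      simp [List.getElem?_append, Cmd.length_code]
      have h1 : ¬ (cf.size + ct.size + 1 < ct.size) := by omega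
      have h2 : cf.size + ct.size + 1 - ct.size = cf.size + 1 := by omega
      simp [h1, h2, Cmd.length_code]
  induction h with
  | skip s => intro a _ _; exact Reach.refl a s
  | push r b s =>
    intro a h hr
    simp only [Cmd.width] at hr
    exact reach_push (by simpa [Cmd.code] using h 0 (by simp [Cmd.size])) hr s
  | pop r s =>
    intro a h hr
    simp only [Cmd.width] at hr
    have := reach_pop (R := R) (by simpa [Cmd.code] using h 0 (by simp [Cmd.size])) hr s
    rcases hs : (s r).head? with _ | _ | _ <;> simpa [hs, Cmd.size] using this
  | @seq c d s₁ s₂ s₃ t₁ t₂ _ _ ih₁ ih₂ =>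
    intro a h hw
    simp only [Cmd.size, Cmd.code, Cmd.width, max_le_iff] at h hw ⊢
    rw [← add_assoc]
    refine (ih₁ a (fun i hi => ?_) hw.1).trans (ih₂ (a + c.size) (fun i hi => ?_) hw.2)
    · rw [h i (by omega), List.getElem?_append_left (by rwa [Cmd.length_code])]
    · rw [add_assoc, h _ (by omega), List.getElem?_append_right (by simp [Cmd.length_code])]
      simp [Cmd.length_code]
  | @loop_nil r ct cf again s hs =>
    intro a h hw
    obtain ⟨h1, -⟩ := loopCode h
    simp only [Cmd.width, max_le_iff] at hw
    have := reach_pop (R := R) h1 hw.1 s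
    simpa [hs, Cmd.size] using this
  | @loop_true r ct cf again s₁ s₂ s₃ l t₁ t₂ hs _ _ ih₁ ih₂ =>
    intro a h hw
    have h0 := ih₂ a h hw
    obtain ⟨h1, h2, h3, -⟩ := loopCode h
    simp only [Cmd.width, max_le_iff] at hw
    have := reach_pop (R := R) h1 hw.1 s₁
    simp only [hs, List.head?_cons, List.tail_cons] at this
    exact this.trans ((ih₁ _ h2 hw.2.1).trans ((reach_jump h3 _).trans h0))
  | @loop_again r ct cf s₁ s₂ s₃ l t₁ t₂ hs _ _ ih₁ ih₂ =>
    intro a h hw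
    have h0 := ih₂ a h hw
    obtain ⟨h1, -, -, h2, h3⟩ := loopCode h
    simp only [Cmd.width, max_le_iff] at hw
    have := reach_pop (R := R) h1 hw.1 s₁
    simp only [hs, List.head?_cons, List.tail_cons] at this
    exact this.trans ((ih₁ _ h2 hw.2.2).trans ((reach_jump (by simpa using h3) _).trans h0))
  | @loop_exit r ct cf s₁ s₂ l t₁ hs _ ih₁ =>
    intro a h hw
    obtain ⟨h1, -, -, h2, h3⟩ := loopCode h
    simp only [Cmd.width, max_le_iff] at hw
    have := reach_pop (R := R) h1 hw.1 s₁
    simp only [hs, List.head?_cons, List.tail_cons] at this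
    exact this.trans ((ih₁ _ h2 hw.2.2).trans (reach_jump (by simpa [Cmd.size] using h3) _))

end Machine

/-- A program that empties all stacks but the output stack `1` yields a machine. -/
theorem Run.outputsInTime {c : Cmd} {x y : List Bool} {t : ℕ} {R : ℕ} (hR : c.width ≤ R)
    (hR' : 1 ≤ R)
    (h : Run c (update (fun _ => []) 0 x) (update (fun _ => []) 1 y) t) :
    Nonempty (Turing.TM2OutputsInTime (machine R (c.code 0)) x (some y) (t + 1)) := by
  obtain ⟨v, hv⟩ := h.reach (R := R) (P := c.code 0) 0 (by simp) hR none
  have h0 : Turing.initList (machine R (c.code 0)) x =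
      config R (c.code 0) 0 none (update (fun _ => []) 0 x) := by
    refine (Turing.TM2.Cfg.mk.injEq ..).mpr ⟨rfl, rfl, ?_⟩
    refine Eq.trans ?_ (restrict_update (Nat.zero_le R) (fun _ => []) x).symm
    funext k
    by_cases hk : k = Fin.ofNat (R + 1) 0
    · subst hk
      exact Eq.trans (dif_pos rfl) (update_self (β := fun _ => List Bool) _ x _).symm
    · exact Eq.trans (dif_neg hk) (update_of_ne (β := fun _ => List Bool) hk x (fun _ => [])).symm
  -- The extra step is the halting instruction behind the code.
  refine ⟨⟨⟨t + 1, ?_⟩, le_rfl⟩⟩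
  rw [h0, add_comm, Function.iterate_add_apply]
  refine (congrArg _ hv).trans ?_
  refine (step_config (by rw [Cmd.length_code, zero_add]) v _).trans ?_
  rw [List.getElem?_eq_none (by rw [Cmd.length_code, zero_add])]
  refine congrArg some ((Turing.TM2.Cfg.mk.injEq ..).mpr ⟨rfl, rfl, ?_⟩)
  rw [restrict_update hR' (fun _ => []) y]
  funext k
  by_cases hk : k = Fin.ofNat (R + 1) 1
  · subst hk
    refine (update_self (β := fun _ => List Bool) _ y _).trans (Eq.symm ?_)
    exact dif_pos rfl
  · refine (update_of_ne (β := fun _ => List Bool) hk y _).trans (Eq.symm ?_)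
    exact dif_neg hk

end StackProg

/-! ### Time bounds and basic programs -/

namespace StackProg

open Function

/-- The program `c` takes the store `s` to `s'` in at most `T` steps. -/
def RunLE (c : Cmd) (s s' : Store) (T : ℕ) : Prop := ∃ t ≤ T, Run c s s' t

theorem RunLE.mono {c : Cmd} {s s' : Store} {T T' : ℕ} (h : RunLE c s s' T) (hT : T ≤ T') :
    RunLE c s s' T' := by
  obtain ⟨t, ht, h⟩ := h
  exact ⟨t, ht.trans hT, h⟩

theorem RunLE.seq {c d : Cmd} {s₁ s₂ s₃ : Store} {T₁ T₂ : ℕ} (h₁ : RunLE c s₁ s₂ T₁)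
    (h₂ : RunLE d s₂ s₃ T₂) : RunLE (c.seq d) s₁ s₃ (T₁ + T₂) := by
  obtain ⟨t₁, ht₁, h₁⟩ := h₁
  obtain ⟨t₂, ht₂, h₂⟩ := h₂
  exact ⟨t₁ + t₂, by omega, h₁.seq h₂⟩

theorem RunLE.congr {c : Cmd} {s s₁ s₂ : Store} {T : ℕ} (h : RunLE c s s₁ T) (hs : s₁ = s₂) :
    RunLE c s s₂ T := hs ▸ h

theorem RunLE.skip (s : Store) : RunLE .skip s s 0 := ⟨0, le_rfl, .skip s⟩

theorem RunLE.push (r : ℕ) (b : Bool) (s : Store) :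
    RunLE (.push r b) s (update s r (b :: s r)) 1 := ⟨1, le_rfl, .push r b s⟩

theorem RunLE.pop (r : ℕ) (s : Store) :
    RunLE (.pop r) s (update s r (s r).tail) 1 := ⟨1, le_rfl, .pop r s⟩

theorem RunLE.loop_nil {r : ℕ} {ct cf : Cmd} {again : Bool} {s : Store} (h : s r = []) :
    RunLE (.loop r ct cf again) s s 1 :=
  ⟨1, le_rfl, by simpa [← h] using Run.loop_nil (ct := ct) (cf := cf) (again := again) h⟩

theorem RunLE.loop_true {r : ℕ} {ct cf : Cmd} {again : Bool} {s₁ s₂ s₃ : Store} {l : List Bool}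
    {T₁ T₂ : ℕ} (h : s₁ r = true :: l) (h₁ : RunLE ct (update s₁ r l) s₂ T₁)
    (h₂ : RunLE (.loop r ct cf again) s₂ s₃ T₂) :
    RunLE (.loop r ct cf again) s₁ s₃ (T₁ + 2 + T₂) := by
  obtain ⟨t₁, ht₁, h₁⟩ := h₁
  obtain ⟨t₂, ht₂, h₂⟩ := h₂
  exact ⟨_, by omega, h₁.loop_true h h₂⟩

theorem RunLE.loop_again {r : ℕ} {ct cf : Cmd} {s₁ s₂ s₃ : Store} {l : List Bool}
    {T₁ T₂ : ℕ} (h : s₁ r = false :: l) (h₁ : RunLE cf (update s₁ r l) s₂ T₁)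
    (h₂ : RunLE (.loop r ct cf true) s₂ s₃ T₂) :
    RunLE (.loop r ct cf true) s₁ s₃ (T₁ + 2 + T₂) := by
  obtain ⟨t₁, ht₁, h₁⟩ := h₁
  obtain ⟨t₂, ht₂, h₂⟩ := h₂
  exact ⟨_, by omega, h₁.loop_again h h₂⟩

theorem RunLE.loop_exit {r : ℕ} {ct cf : Cmd} {s₁ s₂ : Store} {l : List Bool}
    {T₁ : ℕ} (h : s₁ r = false :: l) (h₁ : RunLE cf (update s₁ r l) s₂ T₁) :
    RunLE (.loop r ct cf false) s₁ s₂ (T₁ + 2) := by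
  obtain ⟨t₁, ht₁, h₁⟩ := h₁
  exact ⟨_, by omega, h₁.loop_exit h⟩

/-- `S i` is the store after `i` rounds on `true`. What follows round `n` is left open, because a
loop ends at the empty stack or at a separator `false`. -/
theorem RunLE.loop_prefix {r : ℕ} {ct cf : Cmd} {again : Bool} {T T' : ℕ} {s' : Store} (n : ℕ) :
    ∀ (S : ℕ → Store), (∀ i < n, ∃ l, S i r = true :: l ∧ RunLE ct (update (S i) r l) (S (i + 1)) T) →
    RunLE (.loop r ct cf again) (S n) s' T' →
    RunLE (.loop r ct cf again) (S 0) s' (n * (T + 2) + T') := by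
  induction n with
  | zero => intro S _ h; simpa using h
  | succ n ih =>
    intro S hS h
    obtain ⟨l, hl, h0⟩ := hS 0 (by omega)
    have := ih (fun i => S (i + 1)) (fun i hi => hS (i + 1) (by omega)) h
    exact (RunLE.loop_true hl h0 this).mono (by ring_nf; omega)

theorem RunLE.loop_all {r : ℕ} {ct cf : Cmd} {again : Bool} {T : ℕ} {n : ℕ}
    (S : ℕ → Store) (hn : S n r = [])
    (hS : ∀ i < n, ∃ l, S i r = true :: l ∧ RunLE ct (update (S i) r l) (S (i + 1)) T) :
    RunLE (.loop r ct cf again) (S 0) (S n) (n * (T + 2) + 1) :=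
  RunLE.loop_prefix n S hS (RunLE.loop_nil hn)

/-- A number as the contents of a stack. -/
abbrev unary (n : ℕ) : List Bool := List.replicate n true

theorem unary_sub {i n : ℕ} (h : i < n) : unary (n - i) = true :: unary (n - (i + 1)) := by
  rw [show n - i = (n - (i + 1)) + 1 by omega]
  rfl

theorem unaryString_cons (v : ℕ) (l : List ℕ) :
    unaryString (v :: l) = unary v ++ false :: unaryString l := by
  simp [unaryString]

theorem unaryString_append (l l' : List ℕ) :
    unaryString (l ++ l') = unaryString l ++ unaryString l' := by
  simp [unaryString]

theorem le_length_unaryString {v : ℕ} {l : List ℕ} (h : v ∈ l) : v ≤ (unaryString l).length := by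
  induction l with
  | nil => simp at h
  | cons a l ih =>
    rw [unaryString_cons]
    rcases List.mem_cons.1 h with rfl | h
    · simp
    · have := ih h
      simp; omega

theorem getD_le_length_unaryString (l : List ℕ) (k : ℕ) :
    l.getD k 0 ≤ (unaryString l).length := by
  rcases lt_or_ge k l.length with h | h
  · rw [List.getD_eq_getElem _ _ h]
    exact le_length_unaryString (List.getElem_mem h)
  · rw [List.getD_eq_default _ _ h]
    omega

/-- Empties a stack. -/
def clear (r : ℕ) : Cmd := .loop r .skip .skip true

/-- Pours a stack onto another one. -/
def pour (r d : ℕ) : Cmd := .loop r (.push d true) (.push d false) true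

/-- Adds the number on stack `r` to stack `d`, with the help of stack `tmp`. -/
def copy (r d tmp : ℕ) : Cmd :=
  .seq (.loop r (.seq (.push d true) (.push tmp true)) .skip true) (pour tmp r)

/-- Adds a constant to a stack. -/
def addConst (d : ℕ) : ℕ → Cmd
  | 0 => .skip
  | n + 1 => .seq (.push d true) (addConst d n)

theorem run_clear (r : ℕ) (l : List Bool) : ∀ (s : Store), s r = l →
    RunLE (clear r) s (update s r []) (l.length * 2 + 1) := by
  induction l with
  | nil =>
    intro s hs
    exact (RunLE.loop_nil hs).congr (by simp [← hs])
  | cons b l ih =>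
    intro s hs
    have := ih (update s r l) (by simp)
    rw [update_idem] at this
    cases b
    · exact (RunLE.loop_again hs (RunLE.skip _) this).mono (by simp; omega)
    · exact (RunLE.loop_true hs (RunLE.skip _) this).mono (by simp; omega)

theorem run_pour {r d : ℕ} (h : r ≠ d) (l : List Bool) : ∀ (s : Store), s r = l →
    RunLE (pour r d) s (update (update s r []) d (l.reverse ++ s d)) (l.length * 3 + 1) := by
  induction l with
  | nil =>
    intro s hs
    refine (RunLE.loop_nil hs).congr ?_
    rw [List.reverse_nil, List.nil_append, ← hs, update_eq_self, update_eq_self]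
  | cons b l ih =>
    intro s hs
    have := ih (update (update s r l) d (b :: s d)) (by simp [h])
    have e : update (update (update (update s r l) d (b :: s d)) r []) d
        (l.reverse ++ (update (update s r l) d (b :: s d)) d) =
        update (update s r []) d ((b :: l).reverse ++ s d) := by
      funext x
      by_cases h1 : x = d <;> by_cases h2 : x = r <;> simp_all
    rw [e] at this
    cases b
    · refine (RunLE.loop_again hs ((RunLE.push d false _).congr ?_) this).mono (by simp; omega)
      simp [Ne.symm h]
    · refine (RunLE.loop_true hs ((RunLE.push d true _).congr ?_) this).mono (by simp; omega)
      simp [Ne.symm h]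

theorem run_pour_unary {r d n m : ℕ} (h : r ≠ d) {s : Store} (hr : s r = unary n)
    (hd : s d = unary m) :
    RunLE (pour r d) s (update (update s r []) d (unary (n + m))) (n * 3 + 1) := by
  have := run_pour h _ s hr
  simpa [hd] using this

/-- Reading a stack destroys it, so the loop moves the number to both `d` and `tmp`, and `tmp`
restores `r`. -/
theorem run_copy {r d tmp n : ℕ} (h1 : r ≠ d) (h2 : r ≠ tmp) (h3 : d ≠ tmp) {s : Store}
    (hr : s r = unary n) (hd : s d = []) (ht : s tmp = []) :
    RunLE (copy r d tmp) s (update s d (unary n)) (n * 7 + 2) := by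
  have key := RunLE.loop_all (r := r) (ct := .seq (.push d true) (.push tmp true)) (cf := .skip)
    (again := true) (T := 2) (n := n)
    (fun i => update (update (update s r (unary (n - i))) d (unary i)) tmp (unary i))
    (by simp [h1, h2]) (by
      intro i hi
      refine ⟨unary (n - (i + 1)), by simp [h1, h2, unary_sub hi], ?_⟩
      refine ((RunLE.push _ _ _).seq (RunLE.push _ _ _)).congr ?_
      funext x
      by_cases hx1 : x = d
      · subst hx1; simp [h3, Ne.symm h1, List.replicate_succ]
      by_cases hx2 : x = tmp
      · subst hx2; simp [Ne.symm h3, Ne.symm h2, List.replicate_succ]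
      by_cases hx3 : x = r <;> simp [hx1, hx2, hx3, h1, h2])
  have e0 : (update (update (update s r (unary (n - 0))) d (unary 0)) tmp (unary 0)) = s := by
    funext x
    by_cases hx1 : x = d
    · subst hx1; simp [h3, hd]
    by_cases hx2 : x = tmp
    · subst hx2; simp [ht]
    by_cases hx3 : x = r
    · subst hx3; simp [h1, h2, hr]
    simp [hx1, hx2, hx3]
  have key2 := run_pour_unary (s := update (update (update s r (unary (n - n))) d (unary n)) tmp
    (unary n)) (Ne.symm h2) (n := n) (m := 0) (by simp) (by simp [h1, h2])
  simp only [e0] at key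
  refine ((key.seq key2).congr ?_).mono (by omega)
  funext x
  by_cases hx1 : x = d
  · subst hx1; simp [h3, Ne.symm h1]
  by_cases hx2 : x = tmp
  · subst hx2; simp [Ne.symm h2, Ne.symm h3, ht]
  by_cases hx3 : x = r
  · subst hx3; simp [h1, hr]
  simp [hx1, hx2, hx3]

theorem run_addConst (d n : ℕ) : ∀ (s : Store) (m : ℕ), s d = unary m →
    RunLE (addConst d n) s (update s d (unary (n + m))) n := by
  induction n with
  | zero => intro s m h; exact (RunLE.skip s).congr (by simp [← h])
  | succ n ih =>
    intro s m h
    have := ih (update s d (true :: s d)) (m + 1) (by simp [h, List.replicate_succ])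
    refine (((RunLE.push d true s).seq this).congr ?_).mono (by omega)
    rw [update_idem, show n + (m + 1) = n + 1 + m by omega]

/-- Popping an empty stack changes nothing, which is precisely truncated subtraction. -/
theorem run_monus {r d n m : ℕ} (h : r ≠ d) {s : Store} (hr : s r = unary n)
    (hd : s d = unary m) :
    RunLE (.loop r (.pop d) .skip true) s (update (update s r []) d (unary (m - n)))
      (n * 3 + 1) := by
  have key := RunLE.loop_all (r := r) (ct := .pop d) (cf := .skip)
    (again := true) (T := 1) (n := n)
    (fun i => update (update s r (unary (n - i))) d (unary (m - i)))
    (by simp [h]) (by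
      intro i hi
      refine ⟨unary (n - (i + 1)), by simp [h, unary_sub hi], ?_⟩
      refine (RunLE.pop _ _).congr ?_
      funext x
      by_cases hx1 : x = d
      · subst hx1; simp [Ne.symm h]; omega
      by_cases hx3 : x = r <;> simp [hx1, hx3, h])
  have e0 : update (update s r (unary (n - 0))) d (unary (m - 0)) = s := by
    funext x
    by_cases hx1 : x = d
    · subst hx1; simp [hd]
    by_cases hx3 : x = r
    · subst hx3; simp [h, hr]
    simp [hx1, hx3]
  simp only [e0] at key
  exact key.congr (by simp)

/-- Replaces the number `k` on stack `d` by entry `k` of the list of numbers on stack `0`, with the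
help of stack `1`. -/
def readEntry (d : ℕ) : Cmd :=
  .seq (.loop d (.loop 0 (.push 1 true) (.push 1 false) false) .skip true)
    (.seq (.loop 0 (.seq (.push 1 true) (.push d true)) (.push 1 false) false) (pour 1 0))

/-- With `again = false` the loop stops behind the `false` that terminates an entry. On exhausted
input it stops at once, in accordance with `drop 1` and `take 1` of the empty list. -/
theorem run_skipEntry {s : Store} {inp : List ℕ} (h0 : s 0 = unaryString inp) :
    RunLE (.loop 0 (.push 1 true) (.push 1 false) false) s
      (update (update s 0 (unaryString (inp.drop 1))) 1
        ((unaryString (inp.take 1)).reverse ++ s 1)) ((unaryString inp).length * 3 + 3) := by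
  rcases inp with _ | ⟨v, inp⟩
  · refine ((RunLE.loop_nil (by simpa [unaryString] using h0)).congr ?_).mono (by omega)
    funext x
    by_cases hx : x = 1
    · subst hx; simp [unaryString]
    by_cases hx : x = 0
    · subst hx; simp [h0]
    simp_all
  · rw [unaryString_cons] at h0
    have key := RunLE.loop_prefix (r := 0) (ct := .push 1 true) (cf := .push 1 false)
      (again := false) (T := 1) v
      (fun i => update (update s 0 (unary (v - i) ++ false :: unaryString inp)) 1
        (unary i ++ s 1)) (by
        intro i hi
        refine ⟨unary (v - (i + 1)) ++ false :: unaryString inp, by simp [unary_sub hi], ?_⟩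
        refine (RunLE.push _ _ _).congr ?_
        funext x
        by_cases hx : x = 1
        · subst hx; simp [List.replicate_succ]
        by_cases hx0 : x = 0
        · subst hx0; simp
        simp [hx, hx0])
      (RunLE.loop_exit (l := unaryString inp) (by simp) (RunLE.push 1 false _))
    have e0 : update (update s 0 (unary (v - 0) ++ false :: unaryString inp)) 1
        (unary 0 ++ s 1) = s := by
      funext x
      by_cases hx : x = 1
      · subst hx; simp
      by_cases hx0 : x = 0
      · subst hx0; simp [h0]
      simp [hx, hx0]
    simp only [e0] at key
    refine (key.congr ?_).mono (by simp [unaryString_cons])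
    funext x
    by_cases hx : x = 1
    · subst hx; simp [unaryString]
    by_cases hx0 : x = 0
    · subst hx0; simp
    simp [hx, hx0]

theorem run_takeEntry {s : Store} {inp : List ℕ} {d : ℕ} (hd : 2 ≤ d)
    (h0 : s 0 = unaryString inp) (hs : s d = []) :
    RunLE (.loop 0 (.seq (.push 1 true) (.push d true)) (.push 1 false) false) s
      (update (update (update s 0 (unaryString (inp.drop 1))) 1
        ((unaryString (inp.take 1)).reverse ++ s 1)) d (unary (inp.getD 0 0)))
        ((unaryString inp).length * 4 + 3) := by
  have d0 : d ≠ 0 := by omega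
  have d1 : d ≠ 1 := by omega
  have d0' : 0 ≠ d := by omega
  have d1' : 1 ≠ d := by omega
  rcases inp with _ | ⟨v, inp⟩
  · refine ((RunLE.loop_nil (by simpa [unaryString] using h0)).congr ?_).mono (by omega)
    funext x
    by_cases hx : x = d
    · subst hx; simp [hs]
    by_cases hx : x = 1
    · subst hx; simp [unaryString, d1']
    by_cases hx : x = 0
    · subst hx; simp [h0, d0']
    simp_all
  · rw [unaryString_cons] at h0
    have key := RunLE.loop_prefix (r := 0) (ct := .seq (.push 1 true) (.push d true))
      (cf := .push 1 false) (again := false) (T := 2) v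
      (fun i => update (update (update s 0 (unary (v - i) ++ false :: unaryString inp)) 1
        (unary i ++ s 1)) d (unary i)) (by
        intro i hi
        refine ⟨unary (v - (i + 1)) ++ false :: unaryString inp, by simp [unary_sub hi, d0'], ?_⟩
        refine ((RunLE.push _ _ _).seq (RunLE.push _ _ _)).congr ?_
        funext x
        by_cases hx : x = d
        · subst hx; simp [List.replicate_succ, d1, d0]
        by_cases hx : x = 1
        · subst hx; simp [List.replicate_succ, d1']
        by_cases hx0 : x = 0
        · subst hx0; simp [d0']
        simp_all)
      (RunLE.loop_exit (l := unaryString inp) (by simp [d0']) (RunLE.push 1 false _))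
    have e0 : update (update (update s 0 (unary (v - 0) ++ false :: unaryString inp)) 1
        (unary 0 ++ s 1)) d (unary 0) = s := by
      funext x
      by_cases hx : x = d
      · subst hx; simp [hs]
      by_cases hx : x = 1
      · subst hx; simp [d1']
      by_cases hx0 : x = 0
      · subst hx0; simp [h0, d0']
      simp_all
    simp only [e0] at key
    refine (key.congr ?_).mono (by simp [unaryString_cons])
    funext x
    by_cases hx : x = d
    · subst hx; simp [d1, d0]
    by_cases hx : x = 1
    · subst hx; simp [unaryString, d1']
    by_cases hx0 : x = 0
    · subst hx0; simp [d0']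
    simp_all

/-- The entries passed over pile up in reverse on stack `1`, and pouring them back restores the
input. A position beyond the end yields the default `0`. -/
theorem run_readEntry {s : Store} {inp : List ℕ} {d k : ℕ} (hd : 2 ≤ d)
    (h0 : s 0 = unaryString inp) (h1 : s 1 = []) (hk : s d = unary k) :
    RunLE (readEntry d) s (update s d (unary (inp.getD k 0)))
      (k * ((unaryString inp).length * 3 + 5) + (unaryString inp).length * 7 + 5) := by
  have d0 : d ≠ 0 := by omega
  have d1 : d ≠ 1 := by omega
  have d0' : 0 ≠ d := by omega
  have d1' : 1 ≠ d := by omega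
  have hlen : ∀ i, (unaryString (inp.drop i)).length ≤ (unaryString inp).length := by
    intro i
    conv_rhs => rw [← List.take_append_drop i inp, unaryString_append]
    simp
  have hlen' : ∀ i, (unaryString (inp.take i)).length ≤ (unaryString inp).length := by
    intro i
    conv_rhs => rw [← List.take_append_drop i inp, unaryString_append]
    simp
  have htake : ∀ i, inp.take (i + 1) = inp.take i ++ (inp.drop i).take 1 := by
    intro i; rw [List.take_add]
  have key1 := RunLE.loop_all (r := d) (ct := .loop 0 (.push 1 true) (.push 1 false) false)
    (cf := .skip) (again := true) (T := (unaryString inp).length * 3 + 3) (n := k)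
    (fun i => update (update (update s 0 (unaryString (inp.drop i))) 1
      (unaryString (inp.take i)).reverse) d (unary (k - i)))
    (by simp) (by
      intro i hi
      refine ⟨unary (k - (i + 1)), by simp [unary_sub hi], ?_⟩
      refine ((run_skipEntry (inp := inp.drop i) (by simp [d0'])).congr ?_).mono
        (by have := hlen i; omega)
      funext x
      by_cases hx : x = d
      · subst hx; simp [d1, d0]
      by_cases hx : x = 1
      · subst hx; simp [d1', htake, unaryString_append]
      by_cases hx0 : x = 0
      · subst hx0; simp [d0']
      simp_all)
  have e0 : update (update (update s 0 (unaryString (inp.drop 0))) 1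
      (unaryString (inp.take 0)).reverse) d (unary (k - 0)) = s := by
    funext x
    by_cases hx : x = d
    · subst hx; simp [hk]
    by_cases hx : x = 1
    · subst hx; simp [d1', h1, unaryString]
    by_cases hx0 : x = 0
    · subst hx0; simp [h0, d0']
    simp_all
  simp only [e0] at key1
  have key2 := run_takeEntry (s := update (update (update s 0 (unaryString (inp.drop k))) 1
    (unaryString (inp.take k)).reverse) d (unary (k - k))) (inp := inp.drop k) hd
    (by simp [d0']) (by simp)
  have key3 := run_pour (r := 1) (d := 0) (by norm_num) _ _
    (show _ = (unaryString (inp.take (k + 1))).reverse from ?_) |> key2.seq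
  · refine ((key1.seq key3).congr ?_).mono ?_
    · funext x
      by_cases hx : x = d
      · subst hx; simp [d0, d1]
      by_cases hx : x = 0
      · subst hx
        simp only [List.reverse_reverse, update_self, ne_eq, d0', not_false_eq_true,
          update_of_ne, zero_ne_one, h0, List.drop_drop]
        rw [← unaryString_append, List.take_append_drop]
      by_cases hx0 : x = 1
      · subst hx0; simp [d1', h1]
      simp_all
    · have := hlen k
      have := hlen' (k + 1)
      simp only [List.length_reverse]
      ring_nf at *
      omega
  · simp [d1', htake k, unaryString_append]

end StackProg

/-! ### Arithmetic expressions with polynomial bounds -/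

namespace StackProg

open Function

/-- Arithmetic expressions over a list of input numbers and an environment. The bound variables of
`sum a b` (the index) and `iterW a b` (the index and the accumulator) are appended to the
environment. `iterW` iterates as often as the first input number says. -/
inductive Ex
  | var (k : ℕ)
  | const (c : ℕ)
  | add (a b : Ex)
  | sub (a b : Ex)
  | inp (a : Ex)
  | sum (a b : Ex)
  | iterW (a b : Ex)
  | app1 (f a : Ex)
  | app2 (f a b : Ex)

/-- The value of an expression. -/
def Ex.eval (inp : List ℕ) : Ex → List ℕ → ℕ
  | var k, env => env.getD k 0
  | const c, _ => c
  | add a b, env => a.eval inp env + b.eval inp env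
  | sub a b, env => a.eval inp env - b.eval inp env
  | .inp a, env => inp.getD (a.eval inp env) 0
  | sum a b, env => ∑ i ∈ Finset.range (a.eval inp env), b.eval inp (env ++ [i])
  | iterW a b, env =>
      Nat.rec (a.eval inp env) (fun i acc => b.eval inp (env ++ [i, acc])) (inp.getD 0 0)
  | app1 f a, env => f.eval inp [a.eval inp env]
  | app2 f a b, env => f.eval inp [a.eval inp env, b.eval inp env]

/-- A loop on the counter `sb` with accumulator `sb + 1` and index `sb + 2`, whose body leaves the
next accumulator on `sb + 3`. -/
def foldLoop (sb : ℕ) (count init body : Cmd) : Cmd :=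
  .seq count (.seq init (.seq
    (.loop sb (.seq body (.seq (pour (sb + 3) (sb + 1)) (.push (sb + 2) true))) .skip true)
    (.seq (clear (sb + 2)) (pour (sb + 1) sb))))

/-- The program that evaluates an expression. The variables are on the stacks `vars`, the stacks
from `sb` on are free, and the value is left on stack `sb`. -/
def Ex.comp : Ex → List ℕ → ℕ → Cmd
  | var k, vars, sb => match vars[k]? with
    | none => .skip
    | some r => copy r sb (sb + 1)
  | const c, _, sb => addConst sb c
  | add a b, vars, sb =>
      .seq (a.comp vars sb) (.seq (b.comp vars (sb + 1)) (pour (sb + 1) sb))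
  | sub a b, vars, sb =>
      .seq (a.comp vars sb) (.seq (b.comp vars (sb + 1)) (.loop (sb + 1) (.pop sb) .skip true))
  | inp a, vars, sb => .seq (a.comp vars sb) (readEntry sb)
  | sum a b, vars, sb => foldLoop sb (a.comp vars sb) .skip
      (.seq (b.comp (vars ++ [sb + 2]) (sb + 3)) (pour (sb + 1) (sb + 3)))
  | iterW a b, vars, sb => foldLoop sb (readEntry sb) (a.comp vars (sb + 1))
      (.seq (b.comp (vars ++ [sb + 2, sb + 1]) (sb + 3)) (clear (sb + 1)))
  | app1 f a, vars, sb =>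
      .seq (a.comp vars sb) (.seq (f.comp [sb] (sb + 1)) (.seq (clear sb) (pour (sb + 1) sb)))
  | app2 f a b, vars, sb =>
      .seq (a.comp vars sb) (.seq (b.comp vars (sb + 1)) (.seq (f.comp [sb, sb + 1] (sb + 2))
        (.seq (clear sb) (.seq (clear (sb + 1)) (pour (sb + 2) sb)))))

/-- The store holds the input and the variables, and the stacks from `sb` on are free. -/
structure Ready (inp vars env : List ℕ) (sb : ℕ) (s : Store) : Prop where
  input : s 0 = unaryString inp
  scratch : s 1 = []
  vars : List.Forall₂ (fun r v => (3 ≤ r ∧ r < sb) ∧ s r = unary v) vars env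
  base : 3 ≤ sb
  free : ∀ r, sb ≤ r → s r = []

/-- Stack `2` is exempt: it collects the output, and no expression looks at it. -/
theorem Ready.of_agree {inp vars env : List ℕ} {sb sb' : ℕ} {s s' : Store}
    (h : Ready inp vars env sb s) (hsb : sb ≤ sb') (hs : ∀ r < sb, r ≠ 2 → s' r = s r)
    (hfree : ∀ r, sb' ≤ r → s' r = []) : Ready inp vars env sb' s' where
  input := by rw [hs 0 (by have := h.base; omega) (by omega), h.input]
  scratch := by rw [hs 1 (by have := h.base; omega) (by omega), h.scratch]
  vars := h.vars.imp fun r v hr => ⟨by omega, by rw [hs r (by omega) (by omega), hr.2]⟩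
  base := h.base.trans hsb
  free := hfree

theorem Ready.append {inp vars env : List ℕ} {sb : ℕ} {s : Store} {vars' env' : List ℕ}
    (h : Ready inp vars env sb s)
    (h' : List.Forall₂ (fun r v => (3 ≤ r ∧ r < sb) ∧ s r = unary v) vars' env') :
    Ready inp (vars ++ vars') (env ++ env') sb s where
  input := h.input
  scratch := h.scratch
  vars := List.rel_append h.vars h'
  base := h.base
  free := h.free

theorem Ready.update {inp vars env : List ℕ} {sb : ℕ} {s : Store}
    (h : Ready inp vars env sb s) (l : List Bool) :
    Ready inp vars env (sb + 1) (update s sb l) :=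
  h.of_agree (by omega) (fun r hr _ => update_of_ne (by omega) _ _) fun r hr => by
    rw [update_of_ne (by omega)]; exact h.free r (by omega)

/-- The store during `foldLoop`, with counter `j`, accumulator `a` and index `i`. -/
def foldStore (s : Store) (sb j a i : ℕ) : Store :=
  update (update (update s sb (unary j)) (sb + 1) (unary a)) (sb + 2) (unary i)

/-- `acc i` is the accumulator after `i` rounds. The body only has to clear the old accumulator and
leave the new one on `sb + 3`; the loop moves it down and advances the index. The body has to work
for any value `j` of the remaining count. -/
theorem run_foldLoop {s : Store} {sb n T₁ T₂ T₃ V : ℕ} {count init body : Cmd} (acc : ℕ → ℕ)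
    (hfree : ∀ r, sb ≤ r → s r = [])
    (hcount : RunLE count s (update s sb (unary n)) T₁)
    (hinit : RunLE init (update s sb (unary n))
      (update (update s sb (unary n)) (sb + 1) (unary (acc 0))) T₂)
    (hV : ∀ i ≤ n, acc i ≤ V)
    (hbody : ∀ i < n, ∀ j < n, RunLE body (foldStore s sb j (acc i) i)
      (update (update (foldStore s sb j (acc i) i) (sb + 1) []) (sb + 3) (unary (acc (i + 1)))) T₃) :
    RunLE (foldLoop sb count init body) s (update s sb (unary (acc n)))
      (T₁ + (T₂ + (n * (T₃ + V * 3 + 4) + 1 + (n * 2 + 1 + (V * 3 + 1))))) := by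
  have key := RunLE.loop_all (r := sb)
    (ct := .seq body (.seq (pour (sb + 3) (sb + 1)) (.push (sb + 2) true))) (cf := .skip)
    (again := true) (n := n) (T := T₃ + (V * 3 + 2))
    (fun i => foldStore s sb (n - i) (acc i) i) (by simp [foldStore])
    (by
      intro i hi
      refine ⟨unary (n - (i + 1)), by simp [foldStore, unary_sub hi], ?_⟩
      have e : update (foldStore s sb (n - i) (acc i) i) sb (unary (n - (i + 1))) =
          foldStore s sb (n - (i + 1)) (acc i) i := by
        funext x
        by_cases h1 : x = sb
        · subst h1; simp [foldStore]
        by_cases h2 : x = sb + 1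
        · subst h2; simp [foldStore]
        by_cases h3 : x = sb + 2
        · subst h3; simp [foldStore]
        simp [foldStore, h1, h2, h3]
      rw [e]
      have h1 := hbody i hi (n - (i + 1)) (by omega)
      have h2 := run_pour_unary (r := sb + 3) (d := sb + 1) (n := acc (i + 1)) (m := 0) (by omega)
        (s := update (update (foldStore s sb (n - (i + 1)) (acc i) i) (sb + 1) []) (sb + 3)
          (unary (acc (i + 1)))) (by simp) (by simp)
      refine ((h1.seq (h2.seq (RunLE.push _ _ _))).congr ?_).mono
        (by have := hV (i + 1) (by omega); omega)
      funext x
      by_cases h1 : x = sb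
      · subst h1; simp [foldStore]
      by_cases h2 : x = sb + 1
      · subst h2; simp [foldStore]
      by_cases h3 : x = sb + 2
      · subst h3; simp [foldStore, List.replicate_succ]
      by_cases h4 : x = sb + 3
      · subst h4; simp [foldStore, hfree]
      simp [foldStore, h1, h2, h3, h4])
  have e0 : update (update s sb (unary n)) (sb + 1) (unary (acc 0)) =
      foldStore s sb (n - 0) (acc 0) 0 := by
    funext x
    by_cases h3 : x = sb + 2
    · subst h3; simp [foldStore, hfree]
    simp [foldStore, h3]
  rw [e0] at hinit
  have h4 := run_clear (sb + 2) (unary n) (foldStore s sb (n - n) (acc n) n) (by simp [foldStore])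
  have h5 := run_pour_unary (r := sb + 1) (d := sb) (n := acc n) (m := 0) (by omega)
    (s := update (foldStore s sb (n - n) (acc n) n) (sb + 2) []) (by simp [foldStore])
    (by simp [foldStore])
  refine ((hcount.seq (hinit.seq (key.seq (h4.seq h5)))).congr ?_).mono ?_
  · funext x
    by_cases h1 : x = sb
    · subst h1; simp
    by_cases h2 : x = sb + 1
    · subst h2; simp [hfree]
    by_cases h3 : x = sb + 2
    · subst h3; simp [hfree]
    simp [foldStore, h1, h2, h3]
  · have := hV n le_rfl
    simp only [List.length_replicate]
    have : n * (T₃ + (V * 3 + 2) + 2) = n * (T₃ + V * 3 + 4) := by ring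
    omega

/-- A constant factor moves into the exponent because `k ≤ 2 ^ k ≤ X ^ k`. All bounds thus keep the
shape `(B + 2) ^ c`. -/
theorem absorb {X c k d T : ℕ} (hX : 2 ≤ X) (hT : T ≤ k * (X ^ c) ^ d) : T ≤ X ^ (k + c * d) := by
  rw [pow_add, pow_mul]
  exact hT.trans (Nat.mul_le_mul_right _ ((Nat.lt_two_pow_self).le.trans
    (Nat.pow_le_pow_left hX k)))

/-- Substitution of one bound into another: `B' + 2 ≤ (B + 2) ^ c * (B + 2) ^ 2`. -/
theorem compose_bound {B c c' B' : ℕ} (h : B' ≤ (B + 2) ^ c) :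
    (B' + 2) ^ c' ≤ (B + 2) ^ ((c + 2) * c') := by
  rw [pow_mul]
  refine Nat.pow_le_pow_left ?_ _
  have : 1 ≤ (B + 2) ^ c := Nat.one_le_pow _ _ (by omega)
  have : 4 ≤ (B + 2) ^ 2 := Nat.pow_le_pow_left (show 2 ≤ B + 2 by omega) 2
  rw [pow_add]
  nlinarith

theorem absorb_linear {X c k T : ℕ} (hX : 2 ≤ X) (hT : T ≤ k * X ^ c) : T ≤ X ^ (k + c) := by
  have := absorb (c := c) (k := k) (T := T) (d := 1) hX (by rwa [pow_one])
  rwa [mul_one] at this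

/-- The program of an expression is correct, and for every first input number it obeys a polynomial
bound on its value and running time. -/
def Ex.Good (e : Ex) : Prop :=
  ∀ W, ∃ c, ∀ (inp vars env : List ℕ) (sb : ℕ) (s : Store) (B : ℕ),
    Ready inp vars env sb s → inp.getD 0 0 = W → (unaryString inp).length ≤ B →
    (∀ v ∈ env, v ≤ B) → e.eval inp env ≤ (B + 2) ^ c ∧
    RunLE (e.comp vars sb) s (update s sb (unary (e.eval inp env))) ((B + 2) ^ c)

theorem le_pow_of_le {X c c' v : ℕ} (hX : 2 ≤ X) (h : v ≤ X ^ c) (hc : c ≤ c') : v ≤ X ^ c' :=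
  h.trans (Nat.pow_le_pow_right (by omega) hc)

theorem Ex.good_var (k : ℕ) : (Ex.var k).Good := by
  intro W
  refine ⟨9 + 1, fun inp vars env sb s B hs hW hB henv => ?_⟩
  have hv := hs.vars
  rcases h : vars[k]? with _ | r
  · have h' : env[k]? = none := by
      rw [List.getElem?_eq_none_iff] at h ⊢
      rwa [← hv.length_eq]
    have e : (Ex.var k).eval inp env = 0 := by simp [Ex.eval, h']
    rw [e]
    refine ⟨by omega, ?_⟩
    simp only [Ex.comp, h]
    refine ((RunLE.skip s).congr ?_).mono (by omega)
    simp [← hs.free sb le_rfl]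
  · obtain ⟨hk, hr⟩ := List.getElem?_eq_some_iff.1 h
    have hk' : k < env.length := by rwa [← hv.length_eq]
    have e : (Ex.var k).eval inp env = env[k] := by simp [Ex.eval, hk']
    have hget := hv.get hk hk'
    simp only [List.get_eq_getElem, hr] at hget
    rw [e]
    have hle := henv _ (List.getElem_mem hk')
    have hpow := pow_one (B + 2)
    refine ⟨absorb_linear (by omega) (by omega), ?_⟩
    simp only [Ex.comp, h]
    refine (run_copy (by omega) (by omega) (by omega) hget.2 (hs.free _ le_rfl)
      (hs.free _ (by omega))).mono (absorb_linear (by omega) ?_)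
    omega

theorem Ex.good_const (n : ℕ) : (Ex.const n).Good := by
  intro W
  refine ⟨n, fun inp vars env sb s B hs hW hB henv => ?_⟩
  have : n ≤ (B + 2) ^ n := (Nat.lt_two_pow_self).le.trans (Nat.pow_le_pow_left (by omega) n)
  refine ⟨this, ?_⟩
  have := (run_addConst sb n s 0 (hs.free _ le_rfl)).mono this
  simpa [Ex.comp, Ex.eval] using this

theorem Ex.Good.add {a b : Ex} (ha : a.Good) (hb : b.Good) : (Ex.add a b).Good := by
  intro W
  obtain ⟨c₁, h₁⟩ := ha W
  obtain ⟨c₂, h₂⟩ := hb W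
  refine ⟨6 + (c₁ + c₂), fun inp vars env sb s B hs hW hB henv => ?_⟩
  obtain ⟨v₁, r₁⟩ := h₁ inp vars env sb s B hs hW hB henv
  obtain ⟨v₂, r₂⟩ := h₂ inp vars env (sb + 1) _ B (hs.update _) hW hB henv
  have hX : 2 ≤ B + 2 := by omega
  have hY := Nat.one_le_pow (c₁ + c₂) (B + 2) (by omega)
  have p₁ : (B + 2) ^ c₁ ≤ (B + 2) ^ (c₁ + c₂) := le_pow_of_le hX le_rfl (by omega)
  have p₂ : (B + 2) ^ c₂ ≤ (B + 2) ^ (c₁ + c₂) := le_pow_of_le hX le_rfl (by omega)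
  refine ⟨absorb_linear hX (by simp only [Ex.eval]; omega), ?_⟩
  have r₃ := run_pour_unary (r := sb + 1) (d := sb) (n := b.eval inp env) (m := a.eval inp env)
    (s := Function.update (Function.update s sb (unary (a.eval inp env))) (sb + 1)
      (unary (b.eval inp env))) (by omega) (by simp) (by simp)
  refine ((r₁.seq (r₂.seq r₃)).congr ?_).mono (absorb_linear hX (by omega))
  funext x
  by_cases h1 : x = sb
  · subst h1; simp [Ex.eval, add_comm]
  by_cases h2 : x = sb + 1
  · subst h2; simp [hs.free]
  simp [h1, h2]

theorem Ex.Good.sub {a b : Ex} (ha : a.Good) (hb : b.Good) : (Ex.sub a b).Good := by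
  intro W
  obtain ⟨c₁, h₁⟩ := ha W
  obtain ⟨c₂, h₂⟩ := hb W
  refine ⟨6 + (c₁ + c₂), fun inp vars env sb s B hs hW hB henv => ?_⟩
  obtain ⟨v₁, r₁⟩ := h₁ inp vars env sb s B hs hW hB henv
  obtain ⟨v₂, r₂⟩ := h₂ inp vars env (sb + 1) _ B (hs.update _) hW hB henv
  have hX : 2 ≤ B + 2 := by omega
  have hY := Nat.one_le_pow (c₁ + c₂) (B + 2) (by omega)
  have p₁ : (B + 2) ^ c₁ ≤ (B + 2) ^ (c₁ + c₂) := le_pow_of_le hX le_rfl (by omega)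
  have p₂ : (B + 2) ^ c₂ ≤ (B + 2) ^ (c₁ + c₂) := le_pow_of_le hX le_rfl (by omega)
  refine ⟨absorb_linear hX (by simp only [Ex.eval]; omega), ?_⟩
  have r₃ := run_monus (r := sb + 1) (d := sb) (n := b.eval inp env) (m := a.eval inp env)
    (s := Function.update (Function.update s sb (unary (a.eval inp env))) (sb + 1)
      (unary (b.eval inp env))) (by omega) (by simp) (by simp)
  refine ((r₁.seq (r₂.seq r₃)).congr ?_).mono (absorb_linear hX (by omega))
  funext x
  by_cases h1 : x = sb
  · subst h1; simp [Ex.eval]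
  by_cases h2 : x = sb + 1
  · subst h2; simp [hs.free]
  simp [h1, h2]

theorem Ex.Good.inp {a : Ex} (ha : a.Good) : (Ex.inp a).Good := by
  intro W
  obtain ⟨c₁, h₁⟩ := ha W
  refine ⟨21 + (c₁ + 1) * 2, fun inp vars env sb s B hs hW hB henv => ?_⟩
  obtain ⟨v₁, r₁⟩ := h₁ inp vars env sb s B hs hW hB henv
  have hX : 2 ≤ B + 2 := by omega
  have hb := hs.base
  have r₂ := run_readEntry (s := Function.update s sb (unary (a.eval inp env))) (inp := inp)
    (d := sb) (k := a.eval inp env) (by omega) (by simp [hs.input, show 0 ≠ sb by omega])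
    (by simp [hs.scratch, show 1 ≠ sb by omega]) (by simp)
  have p₁ : (B + 2) ^ c₁ ≤ (B + 2) ^ (c₁ + 1) := le_pow_of_le hX le_rfl (by omega)
  have p₂ : B + 2 ≤ (B + 2) ^ (c₁ + 1) := by
    calc B + 2 = (B + 2) ^ 1 := (pow_one _).symm
      _ ≤ _ := le_pow_of_le hX le_rfl (by omega)
  have p₃ : (B + 2) ^ (c₁ + 1) ≤ ((B + 2) ^ (c₁ + 1)) ^ 2 := by
    rw [pow_two]; exact Nat.le_mul_of_pos_left _ (by omega)
  have hle := getD_le_length_unaryString inp (a.eval inp env)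
  refine ⟨absorb hX (by simp only [Ex.eval]; omega), ?_⟩
  refine ((r₁.seq r₂).congr (by simp [Ex.eval])).mono (absorb hX ?_)
  have : a.eval inp env * ((unaryString inp).length * 3 + 5) ≤
      (B + 2) ^ (c₁ + 1) * ((B + 2) ^ (c₁ + 1) * 5) :=
    Nat.mul_le_mul (v₁.trans p₁) (by omega)
  rw [show (B + 2) ^ (c₁ + 1) * ((B + 2) ^ (c₁ + 1) * 5) = 5 * ((B + 2) ^ (c₁ + 1)) ^ 2 by ring]
    at this
  omega

/-- The function sees an environment that consists of its argument alone, so the numbers of its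
variables do not depend on the place of use. The argument may exceed `B`, hence the larger bound
`max B ((B + 2) ^ c₁)`. -/
theorem Ex.Good.app1 {f a : Ex} (hf : f.Good) (ha : a.Good) : (Ex.app1 f a).Good := by
  intro W
  obtain ⟨c₁, h₁⟩ := ha W
  obtain ⟨c₂, h₂⟩ := hf W
  refine ⟨9 + (c₁ + (c₁ + 1 + 2) * c₂), fun inp vars env sb s B hs hW hB henv => ?_⟩
  obtain ⟨v₁, r₁⟩ := h₁ inp vars env sb s B hs hW hB henv
  have hs1 := hs.update (unary (a.eval inp env))
  have hX : 2 ≤ B + 2 := by omega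
  have hbase := hs.base
  have hY := Nat.one_le_pow c₁ (B + 2) (by omega)
  have hB' : max B ((B + 2) ^ c₁) ≤ (B + 2) ^ (c₁ + 1) := by
    rw [pow_succ]
    exact max_le (by nlinarith) (by nlinarith)
  obtain ⟨v₂, r₂⟩ := h₂ inp [sb] [a.eval inp env] (sb + 1) _ (max B ((B + 2) ^ c₁))
    ⟨hs1.input, hs1.scratch, by simp; omega, hs1.base, hs1.free⟩ hW (le_max_of_le_left hB)
    (by simp only [List.mem_singleton, forall_eq]; exact le_max_of_le_right v₁)
  replace v₂ := v₂.trans (compose_bound hB')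
  replace r₂ := r₂.mono (compose_bound hB')
  have p₁ : (B + 2) ^ c₁ ≤ (B + 2) ^ (c₁ + (c₁ + 1 + 2) * c₂) :=
    le_pow_of_le hX le_rfl (by omega)
  have p₂ : (B + 2) ^ ((c₁ + 1 + 2) * c₂) ≤ (B + 2) ^ (c₁ + (c₁ + 1 + 2) * c₂) :=
    le_pow_of_le hX le_rfl (by omega)
  refine ⟨absorb_linear hX (by simp only [Ex.eval]; omega), ?_⟩
  have r₃ := run_clear sb (unary (a.eval inp env))
    (Function.update (Function.update s sb (unary (a.eval inp env))) (sb + 1)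
      (unary (f.eval inp [a.eval inp env]))) (by simp)
  have r₄ := run_pour_unary (r := sb + 1) (d := sb) (n := f.eval inp [a.eval inp env]) (m := 0)
    (s := Function.update (Function.update (Function.update s sb (unary (a.eval inp env))) (sb + 1)
      (unary (f.eval inp [a.eval inp env]))) sb []) (by omega) (by simp) (by simp)
  refine ((r₁.seq (r₂.seq (r₃.seq r₄))).congr ?_).mono (absorb_linear hX ?_)
  · funext x
    by_cases h1 : x = sb
    · subst h1; simp [Ex.eval]
    by_cases h2 : x = sb + 1
    · subst h2; simp [hs.free]
    simp [h1, h2]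
  · simp only [List.length_replicate]
    omega

theorem Ex.Good.app2 {f a b : Ex} (hf : f.Good) (ha : a.Good) (hb : b.Good) :
    (Ex.app2 f a b).Good := by
  intro W
  obtain ⟨c₁, h₁⟩ := ha W
  obtain ⟨c₃, h₃⟩ := hb W
  obtain ⟨c₂, h₂⟩ := hf W
  refine ⟨15 + (c₁ + c₃ + (c₁ + c₃ + 1 + 2) * c₂), 
    fun inp vars env sb s B hs hW hB henv => ?_⟩
  obtain ⟨v₁, r₁⟩ := h₁ inp vars env sb s B hs hW hB henv
  have hs1 := hs.update (unary (a.eval inp env))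
  obtain ⟨v₃, r₃⟩ := h₃ inp vars env (sb + 1) _ B hs1 hW hB henv
  have hs2 := hs1.update (unary (b.eval inp env))
  have hX : 2 ≤ B + 2 := by omega
  have hbase := hs.base
  have q₁ : (B + 2) ^ c₁ ≤ (B + 2) ^ (c₁ + c₃) := le_pow_of_le hX le_rfl (by omega)
  have q₃ : (B + 2) ^ c₃ ≤ (B + 2) ^ (c₁ + c₃) := le_pow_of_le hX le_rfl (by omega)
  have hY := Nat.one_le_pow (c₁ + c₃) (B + 2) (by omega)
  have hB' : max B ((B + 2) ^ (c₁ + c₃)) ≤ (B + 2) ^ (c₁ + c₃ + 1) := by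
    rw [pow_succ]
    exact max_le (by nlinarith) (by nlinarith)
  obtain ⟨v₂, r₂⟩ := h₂ inp [sb, sb + 1] [a.eval inp env, b.eval inp env] (sb + 1 + 1) _
    (max B ((B + 2) ^ (c₁ + c₃)))
    ⟨hs2.input, hs2.scratch, by simp; omega, hs2.base, hs2.free⟩ hW (le_max_of_le_left hB)
    (by
      intro v hv
      simp only [List.mem_cons, List.not_mem_nil, or_false] at hv
      rcases hv with rfl | rfl <;> exact le_max_of_le_right (by omega))
  replace v₂ := v₂.trans (compose_bound hB')
  replace r₂ := r₂.mono (compose_bound hB')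
  have p₁ : (B + 2) ^ (c₁ + c₃) ≤ (B + 2) ^ (c₁ + c₃ + (c₁ + c₃ + 1 + 2) * c₂) :=
    le_pow_of_le hX le_rfl (by omega)
  have p₂ : (B + 2) ^ ((c₁ + c₃ + 1 + 2) * c₂) ≤ (B + 2) ^ (c₁ + c₃ + (c₁ + c₃ + 1 + 2) * c₂) :=
    le_pow_of_le hX le_rfl (by omega)
  refine ⟨absorb_linear hX (by simp only [Ex.eval]; omega), ?_⟩
  have r₅ := run_clear sb (unary (a.eval inp env))
    (Function.update (Function.update (Function.update s sb (unary (a.eval inp env))) (sb + 1)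
      (unary (b.eval inp env))) (sb + 1 + 1)
      (unary (f.eval inp [a.eval inp env, b.eval inp env]))) (by rw [update_of_ne (by omega), update_of_ne (by omega), update_self])
  have r₆ := run_clear (sb + 1) (unary (b.eval inp env)) (Function.update
    (Function.update (Function.update (Function.update s sb (unary (a.eval inp env))) (sb + 1)
      (unary (b.eval inp env))) (sb + 1 + 1)
      (unary (f.eval inp [a.eval inp env, b.eval inp env]))) sb []) (by simp)
  have r₇ := run_pour_unary (r := sb + 2) (d := sb)
    (n := f.eval inp [a.eval inp env, b.eval inp env]) (m := 0)
    (s := Function.update (Function.update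
    (Function.update (Function.update (Function.update s sb (unary (a.eval inp env))) (sb + 1)
      (unary (b.eval inp env))) (sb + 1 + 1)
      (unary (f.eval inp [a.eval inp env, b.eval inp env]))) sb []) (sb + 1) []) (by omega)
      (by simp) (by simp)
  refine ((r₁.seq (r₃.seq (r₂.seq (r₅.seq (r₆.seq r₇))))).congr ?_).mono (absorb_linear hX ?_)
  · funext x
    by_cases h1 : x = sb
    · subst h1; simp [Ex.eval]
    by_cases h2 : x = sb + 1
    · subst h2; simp [hs.free]
    by_cases h2 : x = sb + 2
    · subst h2; simp [hs.free]
    simp_all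
  · simp only [List.length_replicate]
    omega

theorem Ready.foldStore {inp vars env : List ℕ} {sb : ℕ} {s : Store}
    (h : Ready inp vars env sb s) (j a i : ℕ) :
    Ready inp vars env (sb + 3) (foldStore s sb j a i) :=
  ((h.update _).update _).update _

/-- There are at most `Y` rounds, and the body is bounded by `Y` uniformly in the index. Each round
moves an accumulator of size at most `Y ^ 2`, which makes the time cubic in `Y`. -/
theorem Ex.Good.sum {a b : Ex} (ha : a.Good) (hb : b.Good) : (Ex.sum a b).Good := by
  intro W
  obtain ⟨c₁, h₁⟩ := ha W
  obtain ⟨c₂, h₂⟩ := hb W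
  refine ⟨21 + (c₁ + (c₁ + 1 + 2) * c₂) * 3, fun inp vars env sb s B hs hW hB henv => ?_⟩
  obtain ⟨v₁, r₁⟩ := h₁ inp vars env sb s B hs hW hB henv
  have hX : 2 ≤ B + 2 := by omega
  have hbase := hs.base
  have hY := Nat.one_le_pow c₁ (B + 2) (by omega)
  have hB' : max B ((B + 2) ^ c₁) ≤ (B + 2) ^ (c₁ + 1) := by
    rw [pow_succ]
    exact max_le (by nlinarith) (by nlinarith)
  set n := a.eval inp env with hn
  set acc : ℕ → ℕ := fun k => ∑ i ∈ Finset.range k, b.eval inp (env ++ [i]) with hacc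
  have hbody : ∀ i < n, ∀ j x, b.eval inp (env ++ [i]) ≤ (B + 2) ^ ((c₁ + 1 + 2) * c₂) ∧
      RunLE (b.comp (vars ++ [sb + 2]) (sb + 3)) (StackProg.foldStore s sb j x i)
        (Function.update (StackProg.foldStore s sb j x i) (sb + 3)
          (unary (b.eval inp (env ++ [i])))) ((B + 2) ^ ((c₁ + 1 + 2) * c₂)) := by
    intro i hi j x
    have := h₂ inp (vars ++ [sb + 2]) (env ++ [i]) (sb + 3) (StackProg.foldStore s sb j x i)
      (max B ((B + 2) ^ c₁))
      ((hs.foldStore j x i).append (by simp [StackProg.foldStore]; omega)) hW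
      (le_max_of_le_left hB) (by
        intro v hv
        rcases List.mem_append.1 hv with hv | hv
        · exact le_max_of_le_left (henv v hv)
        · rw [List.mem_singleton.1 hv]
          exact le_max_of_le_right (by omega))
    exact ⟨this.1.trans (compose_bound hB'), this.2.mono (compose_bound hB')⟩
  have p₁ : (B + 2) ^ c₁ ≤ (B + 2) ^ (c₁ + (c₁ + 1 + 2) * c₂) :=
    le_pow_of_le hX le_rfl (by omega)
  have p₂ : (B + 2) ^ ((c₁ + 1 + 2) * c₂) ≤ (B + 2) ^ (c₁ + (c₁ + 1 + 2) * c₂) :=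
    le_pow_of_le hX le_rfl (by omega)
  set Y := (B + 2) ^ (c₁ + (c₁ + 1 + 2) * c₂) with hYdef
  have hY1 : 1 ≤ Y := hY.trans p₁
  have hYY : Y ≤ Y ^ 2 := by rw [pow_two]; exact Nat.le_mul_of_pos_left _ hY1
  have hYYY : Y ^ 2 ≤ Y ^ 3 := Nat.pow_le_pow_right hY1 (by omega)
  have hV : ∀ i ≤ n, acc i ≤ Y ^ 2 := by
    intro i hi
    calc acc i ≤ ∑ _j ∈ Finset.range i, Y := Finset.sum_le_sum fun j hj =>
          (hbody j (by have := Finset.mem_range.1 hj; omega) 0 0).1.trans p₂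
      _ = i * Y := by simp
      _ ≤ Y * Y := Nat.mul_le_mul_right _ (by omega)
      _ = Y ^ 2 := (pow_two Y).symm
  refine ⟨absorb hX ?_, ?_⟩
  · have := hV n le_rfl
    simp only [Ex.eval, ← hn]
    simp only [hacc] at this
    rw [← hYdef]
    omega
  have main := run_foldLoop (s := s) (sb := sb) (n := n) (count := a.comp vars sb)
    (init := .skip) (body := .seq (b.comp (vars ++ [sb + 2]) (sb + 3)) (pour (sb + 1) (sb + 3)))
    (T₁ := Y) (T₂ := 0) (T₃ := Y + (Y ^ 2 * 3 + 1)) (V := Y ^ 2) acc hs.free (r₁.mono p₁) (by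
      refine (RunLE.skip _).congr ?_
      simp [hacc, ← hs.free (sb + 1) (by omega)]) hV (by
      intro i hi j hj
      obtain ⟨-, r₂⟩ := hbody i hi j (acc i)
      have r₃ := run_pour_unary (r := sb + 1) (d := sb + 3) (n := acc i)
        (m := b.eval inp (env ++ [i]))
        (s := Function.update (StackProg.foldStore s sb j (acc i) i) (sb + 3)
          (unary (b.eval inp (env ++ [i])))) (by omega) (by simp [StackProg.foldStore]) (by simp)
      refine ((r₂.seq r₃).congr ?_).mono (by have := hV i hi.le; omega)
      have : acc (i + 1) = acc i + b.eval inp (env ++ [i]) := Finset.sum_range_succ _ _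
      rw [this]
      funext x
      by_cases h1 : x = sb + 3
      · subst h1; simp
      by_cases h2 : x = sb + 1
      · subst h2; simp
      simp [h1, h2])
  refine main.mono (absorb hX ?_)
  have hm : n * (Y + (Y ^ 2 * 3 + 1) + Y ^ 2 * 3 + 4) ≤ Y * (Y ^ 2 * 12) :=
    Nat.mul_le_mul (v₁.trans p₁) (by omega)
  rw [show Y * (Y ^ 2 * 12) = 12 * Y ^ 3 by ring] at hm
  rw [← hYdef]
  omega

end StackProg

namespace StackProg

open Function

theorem max_pow_le (B c : ℕ) : max B ((B + 2) ^ c) ≤ (B + 2) ^ (c + 1) := by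
  have hY := Nat.one_le_pow c (B + 2) (by omega)
  rw [pow_succ]
  exact max_le (by nlinarith) (by nlinarith)

/-- The accumulator of `iterW a b` after `k` rounds. -/
def Ex.iterAcc (inp env : List ℕ) (a b : Ex) (k : ℕ) : ℕ :=
  Nat.rec (a.eval inp env) (fun i acc => b.eval inp (env ++ [i, acc])) k

/-- Every round composes with one more polynomial, so the exponent grows with the number of rounds.
This is where `W` has to be fixed: there are `W` rounds, and the exponent depends on `W` but not on
the rest of the input. -/
theorem Ex.iterAcc_bound {a b : Ex} (ha : a.Good) (hb : b.Good) (W K : ℕ) (hK : K ≤ W) :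
    ∃ c, ∀ (inp vars env : List ℕ) (sb : ℕ) (s : Store) (B : ℕ),
      Ready inp vars env sb s → inp.getD 0 0 = W → (unaryString inp).length ≤ B →
      (∀ v ∈ env, v ≤ B) → ∀ k ≤ K, Ex.iterAcc inp env a b k ≤ (B + 2) ^ c := by
  induction K with
  | zero =>
    obtain ⟨c, h⟩ := ha W
    refine ⟨c, fun inp vars env sb s B hs hW hB henv k hk => ?_⟩
    rw [Nat.le_zero.1 hk]
    exact (h inp vars env sb s B hs hW hB henv).1
  | succ K ih =>
    obtain ⟨c₁, h₁⟩ := ih (by omega)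
    obtain ⟨c₂, h₂⟩ := hb W
    refine ⟨c₁ + (c₁ + 1 + 2) * c₂, fun inp vars env sb s B hs hW hB henv k hk => ?_⟩
    have hX : 2 ≤ B + 2 := by omega
    rcases Nat.lt_or_ge k (K + 1) with h | h
    · exact le_pow_of_le hX (h₁ inp vars env sb s B hs hW hB henv k (by omega)) (by omega)
    · obtain rfl : k = K + 1 := by omega
      have hacc := h₁ inp vars env sb s B hs hW hB henv K le_rfl
      have hbase := hs.base
      have hWB := hW ▸ getD_le_length_unaryString inp 0
      -- The bound on the value of `b` comes with a run, so some store is needed in which `b` can be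
      -- run; its counter `0` is irrelevant.
      have := (h₂ inp (vars ++ [sb + 2, sb + 1]) (env ++ [K, Ex.iterAcc inp env a b K]) (sb + 3)
        (foldStore s sb 0 (Ex.iterAcc inp env a b K) K) (max B ((B + 2) ^ c₁))
        ((hs.foldStore _ _ _).append (by simp [foldStore]; omega)) hW (le_max_of_le_left hB) (by
          intro v hv
          simp only [List.mem_append, List.mem_cons, List.not_mem_nil, or_false] at hv
          rcases hv with hv | rfl | rfl
          · exact le_max_of_le_left (henv v hv)
          · exact le_max_of_le_left (by omega)
          · exact le_max_of_le_right hacc)).1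
      exact le_pow_of_le hX (this.trans (compose_bound (max_pow_le B c₁))) (by omega)

theorem Ex.Good.iterW {a b : Ex} (ha : a.Good) (hb : b.Good) : (Ex.iterW a b).Good := by
  intro W
  obtain ⟨c₁, h₁⟩ := ha W
  obtain ⟨c₂, h₂⟩ := hb W
  obtain ⟨c₃, h₃⟩ := Ex.iterAcc_bound ha hb W W le_rfl
  refine ⟨35 + (c₁ + (c₃ + 1 + 2) * c₂ + c₃ + 1) * 2,
    fun inp vars env sb s B hs hW hB henv => ?_⟩
  obtain ⟨v₁, r₁⟩ := h₁ inp vars env (sb + 1) _ B (hs.update (unary W)) hW hB henv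
  have hV := h₃ inp vars env sb s B hs hW hB henv
  have hX : 2 ≤ B + 2 := by omega
  have hbase := hs.base
  have hWB := hW ▸ getD_le_length_unaryString inp 0
  set acc := Ex.iterAcc inp env a b with hacc
  have hbody : ∀ i < W, ∀ j,
      RunLE (b.comp (vars ++ [sb + 2, sb + 1]) (sb + 3)) (StackProg.foldStore s sb j (acc i) i)
        (Function.update (StackProg.foldStore s sb j (acc i) i) (sb + 3)
          (unary (acc (i + 1)))) ((B + 2) ^ ((c₃ + 1 + 2) * c₂)) := by
    intro i hi j
    have := h₂ inp (vars ++ [sb + 2, sb + 1]) (env ++ [i, acc i]) (sb + 3)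
      (StackProg.foldStore s sb j (acc i) i) (max B ((B + 2) ^ c₃))
      ((hs.foldStore j _ i).append (by simp [StackProg.foldStore]; omega)) hW
      (le_max_of_le_left hB) (by
        intro v hv
        simp only [List.mem_append, List.mem_cons, List.not_mem_nil, or_false] at hv
        rcases hv with hv | rfl | rfl
        · exact le_max_of_le_left (henv v hv)
        · exact le_max_of_le_left (by omega)
        · exact le_max_of_le_right (hV i hi.le))
    exact this.2.mono (compose_bound (max_pow_le B c₃))
  have p₁ : (B + 2) ^ c₁ ≤ (B + 2) ^ (c₁ + (c₃ + 1 + 2) * c₂ + c₃ + 1) :=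
    le_pow_of_le hX le_rfl (by omega)
  have p₂ : (B + 2) ^ ((c₃ + 1 + 2) * c₂) ≤ (B + 2) ^ (c₁ + (c₃ + 1 + 2) * c₂ + c₃ + 1) :=
    le_pow_of_le hX le_rfl (by omega)
  have p₃ : (B + 2) ^ c₃ ≤ (B + 2) ^ (c₁ + (c₃ + 1 + 2) * c₂ + c₃ + 1) :=
    le_pow_of_le hX le_rfl (by omega)
  have p₄ : B + 2 ≤ (B + 2) ^ (c₁ + (c₃ + 1 + 2) * c₂ + c₃ + 1) := by
    calc B + 2 = (B + 2) ^ 1 := (pow_one _).symm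
      _ ≤ _ := le_pow_of_le hX le_rfl (by omega)
  set Y := (B + 2) ^ (c₁ + (c₃ + 1 + 2) * c₂ + c₃ + 1) with hYdef
  have hY1 : 1 ≤ Y := by omega
  have hYY : Y ≤ Y ^ 2 := by rw [pow_two]; exact Nat.le_mul_of_pos_left _ hY1
  have heval : (Ex.iterW a b).eval inp env = acc W := by rw [← hW]; rfl
  rw [heval]
  refine ⟨absorb hX (by have := hV W le_rfl; rw [← hYdef]; omega), ?_⟩
  -- The empty stack `sb` is the number `0`, so that `readEntry` fetches the first input number,
  -- which is `W`.
  have r₀ := run_readEntry (s := s) (inp := inp) (d := sb) (k := 0) (by omega)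
    hs.input hs.scratch (hs.free _ le_rfl)
  rw [hW] at r₀
  have main := run_foldLoop (s := s) (sb := sb) (n := W) (count := readEntry sb)
    (init := a.comp vars (sb + 1))
    (body := .seq (b.comp (vars ++ [sb + 2, sb + 1]) (sb + 3)) (clear (sb + 1)))
    (T₁ := 7 * Y) (T₂ := Y) (T₃ := Y + (Y * 2 + 1)) (V := Y) acc hs.free (r₀.mono (by omega))
    (r₁.mono p₁) (fun i hi => (hV i hi).trans p₃) (by
      intro i hi j hj
      have r₂ := hbody i hi j
      have r₃ := run_clear (sb + 1) (unary (acc i))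
        (Function.update (StackProg.foldStore s sb j (acc i) i) (sb + 3)
          (unary (acc (i + 1)))) (by simp [StackProg.foldStore])
      refine ((r₂.seq r₃).congr ?_).mono (by
        have := (hV i hi.le).trans p₃
        simp only [List.length_replicate]
        omega)
      funext x
      by_cases h1 : x = sb + 3
      · subst h1; simp
      by_cases h2 : x = sb + 1
      · subst h2; simp
      simp [h1, h2])
  refine main.mono (absorb hX ?_)
  have hm : W * (Y + (Y * 2 + 1) + Y * 3 + 4) ≤ Y * (Y * 11) :=
    Nat.mul_le_mul (by omega) (by omega)
  rw [show Y * (Y * 11) = 11 * Y ^ 2 by ring] at hm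
  rw [← hYdef]
  omega

theorem Ex.good (e : Ex) : e.Good := by
  induction e with
  | var k => exact Ex.good_var k
  | const c => exact Ex.good_const c
  | add a b ha hb => exact ha.add hb
  | sub a b ha hb => exact ha.sub hb
  | inp a ha => exact ha.inp
  | sum a b ha hb => exact ha.sum hb
  | iterW a b ha hb => exact ha.iterW hb
  | app1 f a hf ha => exact hf.app1 ha
  | app2 f a b hf ha hb => exact hf.app2 ha hb

/-! ### Generators of lists of numbers -/

/-- Programs that generate a list of numbers. The index of `each` is appended to the environment. -/
inductive Gen
  | emit (e : Ex)
  | seq (g h : Gen)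
  | each (a : Ex) (g : Gen)

/-- The list that is generated. -/
def Gen.out (inp : List ℕ) : Gen → List ℕ → List ℕ
  | emit e, env => [e.eval inp env]
  | seq g h, env => g.out inp env ++ h.out inp env
  | each a g, env => (List.range (a.eval inp env)).flatMap fun i => g.out inp (env ++ [i])

/-- The program that pushes the bit string of the generated list on stack `2`. -/
def Gen.comp : Gen → List ℕ → ℕ → Cmd
  | emit e, vars, sb => .seq (e.comp vars sb) (.seq (pour sb 2) (.push 2 false))
  | seq g h, vars, sb => .seq (g.comp vars sb) (h.comp vars sb)
  | each a g, vars, sb => .seq (a.comp vars sb) (.seq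
      (.loop sb (.seq (g.comp (vars ++ [sb + 1]) (sb + 2)) (.push (sb + 1) true)) .skip true)
      (clear (sb + 1)))

/-- The store after the numbers `l` have been pushed on stack `2`. -/
def outStore (s : Store) (l : List ℕ) : Store :=
  update s 2 ((unaryString l).reverse ++ s 2)

theorem outStore_outStore (s : Store) (l l' : List ℕ) :
    outStore (outStore s l) l' = outStore s (l ++ l') := by
  simp [outStore, unaryString_append]

theorem outStore_of_ne {r : ℕ} (h : r ≠ 2) (s : Store) (l : List ℕ) : outStore s l r = s r :=
  update_of_ne h _ _

theorem Ready.outStore {inp vars env : List ℕ} {sb : ℕ} {s : Store}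
    (h : Ready inp vars env sb s) (l : List ℕ) : Ready inp vars env sb (outStore s l) :=
  h.of_agree le_rfl (fun _ _ h2 => outStore_of_ne h2 _ _) fun r hr => by
    rw [outStore_of_ne (by have := h.base; omega)]; exact h.free r hr

/-- The program of a generator is correct, and for every first input number it obeys a polynomial
bound on its output length and running time. -/
def Gen.Good (g : Gen) : Prop :=
  ∀ W, ∃ c, ∀ (inp vars env : List ℕ) (sb : ℕ) (s : Store) (B : ℕ),
    Ready inp vars env sb s → inp.getD 0 0 = W → (unaryString inp).length ≤ B →
    (∀ v ∈ env, v ≤ B) → (unaryString (g.out inp env)).length ≤ (B + 2) ^ c ∧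
    RunLE (g.comp vars sb) s (StackProg.outStore s (g.out inp env)) ((B + 2) ^ c)

theorem Gen.good_emit (e : Ex) : (Gen.emit e).Good := by
  intro W
  obtain ⟨c₁, h₁⟩ := e.good W
  refine ⟨6 + c₁, fun inp vars env sb s B hs hW hB henv => ?_⟩
  obtain ⟨v₁, r₁⟩ := h₁ inp vars env sb s B hs hW hB henv
  have hX : 2 ≤ B + 2 := by omega
  have hbase := hs.base
  have hY := Nat.one_le_pow c₁ (B + 2) (by omega)
  refine ⟨absorb_linear hX (by simp [Gen.out, unaryString]; omega), ?_⟩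
  have r₂ := run_pour (r := sb) (d := 2) (by omega) _ (update s sb (unary (e.eval inp env)))
    (update_self _ _ _)
  refine ((r₁.seq (r₂.seq (RunLE.push _ _ _))).congr ?_).mono
    (absorb_linear hX (by simp only [List.length_replicate]; omega))
  funext x
  have h2 : 2 ≠ sb := by omega
  by_cases h1 : x = 2
  · subst h1; simp [StackProg.outStore, Gen.out, unaryString, h2]
  by_cases h3 : x = sb
  · subst h3; simp [StackProg.outStore, h1, hs.free]
  simp [StackProg.outStore, h1, h3]

theorem Gen.Good.seq {g h : Gen} (hg : g.Good) (hh : h.Good) : (Gen.seq g h).Good := by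
  intro W
  obtain ⟨c₁, h₁⟩ := hg W
  obtain ⟨c₂, h₂⟩ := hh W
  refine ⟨2 + (c₁ + c₂), fun inp vars env sb s B hs hW hB henv => ?_⟩
  obtain ⟨v₁, r₁⟩ := h₁ inp vars env sb s B hs hW hB henv
  obtain ⟨v₂, r₂⟩ := h₂ inp vars env sb _ B (hs.outStore _) hW hB henv
  have hX : 2 ≤ B + 2 := by omega
  have p₁ : (B + 2) ^ c₁ ≤ (B + 2) ^ (c₁ + c₂) := le_pow_of_le hX le_rfl (by omega)
  have p₂ : (B + 2) ^ c₂ ≤ (B + 2) ^ (c₁ + c₂) := le_pow_of_le hX le_rfl (by omega)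
  refine ⟨absorb_linear hX ?_, ((r₁.seq r₂).congr ?_).mono (absorb_linear hX (by omega))⟩
  · simp only [Gen.out, unaryString_append, List.length_append]
    omega
  · simp [Gen.out, outStore_outStore]

theorem flatMap_range_succ (f : ℕ → List ℕ) (n : ℕ) :
    (List.range (n + 1)).flatMap f = (List.range n).flatMap f ++ f n := by
  simp [List.range_succ, List.flatMap_append]

theorem length_unaryString_flatMap_le (f : ℕ → List ℕ) (Y : ℕ) (n : ℕ)
    (h : ∀ i < n, (unaryString (f i)).length ≤ Y) :
    (unaryString ((List.range n).flatMap f)).length ≤ n * Y := by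
  induction n with
  | zero => simp [unaryString]
  | succ n ih =>
    rw [flatMap_range_succ, unaryString_append, List.length_append, add_mul, one_mul]
    exact add_le_add (ih fun i hi => h i (by omega)) (h n (by omega))

/-- The invariant is that stack `2` has received `L i`, the output of the first `i` rounds. -/
theorem Gen.Good.each {a : Ex} {g : Gen} (hg : g.Good) : (Gen.each a g).Good := by
  intro W
  obtain ⟨c₁, h₁⟩ := a.good W
  obtain ⟨c₂, h₂⟩ := hg W
  refine ⟨12 + (c₁ + (c₁ + 1 + 2) * c₂) * 2, fun inp vars env sb s B hs hW hB henv => ?_⟩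
  obtain ⟨v₁, r₁⟩ := h₁ inp vars env sb s B hs hW hB henv
  have hX : 2 ≤ B + 2 := by omega
  have hbase := hs.base
  have hY := Nat.one_le_pow c₁ (B + 2) (by omega)
  set n := a.eval inp env with hn
  set f : ℕ → List ℕ := fun i => g.out inp (env ++ [i]) with hf
  set L : ℕ → List ℕ := fun k => (List.range k).flatMap f with hL
  have p₁ : (B + 2) ^ c₁ ≤ (B + 2) ^ (c₁ + (c₁ + 1 + 2) * c₂) :=
    le_pow_of_le hX le_rfl (by omega)
  have p₂ : (B + 2) ^ ((c₁ + 1 + 2) * c₂) ≤ (B + 2) ^ (c₁ + (c₁ + 1 + 2) * c₂) :=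
    le_pow_of_le hX le_rfl (by omega)
  set Y := (B + 2) ^ (c₁ + (c₁ + 1 + 2) * c₂) with hYdef
  have hY1 : 1 ≤ Y := hY.trans p₁
  have hYY : Y ≤ Y ^ 2 := by rw [pow_two]; exact Nat.le_mul_of_pos_left _ hY1
  have hbody : ∀ i < n, ∀ (j : ℕ) (l : List ℕ), (unaryString (f i)).length ≤ Y ∧
      RunLE (g.comp (vars ++ [sb + 1]) (sb + 2))
        (StackProg.outStore (update (update s sb (unary j)) (sb + 1) (unary i)) l)
        (StackProg.outStore (update (update s sb (unary j)) (sb + 1) (unary i)) (l ++ f i)) Y := by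
    intro i hi j l
    have := h₂ inp (vars ++ [sb + 1]) (env ++ [i]) (sb + 2)
      (StackProg.outStore (update (update s sb (unary j)) (sb + 1) (unary i)) l)
      (max B ((B + 2) ^ c₁))
      ((((hs.update _).update _).outStore l).append (by
        simp [outStore_of_ne (show sb + 1 ≠ 2 by omega)]; omega)) hW (le_max_of_le_left hB) (by
        intro v hv
        rcases List.mem_append.1 hv with hv | hv
        · exact le_max_of_le_left (henv v hv)
        · rw [List.mem_singleton.1 hv]
          exact le_max_of_le_right (by omega))
    rw [outStore_outStore] at this
    exact ⟨this.1.trans ((compose_bound (max_pow_le B c₁)).trans p₂),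
      this.2.mono ((compose_bound (max_pow_le B c₁)).trans p₂)⟩
  refine ⟨absorb hX ?_, ?_⟩
  · rw [← hYdef]
    calc _ ≤ n * Y := length_unaryString_flatMap_le f Y n fun i hi => (hbody i hi 0 []).1
      _ ≤ Y * Y := Nat.mul_le_mul_right _ (by omega)
      _ = Y ^ 2 := (pow_two Y).symm
      _ ≤ _ := by omega
  have r₂ := RunLE.loop_all (r := sb)
    (ct := .seq (g.comp (vars ++ [sb + 1]) (sb + 2)) (.push (sb + 1) true)) (cf := .skip)
    (again := true) (n := n) (T := Y + 1)
    (fun i => StackProg.outStore (update (update s sb (unary (n - i))) (sb + 1) (unary i)) (L i))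
    (by simp [outStore_of_ne (show sb ≠ 2 by omega)]) (by
      intro i hi
      refine ⟨unary (n - (i + 1)),
        by simp [outStore_of_ne (show sb ≠ 2 by omega), unary_sub hi], ?_⟩
      have e : update (StackProg.outStore (update (update s sb (unary (n - i))) (sb + 1) (unary i))
          (L i)) sb (unary (n - (i + 1))) =
          StackProg.outStore (update (update s sb (unary (n - (i + 1)))) (sb + 1) (unary i))
          (L i) := by
        funext x
        by_cases h1 : x = sb
        · subst h1; simp [outStore_of_ne (show x ≠ 2 by omega)]
        by_cases h2 : x = 2
        · subst h2; simp [StackProg.outStore, h1, show 2 ≠ sb + 1 by omega]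
        simp [outStore_of_ne h2, h1, Function.update_apply]
      rw [e]
      refine ((hbody i hi _ _).2.seq (RunLE.push _ _ _)).congr ?_
      have eL : L (i + 1) = L i ++ f i := flatMap_range_succ f i
      rw [eL]
      funext x
      by_cases h1 : x = sb + 1
      · subst h1; simp [outStore_of_ne (show sb + 1 ≠ 2 by omega), List.replicate_succ]
      by_cases h2 : x = 2
      · subst h2; simp [StackProg.outStore, h1, show 2 ≠ sb by omega]
      simp [outStore_of_ne h2, h1])
  have r₃ := run_clear (sb + 1) (unary n)
    (StackProg.outStore (update (update s sb (unary (n - n))) (sb + 1) (unary n)) (L n))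
    (by simp [outStore_of_ne (show sb + 1 ≠ 2 by omega)])
  have e0 : update s sb (unary n) =
      StackProg.outStore (update (update s sb (unary (n - 0))) (sb + 1) (unary 0)) (L 0) := by
    funext x
    by_cases h1 : x = sb + 1
    · subst h1; simp [outStore_of_ne (show sb + 1 ≠ 2 by omega), hs.free]
    by_cases h2 : x = 2
    · subst h2; simp [StackProg.outStore, h1, hL, unaryString]
    simp [outStore_of_ne h2, h1]
  rw [e0] at r₁
  refine ((r₁.seq (r₂.seq r₃)).congr ?_).mono (absorb hX ?_)
  · funext x
    by_cases h1 : x = sb + 1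
    · subst h1; simp [outStore_of_ne (show sb + 1 ≠ 2 by omega), hs.free]
    by_cases h2 : x = 2
    · subst h2; simp [StackProg.outStore, h1, show 2 ≠ sb by omega]; rfl
    by_cases h3 : x = sb
    · subst h3; simp [outStore_of_ne h2, hs.free]
    simp [outStore_of_ne h2, h1, h3]
  · rw [← hYdef]
    have hm : n * (Y + 1 + 2) ≤ Y * (Y * 4) := Nat.mul_le_mul (by omega) (by omega)
    rw [show Y * (Y * 4) = 4 * Y ^ 2 by ring] at hm
    simp only [List.length_replicate]
    omega

theorem Gen.good (g : Gen) : g.Good := by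
  induction g with
  | emit e => exact Gen.good_emit e
  | seq g h hg hh => exact hg.seq hh
  | each a g hg => exact hg.each

/-- A generator is computed by a machine whose running time is, for every value of the first input
number, polynomial in the length of the input. -/
theorem Gen.exists_machine (g : Gen) :
    ∃ (M : Turing.TM2ComputableAux Bool Bool) (p : ℕ → Polynomial ℕ), ∀ inp : List ℕ,
      Nonempty (Turing.TM2OutputsInTime M.tm ((unaryString inp).map M.inputAlphabet.symm)
        (some ((unaryString (g.out inp [])).map M.outputAlphabet.symm))
        ((p (inp.getD 0 0)).eval (unaryString inp).length)) := by
  choose c hc using g.good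
  -- The output lies in reverse on stack `2`. Erasing the input and pouring stack `2` onto stack `1`
  -- leaves it in order, with all other stacks empty.
  let prog : Cmd := .seq (g.comp [] 3) (.seq (clear 0) (pour 2 1))
  refine ⟨⟨machine (prog.width + 1) (prog.code 0), Equiv.refl Bool, Equiv.refl Bool⟩,
    fun W => (Polynomial.X + 2) ^ (10 + (c W + 1)), fun inp => ?_⟩
  have hready : Ready inp [] [] 3 (update (fun _ => []) 0 (unaryString inp)) :=
    ⟨by simp, by simp, by simp, le_rfl, fun r hr => by rw [update_of_ne (by omega)]⟩
  obtain ⟨v, r₁⟩ := hc _ inp [] [] 3 _ _ hready rfl le_rfl (by simp)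
  set B := (unaryString inp).length with hB
  have hX : 2 ≤ B + 2 := by omega
  have r₂ := run_clear 0 (unaryString inp)
    (StackProg.outStore (update (fun _ => []) 0 (unaryString inp)) (g.out inp []))
    (by simp [StackProg.outStore])
  have r₃ := run_pour (r := 2) (d := 1) (by omega) (unaryString (g.out inp [])).reverse
    (update (StackProg.outStore (update (fun _ => []) 0 (unaryString inp)) (g.out inp [])) 0 [])
    (by simp [StackProg.outStore])
  have p₁ : (B + 2) ^ (c (inp.getD 0 0)) ≤ (B + 2) ^ (c (inp.getD 0 0) + 1) :=
    le_pow_of_le hX le_rfl (by omega)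
  have p₂ : B + 2 ≤ (B + 2) ^ (c (inp.getD 0 0) + 1) := by
    calc B + 2 = (B + 2) ^ 1 := (pow_one _).symm
      _ ≤ _ := le_pow_of_le hX le_rfl (by omega)
  obtain ⟨t, ht, r⟩ := ((r₁.seq (r₂.seq r₃)).congr (s₂ := update (fun _ => []) 1
    (unaryString (g.out inp []))) (by
      funext x
      by_cases h1 : x = 1
      · subst h1; simp [StackProg.outStore]
      by_cases h2 : x = 2
      · subst h2; simp
      by_cases h3 : x = 0
      · subst h3; simp
      simp [StackProg.outStore, h1, h2, h3]))
  obtain ⟨H⟩ := Run.outputsInTime (c := prog) (R := prog.width + 1) (by omega) (by omega) r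
  refine ⟨⟨⟨H.steps, ?_⟩, H.steps_le_m.trans ?_⟩⟩
  · have e : ∀ l : List Bool, l.map (Equiv.refl Bool).symm = l := fun l => List.map_id l
    refine Eq.trans (congrArg (fun l => (flip bind
      (machine (prog.width + 1) (prog.code 0)).step)^[H.steps] (some (Turing.initList
      (machine (prog.width + 1) (prog.code 0)) l))) (e _)) (H.evals_in_steps.trans ?_)
    exact (congrArg (fun l => some (Turing.haltList
      (machine (prog.width + 1) (prog.code 0)) l)) (e _)).symm
  · have : t + 1 ≤ (B + 2) ^ (10 + (c (inp.getD 0 0) + 1)) := absorb_linear hX (by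
      rw [List.length_reverse] at ht
      omega)
    simpa using this

end StackProg

/-! ### The long code and its tests -/

namespace LongCode

open Finset

variable {Ω : Type}

theorem zmod_two_add_self : ∀ a : ZMod 2, a + a = 0 := by decide

theorem fun_add_self (f : Ω → ZMod 2) : f + f = 0 := by
  funext p; exact zmod_two_add_self _

theorem add_eq_zero_iff_eq_of_two (f g : Ω → ZMod 2) : f + g = 0 ↔ f = g := by
  constructor
  · intro h
    have := congrArg (· + g) h
    simpa [add_assoc, fun_add_self] using this
  · rintro rfl; exact fun_add_self f

variable [Fintype Ω]

/-- The inner product over the field with two elements. -/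
def dot (S f : Ω → ZMod 2) : ZMod 2 := ∑ p, S p * f p

theorem dot_add (S f g : Ω → ZMod 2) : dot S (f + g) = dot S f + dot S g := by
  simp [dot, mul_add, sum_add_distrib]

theorem add_dot (S T f : Ω → ZMod 2) : dot (S + T) f = dot S f + dot T f := by
  simp [dot, add_mul, sum_add_distrib]

variable [DecidableEq Ω]

theorem dot_single (S : Ω → ZMod 2) (p : Ω) : dot S (Pi.single p 1) = S p := by
  simp [dot, Pi.single_apply]

theorem single_dot (f : Ω → ZMod 2) (p : Ω) : dot (Pi.single p 1) f = f p := by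
  simp [dot, Pi.single_apply]

/-- The sign `(-1) ^ a`. -/
def sgn (a : ZMod 2) : ℤ := if a = 0 then 1 else -1

theorem sgn_add : ∀ a b : ZMod 2, sgn (a + b) = sgn a * sgn b := by decide

theorem sgn_mul_self : ∀ a : ZMod 2, sgn a * sgn a = 1 := by decide

theorem zmod_two_ne_add_one : ∀ a b : ZMod 2, ¬ a ≠ b → a + 1 ≠ b := by decide

/-- Orthogonality of characters: if `f p ≠ 0`, adding the unit vector at `p` to `S` permutes the
summands and reverses all signs. -/
theorem sum_sgn_dot (f : Ω → ZMod 2) :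
    ∑ S : Ω → ZMod 2, sgn (dot S f) = if f = 0 then (Fintype.card (Ω → ZMod 2) : ℤ) else 0 := by
  split_ifs with h
  · subst h
    simp [dot, sgn]
  · obtain ⟨p, hp⟩ : ∃ p, f p ≠ 0 := by
      by_contra! hc
      exact h (funext hc)
    have hp1 : sgn (f p) = -1 := by simp [sgn, hp]
    have : ∑ S : Ω → ZMod 2, sgn (dot (S + Pi.single p 1) f) = ∑ S : Ω → ZMod 2, sgn (dot S f) :=
      Fintype.sum_equiv (Equiv.addRight (Pi.single p (1 : ZMod 2) : Ω → ZMod 2)) _ _ fun _ => rfl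
    simp only [add_dot, sgn_add, single_dot, hp1, mul_neg, mul_one, sum_neg_distrib] at this
    linarith

/-- The Fourier coefficients, not normalized. -/
def fourier (B : (Ω → ZMod 2) → ZMod 2) (S : Ω → ZMod 2) : ℤ := ∑ f, sgn (B f) * sgn (dot S f)

/-- Parseval's identity: after expansion, orthogonality leaves only the diagonal `f = g`. -/
theorem sum_fourier_sq (B : (Ω → ZMod 2) → ZMod 2) :
    ∑ S, fourier B S ^ 2 = (Fintype.card (Ω → ZMod 2) : ℤ) ^ 2 := by
  have h : ∀ S, fourier B S ^ 2 =
      ∑ f, ∑ g, sgn (B f) * sgn (B g) * sgn (dot S (f + g)) := by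
    intro S
    rw [pow_two, fourier, sum_mul_sum]
    refine sum_congr rfl fun f _ => sum_congr rfl fun g _ => ?_
    rw [dot_add, sgn_add]
    ring
  calc ∑ S, fourier B S ^ 2
      = ∑ f, ∑ g, ∑ S, sgn (B f) * sgn (B g) * sgn (dot S (f + g)) := by
        simp_rw [h]
        rw [sum_comm]
        exact sum_congr rfl fun f _ => sum_comm
    _ = ∑ f : Ω → ZMod 2, (Fintype.card (Ω → ZMod 2) : ℤ) := by
        refine sum_congr rfl fun f _ => ?_
        simp_rw [← mul_sum, sum_sgn_dot, add_eq_zero_iff_eq_of_two]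
        simp [sgn_mul_self]
    _ = _ := by simp [pow_two]

/-- In the expanded cube, orthogonality keeps the triples with `k = h + f`, which are the queries of
the linearity test. -/
theorem sum_fourier_cube (B : (Ω → ZMod 2) → ZMod 2) :
    ∑ S, fourier B S ^ 3 =
      (Fintype.card (Ω → ZMod 2) : ℤ) * ∑ f, ∑ h, sgn (B f + B h + B (h + f)) := by
  have e3 : ∀ S, fourier B S ^ 3 = ∑ f, ∑ h, ∑ k,
      sgn (B f + B h + B k) * sgn (dot S (h + f + k)) := by
    intro S
    rw [pow_succ, pow_two, fourier, sum_mul_sum, sum_mul]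
    refine sum_congr rfl fun f _ => ?_
    rw [sum_mul]
    refine sum_congr rfl fun g _ => ?_
    rw [mul_sum]
    refine sum_congr rfl fun k _ => ?_
    simp only [dot_add, sgn_add]
    ring
  calc ∑ S, fourier B S ^ 3
      = ∑ f, ∑ h, ∑ k, ∑ S, sgn (B f + B h + B k) * sgn (dot S (h + f + k)) := by
        simp_rw [e3]
        rw [sum_comm]
        refine sum_congr rfl fun f _ => ?_
        rw [sum_comm]
        exact sum_congr rfl fun h _ => sum_comm
    _ = _ := by
        rw [mul_sum]
        refine sum_congr rfl fun f _ => ?_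
        rw [mul_sum]
        refine sum_congr rfl fun h _ => ?_
        simp_rw [← mul_sum, sum_sgn_dot, add_eq_zero_iff_eq_of_two]
        simp [mul_comm]

theorem sum_sgn {α : Type} [Fintype α] (b : α → ZMod 2) :
    ∑ a, sgn (b a) = (Fintype.card α : ℤ) - 2 * #{a | b a ≠ 0} := by
  have : ∀ a, sgn (b a) = 1 - 2 * (if b a ≠ 0 then 1 else 0) := by
    intro a
    by_cases h : b a = 0 <;> simp [sgn, h]
  simp_rw [this, sum_sub_distrib, ← mul_sum, sum_boole]
  simp

/-- The linearity test: a function that fails it rarely is close to a linear one. -/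
theorem exists_dot_close (B : (Ω → ZMod 2) → ZMod 2) :
    ∃ S, Fintype.card (Ω → ZMod 2) * #{f | B f ≠ dot S f} ≤
      #{t : (Ω → ZMod 2) × (Ω → ZMod 2) | B t.1 + B t.2 + B (t.2 + t.1) ≠ 0} := by
  -- `S` has the largest coefficient, `N - 2 * distance`. The cubes sum to at most this coefficient
  -- times the sum `N ^ 2` of the squares, and they sum to `N * (N ^ 2 - 2 * failures)`; comparison
  -- gives the claim.
  obtain ⟨S, -, hS⟩ := exists_max_image univ (fourier B) ⟨0, mem_univ 0⟩
  refine ⟨S, ?_⟩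
  set N : ℤ := (Fintype.card (Ω → ZMod 2) : ℤ) with hN
  have hN0 : 0 < N := by
    rw [hN]; exact_mod_cast Fintype.card_pos
  have h1 : ∑ T, fourier B T ^ 3 ≤ fourier B S * N ^ 2 := by
    rw [← sum_fourier_sq B, mul_sum]
    refine sum_le_sum fun T _ => ?_
    rw [pow_succ, mul_comm]
    exact mul_le_mul_of_nonneg_right (hS T (mem_univ T)) (sq_nonneg _)
  have h2 : fourier B S = N - 2 * #{f | B f ≠ dot S f} := by
    have := sum_sgn (fun f => B f + dot S f)
    simp only [sgn_add] at this
    rw [fourier, this]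
    congr 3
    refine congrArg _ (filter_congr fun f _ => not_congr ?_)
    generalize B f = a
    generalize dot S f = b
    revert a b
    decide
  have h3 := sum_fourier_cube B
  have h4 := sum_sgn (fun t : (Ω → ZMod 2) × (Ω → ZMod 2) => B t.1 + B t.2 + B (t.2 + t.1))
  rw [Fintype.sum_prod_type] at h4
  simp only at h4
  rw [h4, Fintype.card_prod, Nat.cast_mul, ← hN] at h3
  rw [h3, h2] at h1
  zify
  rw [← hN]
  have h5 : N * (N * #{f | B f ≠ dot S f}) ≤ N *
    #{t : (Ω → ZMod 2) × (Ω → ZMod 2) | B t.1 + B t.2 + B (t.2 + t.1) ≠ 0} := by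
    nlinarith
  exact le_of_mul_le_mul_left h5 hN0

/-- `σ` injects the complement of the set into the set. -/
theorem card_le_two_mul {α : Type} [Fintype α] [DecidableEq α] (P : α → Prop) [DecidablePred P]
    (σ : α → α) (hσ : Function.Injective σ) (h : ∀ a, ¬ P a → P (σ a)) :
    Fintype.card α ≤ 2 * #{a | P a} := by
  have h1 : #{a | ¬ P a} ≤ #{a | P a} := by
    refine card_le_card_of_injOn σ (fun a ha => ?_) hσ.injOn
    simp only [coe_filter, mem_univ, true_and, Set.mem_ofPred_eq] at ha ⊢
    exact h a ha
  have h2 : #{a | P a} + #{a | ¬ P a} = Fintype.card α := by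
    rw [← card_univ]
    exact card_filter_add_card_filter_not _
  omega

theorem card_mul_le_sum {α : Type} [Fintype α] (P : α → Prop) [DecidablePred P] (b : α → ℕ) (n : ℕ)
    (h : ∀ a, P a → n ≤ b a) : #{a | P a} * n ≤ ∑ a, b a := by
  calc _ = ∑ a with P a, n := by simp
    _ ≤ ∑ a with P a, b a := sum_le_sum fun a ha => h a (mem_filter.1 ha).2
    _ ≤ _ := sum_le_sum_of_subset (filter_subset _ _)

theorem card_filter_le_add {α : Type} [Fintype α] {P Q R : α → Prop} [DecidablePred P]
    [DecidablePred Q] [DecidablePred R] (h : ∀ a, P a → Q a ∨ R a) :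
    #{a | P a} ≤ #{a | Q a} + #{a | R a} := by
  classical
  refine (card_le_card fun a ha => ?_).trans (card_union_le _ _)
  simpa using h a (mem_filter.1 ha).2

theorem card_filter_le_add₃ {α : Type} [Fintype α] {P Q R S : α → Prop} [DecidablePred P]
    [DecidablePred Q] [DecidablePred R] [DecidablePred S] (h : ∀ a, P a → Q a ∨ R a ∨ S a) :
    #{a | P a} ≤ #{a | Q a} + (#{a | R a} + #{a | S a}) :=
  (card_filter_le_add (R := fun a => R a ∨ S a) h).trans
    (Nat.add_le_add_left (card_filter_le_add fun _ h => h) _)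

/-- Toggling `f` at `p` turns agreement at `p` and `q` into disagreement. Hence two code words are
at relative distance at least one half. -/
theorem card_apply_ne {p q : Ω} (hpq : p ≠ q) :
    Fintype.card (Ω → ZMod 2) ≤ 2 * #{f : Ω → ZMod 2 | f p ≠ f q} := by
  refine card_le_two_mul _ (· + Pi.single p 1) (add_left_injective _) fun f hf => ?_
  simp only [Pi.add_apply, Pi.single_eq_same, Pi.single_eq_of_ne hpq.symm, add_zero]
  exact zmod_two_ne_add_one _ _ hf

/-- If `f p ≠ f q`, then `dot S f ≠ f x` for one of `x = p` and `x = q`. Toggling `g` at this `x`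
changes the two sides by the different amounts `dot S f` and `f x`. So at least half of all `g` fail
for at least half of all `f`. -/
theorem card_not_mul {S : Ω → ZMod 2} {p q : Ω} (hpq : p ≠ q) (hp : S p = 1) (hq : S q = 1) :
    Fintype.card (Ω → ZMod 2) ^ 2 ≤
      4 * #{t : (Ω → ZMod 2) × (Ω → ZMod 2) | dot S t.1 * dot S t.2 ≠ dot S (t.1 * t.2)} := by
  have key : ∀ f : Ω → ZMod 2, f p ≠ f q → Fintype.card (Ω → ZMod 2) ≤
      2 * #{g : Ω → ZMod 2 | dot S f * dot S g ≠ dot S (f * g)} := by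
    intro f hf
    obtain ⟨x, hx, hfx⟩ : ∃ x, S x = 1 ∧ dot S f + f x = 1 := by
      by_cases h : dot S f + f p = 1
      · exact ⟨p, hp, h⟩
      · refine ⟨q, hq, ?_⟩
        revert h hf
        generalize dot S f = a
        generalize f p = b
        generalize f q = c
        revert a b c
        decide
    refine card_le_two_mul _ (· + Pi.single x 1) (add_left_injective _) fun g hg => ?_
    have e : f * (Pi.single x 1 : Ω → ZMod 2) = fun y => if y = x then f x else 0 := by
      funext y
      by_cases h : y = x
      · subst h; simp
      · simp [h]
    have e2 : dot S (f * (Pi.single x 1 : Ω → ZMod 2)) = f x := by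
      rw [e]; simp [dot, hx]
    rw [mul_add, dot_add, dot_add, dot_single, hx, e2]
    revert hg hfx
    generalize dot S f = a
    generalize dot S g = b
    generalize dot S (f * g) = c
    generalize f x = d
    revert a b c d
    decide
  have h1 := card_apply_ne hpq
  have h2 : #{t : (Ω → ZMod 2) × (Ω → ZMod 2) | dot S t.1 * dot S t.2 ≠ dot S (t.1 * t.2)} =
      ∑ f : Ω → ZMod 2, #{g : Ω → ZMod 2 | dot S f * dot S g ≠ dot S (f * g)} := by
    simp only [card_filter, Fintype.sum_prod_type]
  have h3 := card_mul_le_sum (fun f : Ω → ZMod 2 => f p ≠ f q)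
    (fun f => 2 * #{g : Ω → ZMod 2 | dot S f * dot S g ≠ dot S (f * g)}) _ key
  rw [← mul_sum] at h3
  rw [h2, pow_two]
  nlinarith

/-- The word `A` is closer than a quarter to the code word of the element `a` in the long code. -/
def Close (A : (Ω → ZMod 2) → ZMod 2) (a : Ω) : Prop :=
  4 * #{f | A f ≠ f a} < Fintype.card (Ω → ZMod 2)

theorem Close.unique {A : (Ω → ZMod 2) → ZMod 2} {a b : Ω} (ha : Close A a) (hb : Close A b) :
    a = b := by
  by_contra hab
  have h1 := card_apply_ne hab
  have h2 : #{f : Ω → ZMod 2 | f a ≠ f b} ≤ #{f | A f ≠ f a} + #{f | A f ≠ f b} := by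
    refine card_filter_le_add fun f hf => ?_
    by_contra! hc
    exact hf (hc.1.symm.trans hc.2)
  unfold Close at ha hb
  omega

theorem close_self (a : Ω) : Close (fun f : Ω → ZMod 2 => f a) a := by
  simp [Close]

variable (Ω) in
/-- The randomness of the tests. -/
abbrev Triple : Type := (Ω → ZMod 2) × (Ω → ZMod 2) × (Ω → ZMod 2)

theorem card_fst (P : (Ω → ZMod 2) → Prop) [DecidablePred P] :
    #{t : Triple Ω | P t.1} = #{f | P f} * Fintype.card (Ω → ZMod 2) ^ 2 := by
  have : ({t : Triple Ω | P t.1} : Finset _) = ({f | P f} : Finset _) ×ˢ univ := by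
    ext t; simp
  rw [this, card_product, card_univ, Fintype.card_prod, pow_two]

theorem card_comp_le {α : Type} [Fintype α] (e : α ≃ α) (P : α → Prop)
    [DecidablePred P] : #{t | P (e t)} = #{t | P t} := by
  refine card_bij' (fun t _ => e t) (fun t _ => e.symm t) ?_ ?_ ?_ ?_ <;> simp

/-- Exchanges the second or third component with the first. -/
def swapSnd : Triple Ω ≃ Triple Ω where
  toFun t := (t.2.1, t.1, t.2.2)
  invFun t := (t.2.1, t.1, t.2.2)
  left_inv _ := rfl
  right_inv _ := rfl

/-- Exchanges the first and the last component. -/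
def swapThd : Triple Ω ≃ Triple Ω where
  toFun t := (t.2.2, t.2.1, t.1)
  invFun t := (t.2.2, t.2.1, t.1)
  left_inv _ := rfl
  right_inv _ := rfl

/-- Shifts the last component by a function of the others. -/
def shiftThd (φ : (Ω → ZMod 2) → (Ω → ZMod 2) → (Ω → ZMod 2)) : Triple Ω ≃ Triple Ω where
  toFun t := (t.1, t.2.1, t.2.2 + φ t.1 t.2.1)
  invFun t := (t.1, t.2.1, t.2.2 + φ t.1 t.2.1)
  left_inv t := by simp [add_assoc, fun_add_self]
  right_inv t := by simp [add_assoc, fun_add_self]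

theorem card_snd (P : (Ω → ZMod 2) → Prop) [DecidablePred P] :
    #{t : Triple Ω | P t.2.1} = #{f | P f} * Fintype.card (Ω → ZMod 2) ^ 2 := by
  rw [← card_fst]
  exact card_comp_le swapSnd (fun t : Triple Ω => P t.1)

theorem card_thd (P : (Ω → ZMod 2) → Prop) [DecidablePred P] :
    #{t : Triple Ω | P t.2.2} = #{f | P f} * Fintype.card (Ω → ZMod 2) ^ 2 := by
  rw [← card_fst]
  exact card_comp_le swapThd (fun t : Triple Ω => P t.1)

/-- For fixed `f` and `g` the shift permutes the third components, so `h + φ f g` is distributed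
like `h`. This permits self-correction: the value at a prescribed function is read off from two
uniformly random places. -/
theorem card_shift (P : (Ω → ZMod 2) → Prop) [DecidablePred P]
    (φ : (Ω → ZMod 2) → (Ω → ZMod 2) → (Ω → ZMod 2)) :
    #{t : Triple Ω | P (t.2.2 + φ t.1 t.2.1)} =
      #{f | P f} * Fintype.card (Ω → ZMod 2) ^ 2 := by
  rw [← card_thd]
  exact card_comp_le (shiftThd φ) (fun t : Triple Ω => P t.2.2)

/-- Soundness of the tests of a constraint `π` on the long codes of two elements. -/
theorem tests_sound (π : Ω → ZMod 2) (r r' : Ω → Ω) (A A' B : (Ω → ZMod 2) → ZMod 2)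
    (C : (Ω → ZMod 2) → (Ω → ZMod 2) → ZMod 2)
    (h0 : 100 * #{t : Triple Ω | B t.1 + B t.2.2 + B (t.2.2 + t.1) ≠ 0} <
      Fintype.card (Triple Ω))
    (h1 : 100 * #{t : Triple Ω | C t.2.2 t.2.1 ≠ B t.2.2 * B t.2.1} < Fintype.card (Triple Ω))
    (h2 : 100 * #{t : Triple Ω | C t.1 t.2.1 + B t.2.2 + B (t.2.2 + t.1 * t.2.1) ≠ 0} <
      Fintype.card (Triple Ω))
    (h3 : 100 * #{t : Triple Ω | B t.2.2 + B (t.2.2 + π) ≠ 1} < Fintype.card (Triple Ω))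
    (h4 : 100 * #{t : Triple Ω | A t.1 + B t.2.2 + B (t.2.2 + t.1 ∘ r) ≠ 0} <
      Fintype.card (Triple Ω))
    (h5 : 100 * #{t : Triple Ω | A' t.1 + B t.2.2 + B (t.2.2 + t.1 ∘ r') ≠ 0} <
      Fintype.card (Triple Ω)) :
    ∃ p, π p = 1 ∧ Close A (r p) ∧ Close A' (r' p) := by
  -- By the linearity test, `B` differs from `dot S` on less than a hundredth of all functions.
  obtain ⟨S, hS⟩ := exists_dot_close B
  set N := Fintype.card (Ω → ZMod 2) with hN
  have hNpos : 0 < N := Fintype.card_pos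
  have hT : Fintype.card (Triple Ω) = N ^ 3 := by
    rw [Fintype.card_prod, Fintype.card_prod, ← hN]; ring
  rw [hT] at h0 h1 h2 h3 h4 h5
  set d := #{f | B f ≠ dot S f} with hd
  -- The linearity test ignores the second component, so its failures among triples are `N` times
  -- those among pairs.
  have hd0 : d * N ^ 2 ≤ #{t : Triple Ω | B t.1 + B t.2.2 + B (t.2.2 + t.1) ≠ 0} := by
    have e2 : #{t : Triple Ω | B t.1 + B t.2.2 + B (t.2.2 + t.1) ≠ 0} =
        #{t : Triple Ω | B t.2.1 + B t.2.2 + B (t.2.2 + t.2.1) ≠ 0} :=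
      card_comp_le swapSnd (fun t : Triple Ω => B t.2.1 + B t.2.2 + B (t.2.2 + t.2.1) ≠ 0)
    have e3 : ({t : Triple Ω | B t.2.1 + B t.2.2 + B (t.2.2 + t.2.1) ≠ 0} : Finset _) =
        univ ×ˢ ({t : (Ω → ZMod 2) × (Ω → ZMod 2) | B t.1 + B t.2 + B (t.2 + t.1) ≠ 0} :
          Finset _) := by
      ext t; simp
    rw [e2, e3, card_product, card_univ, ← hN, pow_two]
    calc d * (N * N) = N * (N * d) := by ring
      _ ≤ _ := Nat.mul_le_mul_left _ hS
  have hX1 : #{t : Triple Ω | B t.1 ≠ dot S t.1} = d * N ^ 2 :=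
    card_fst (fun f => B f ≠ dot S f)
  have hX2 : #{t : Triple Ω | B t.2.1 ≠ dot S t.2.1} = d * N ^ 2 :=
    card_snd (fun f => B f ≠ dot S f)
  have hX3 : #{t : Triple Ω | B t.2.2 ≠ dot S t.2.2} = d * N ^ 2 :=
    card_thd (fun f => B f ≠ dot S f)
  have hX4 : ∀ φ : (Ω → ZMod 2) → (Ω → ZMod 2) → (Ω → ZMod 2),
      #{t : Triple Ω | B (t.2.2 + φ t.1 t.2.1) ≠ dot S (t.2.2 + φ t.1 t.2.1)} = d * N ^ 2 :=
    fun φ => card_shift (fun f => B f ≠ dot S f) φ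
  -- Otherwise every triple fails the test of `π` or meets an error of `B` at one of two places,
  -- which accounts for less than three hundredths.
  have hπ : dot S π = 1 := by
    by_contra hne
    have := card_filter_le_add₃ (P := fun _ : Triple Ω => True)
      (Q := fun t => B t.2.2 + B (t.2.2 + π) ≠ 1) (R := fun t => B t.2.2 ≠ dot S t.2.2)
      (S := fun t => B (t.2.2 + π) ≠ dot S (t.2.2 + π)) (by
        intro t _
        by_contra! hc
        obtain ⟨c1, c2, c3⟩ := hc
        rw [c2, c3, dot_add, ← add_assoc, zmod_two_add_self, zero_add] at c1
        exact hne c1)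
    rw [filter_true, card_univ, hT, hX3, hX4 (fun _ _ => π)] at this
    omega
  -- Two points in the support of `S` would spoil multiplicativity for a quarter of the pairs. The
  -- two product tests and four possible errors of `B` leave room for less than six hundredths.
  have hmul : ∀ p q, S p = 1 → S q = 1 → p = q := by
    intro p q hp hq
    by_contra hpq
    have hlow := card_not_mul hpq hp hq
    -- The test queries `C` at the third and second components; an exchange moves this to the first
    -- and second.
    have e1 : #{t : Triple Ω | C t.1 t.2.1 ≠ B t.1 * B t.2.1} =
        #{t : Triple Ω | C t.2.2 t.2.1 ≠ B t.2.2 * B t.2.1} :=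
      card_comp_le swapThd (fun t : Triple Ω => C t.2.2 t.2.1 ≠ B t.2.2 * B t.2.1)
    have e2 : #{t : Triple Ω | dot S t.1 * dot S t.2.1 ≠ dot S (t.1 * t.2.1)} =
        #{t : (Ω → ZMod 2) × (Ω → ZMod 2) | dot S t.1 * dot S t.2 ≠ dot S (t.1 * t.2)} * N := by
      have e3 := card_product ({t : (Ω → ZMod 2) × (Ω → ZMod 2) |
        dot S t.1 * dot S t.2 ≠ dot S (t.1 * t.2)} : Finset _) (univ : Finset (Ω → ZMod 2))
      rw [card_univ, ← hN] at e3
      rw [← e3]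
      refine card_bij' (fun t _ => ((t.1, t.2.1), t.2.2)) (fun t _ => (t.1.1, t.1.2, t.2))
        ?_ ?_ ?_ ?_ <;> simp
    have := (card_filter_le_add₃
      (P := fun t : Triple Ω => dot S t.1 * dot S t.2.1 ≠ dot S (t.1 * t.2.1))
      (Q := fun t => C t.1 t.2.1 ≠ B t.1 * B t.2.1)
      (R := fun t => C t.1 t.2.1 + B t.2.2 + B (t.2.2 + t.1 * t.2.1) ≠ 0)
      (S := fun t => B t.1 ≠ dot S t.1 ∨ B t.2.1 ≠ dot S t.2.1 ∨ B t.2.2 ≠ dot S t.2.2 ∨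
        B (t.2.2 + t.1 * t.2.1) ≠ dot S (t.2.2 + t.1 * t.2.1)) (by
        intro t ht
        by_contra! hc
        obtain ⟨c1, c2, c3, c4, c5, c6⟩ := hc
        apply ht
        rw [c1, c3, c4, c5, c6, dot_add] at c2
        revert c2
        generalize dot S t.1 * dot S t.2.1 = a
        generalize dot S t.2.2 = b
        generalize dot S (t.1 * t.2.1) = c
        revert a b c
        decide)).trans (Nat.add_le_add_left (Nat.add_le_add_left ((card_filter_le_add₃
          (fun _ h => h)).trans (Nat.add_le_add_left (Nat.add_le_add_left
          (card_filter_le_add (fun _ h => h)) _) _)) _) _)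
    rw [e1, e2, hX1, hX2, hX3, hX4 (fun f g => f * g)] at this
    have h6 : N ^ 3 ≤ 4 * (#{t : (Ω → ZMod 2) × (Ω → ZMod 2) |
        dot S t.1 * dot S t.2 ≠ dot S (t.1 * t.2)} * N) := by
      calc N ^ 3 = N ^ 2 * N := by ring
        _ ≤ _ := by rw [← mul_assoc]; exact Nat.mul_le_mul_right _ hlow
    omega
  obtain ⟨p, hp⟩ : ∃ p, S p = 1 := by
    by_contra! hc
    have hS0 : S = 0 := by
      funext p
      have := hc p
      revert this
      simp only [Pi.zero_apply]
      generalize S p = a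
      revert a
      decide
    simp [hS0, dot] at hπ
  have hSp : S = Pi.single p 1 := by
    funext q
    by_cases h : q = p
    · subst h; simp [hp]
    · rw [Pi.single_eq_of_ne h]
      have := fun hq => h (hmul q p hq hp)
      revert this
      generalize S q = a
      revert a
      decide
  have hdot : ∀ f, dot S f = f p := fun f => by rw [hSp, single_dot]
  -- `A f` is compared with the self-corrected value `f (r p)` of `B` at `f ∘ r`. The errors, less
  -- than three hundredths, stay below a quarter.
  have hclose : ∀ (A : (Ω → ZMod 2) → ZMod 2) (r : Ω → Ω),
      100 * #{t : Triple Ω | A t.1 + B t.2.2 + B (t.2.2 + t.1 ∘ r) ≠ 0} < N ^ 3 →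
      Close A (r p) := by
    intro A r hA
    have := card_filter_le_add₃ (P := fun t : Triple Ω => A t.1 ≠ t.1 (r p))
      (Q := fun t => A t.1 + B t.2.2 + B (t.2.2 + t.1 ∘ r) ≠ 0)
      (R := fun t => B t.2.2 ≠ dot S t.2.2)
      (S := fun t => B (t.2.2 + t.1 ∘ r) ≠ dot S (t.2.2 + t.1 ∘ r)) (by
        intro t ht
        by_contra! hc
        obtain ⟨c1, c2, c3⟩ := hc
        apply ht
        rw [c2, c3, hdot, hdot, Pi.add_apply, Function.comp_apply] at c1
        revert c1
        generalize A t.1 = a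
        generalize t.2.2 p = b
        generalize t.1 (r p) = c
        revert a b c
        decide)
    rw [hX3, hX4 (fun f _ => f ∘ r), card_fst (fun f => A f ≠ f (r p)), ← hN] at this
    have h6 : 4 * #{f | A f ≠ f (r p)} * N ^ 2 < N * N ^ 2 := by
      rw [show N * N ^ 2 = N ^ 3 by ring, mul_assoc]
      omega
    exact lt_of_mul_lt_mul_right h6 (Nat.zero_le _)
  refine ⟨p, (hdot π).symm.trans hπ, hclose A r h4, hclose A' r' h5⟩

end LongCode

/-! ### Values and reconfiguration sequences -/

namespace ConstraintGraph

variable {q : ℕ} {V E A : Type}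

theorem value_le_one [Finite E] (G : ConstraintGraph q V E A) (ψ : V → A) : G.value ψ ≤ 1 := by
  refine div_le_one_of_le₀ ?_ (Nat.cast_nonneg _)
  exact_mod_cast Nat.card_le_card_of_injective _ Subtype.val_injective

theorem value_eq_one_iff [Finite E] [Nonempty E] (G : ConstraintGraph q V E A) (ψ : V → A) :
    G.value ψ = 1 ↔ G.Satisfies ψ := by
  have hpos : (0 : ℝ) < Nat.card E := by exact_mod_cast Nat.card_pos
  unfold value
  rw [div_eq_one_iff_eq hpos.ne', Nat.cast_inj]
  constructor
  · intro h e
    have := (Nat.bijective_iff_injective_and_card (Subtype.val : {e // G.SatisfiesEdge ψ e} → E)).2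
      ⟨Subtype.val_injective, h⟩
    obtain ⟨x, rfl⟩ := this.2 e
    exact x.2
  · intro h
    exact Nat.card_congr (Equiv.subtypeUnivEquiv h)

theorem one_sub_value [Finite E] [Nonempty E] (G : ConstraintGraph q V E A) (ψ : V → A) :
    1 - G.value ψ = (Nat.card {e // ¬ G.SatisfiesEdge ψ e} : ℝ) / Nat.card E := by
  classical
  have hpos : (0 : ℝ) < Nat.card E := by exact_mod_cast Nat.card_pos
  have h : Nat.card {e // G.SatisfiesEdge ψ e} + Nat.card {e // ¬ G.SatisfiesEdge ψ e} =
      Nat.card E := by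
    rw [← Nat.card_sum]
    exact Nat.card_congr (Equiv.sumCompl _)
  have h' : (Nat.card {e // G.SatisfiesEdge ψ e} : ℝ) + Nat.card {e // ¬ G.SatisfiesEdge ψ e} =
      Nat.card E := by exact_mod_cast h
  unfold value
  field_simp
  linarith

theorem seqValue_le (G : ConstraintGraph q V E A) {T : ℕ} (s : Fin (T + 1) → V → A)
    (t : Fin (T + 1)) : G.seqValue s ≤ G.value (s t) :=
  ciInf_le (Set.finite_range _).bddBelow t

section Sequences

variable [Fintype V] [DecidableEq A]

theorem hammingDist_le_one_of_forall {φ φ' : V → A} (x : V) (h : ∀ y, y ≠ x → φ y = φ' y) :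
    hammingDist φ φ' ≤ 1 := by
  refine Finset.card_le_one.2 fun a ha b hb => ?_
  have key : ∀ a ∈ ({i | φ i ≠ φ' i} : Finset V), a = x := by
    intro a ha
    by_contra hne
    exact (Finset.mem_filter.1 ha).2 (h a hne)
  rw [key a ha, key b hb]

theorem exists_of_hammingDist_le_one [Nonempty V] {φ φ' : V → A} (h : hammingDist φ φ' ≤ 1) :
    ∃ x, ∀ y, y ≠ x → φ y = φ' y := by
  obtain ⟨x, hx⟩ := Finset.card_le_one_iff_subset_singleton.1 h
  refine ⟨x, fun y hy => ?_⟩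
  by_contra hne
  exact hy (Finset.mem_singleton.1 (hx (Finset.mem_filter.2 ⟨Finset.mem_univ y, hne⟩)))

/-- A change of at most one vertex that leads to a satisfying assignment. -/
def Move (G : ConstraintGraph q V E A) (φ φ' : V → A) : Prop :=
  G.Satisfies φ' ∧ hammingDist φ φ' ≤ 1

/-- Two assignments are linked by satisfying assignments if all their mixtures are satisfying. -/
theorem reachable_of_mixtures (G : ConstraintGraph q V E A) (φ φ' : V → A)
    (h : ∀ χ : V → A, (∀ x, χ x = φ x ∨ χ x = φ' x) → G.Satisfies χ) :
    Relation.ReflTransGen G.Move φ φ' := by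
  classical
  -- The vertices are switched from `φ` to `φ'` one at a time, and each stage is a mixture.
  have key : ∀ S : Finset V, Relation.ReflTransGen G.Move φ (S.piecewise φ' φ) := by
    intro S
    induction S using Finset.induction_on with
    | empty => rw [Finset.piecewise_empty]
    | insert a S ha ih =>
      refine ih.tail ⟨h _ fun x => ?_, hammingDist_le_one_of_forall a fun y hy => ?_⟩
      · by_cases hx : x ∈ insert a S <;> simp [Finset.piecewise, hx]
      · simp [Finset.piecewise, hy]
  simpa using key Finset.univ

theorem exists_seq_of_reachable (G : ConstraintGraph q V E A) {φ φ' : V → A}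
    (h0 : G.Satisfies φ) (h : Relation.ReflTransGen G.Move φ φ') :
    ∃ (T : ℕ) (s : Fin (T + 1) → V → A), IsReconfSeq φ φ' s ∧ ∀ t, G.Satisfies (s t) := by
  induction h with
  | refl => exact ⟨0, fun _ => φ, ⟨rfl, rfl, fun t => t.elim0⟩, fun _ => h0⟩
  | @tail b c _ hbc ih =>
    obtain ⟨T, s, ⟨h1, h2, h3⟩, hs⟩ := ih
    refine ⟨T + 1, Fin.snoc s c, ⟨?_, Fin.snoc_last _ _, fun t => ?_⟩, fun t => ?_⟩
    · rw [← h1]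
      exact Fin.snoc_castSucc (α := fun _ => V → A) c s 0
    · rw [Fin.snoc_castSucc (α := fun _ => V → A)]
      refine Fin.lastCases ?_ (fun t => ?_) t
      · rw [Fin.succ_last, Fin.snoc_last, h2]
        exact hbc.2
      · rw [← Fin.castSucc_succ, Fin.snoc_castSucc (α := fun _ => V → A)]
        exact h3 t
    · refine Fin.lastCases ?_ (fun t => ?_) t
      · rw [Fin.snoc_last]; exact hbc.1
      · rw [Fin.snoc_castSucc (α := fun _ => V → A)]; exact hs t

theorem reconfValueSet_nonempty_bddAbove [Finite E] (G : ConstraintGraph q V E A) (φ φ' : V → A) :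
    (G.reconfValueSet φ φ').Nonempty ∧ BddAbove (G.reconfValueSet φ φ') := by
  classical
  constructor
  · let G' : ConstraintGraph q V PEmpty A := ⟨nofun, nofun, nofun⟩
    obtain ⟨T, s, hs, -⟩ := G'.exists_seq_of_reachable (φ := φ) (φ' := φ') nofun
      (G'.reachable_of_mixtures φ φ' fun _ _ => nofun)
    exact ⟨_, T, s, hs, rfl⟩
  · refine ⟨1, ?_⟩
    rintro r ⟨T, s, -, rfl⟩
    obtain ⟨t, ht⟩ := G.seqValue_mem s
    rw [← ht]
    exact G.value_le_one _

theorem reconfValue_eq_one_of_seq [Finite E] [Nonempty E] (G : ConstraintGraph q V E A)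
    {φ φ' : V → A} {T : ℕ} {s : Fin (T + 1) → V → A} (hs : IsReconfSeq φ φ' s)
    (hsat : ∀ t, G.Satisfies (s t)) : G.reconfValue φ φ' = 1 := by
  obtain ⟨hne, hbdd⟩ := G.reconfValueSet_nonempty_bddAbove φ φ'
  apply le_antisymm
  · refine csSup_le hne ?_
    rintro r ⟨T, s, -, rfl⟩
    obtain ⟨t, ht⟩ := G.seqValue_mem s
    rw [← ht]
    exact G.value_le_one _
  · refine le_csSup hbdd ⟨T, s, hs, ?_⟩
    obtain ⟨t, ht⟩ := G.seqValue_mem s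
    rw [← ht]
    exact (G.value_eq_one_iff _).2 (hsat t)

end Sequences

/-! ### Renaming vertices and hyperedges -/

section Transport

variable {V' E' : Type} (eV : V ≃ V') (eE : E ≃ E')

/-- The graph with renamed vertices and hyperedges. -/
def rename (G : ConstraintGraph q V E A) : ConstraintGraph q V' E' A where
  vertex e i := eV (G.vertex (eE.symm e) i)
  vertex_injective _ := eV.injective.comp (G.vertex_injective _)
  constraint e := G.constraint (eE.symm e)

theorem rename_satisfiesEdge (G : ConstraintGraph q V E A) (φ : V' → A) (e : E') :
    (G.rename eV eE).SatisfiesEdge φ e ↔ G.SatisfiesEdge (φ ∘ eV) (eE.symm e) := Iff.rfl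

theorem rename_satisfies (G : ConstraintGraph q V E A) (φ : V' → A) :
    (G.rename eV eE).Satisfies φ ↔ G.Satisfies (φ ∘ eV) :=
  ⟨fun h e => by simpa using (rename_satisfiesEdge eV eE G φ _).1 (h (eE e)), fun h e => h _⟩

theorem rename_value (G : ConstraintGraph q V E A) (φ : V' → A) :
    (G.rename eV eE).value φ = G.value (φ ∘ eV) := by
  unfold value
  rw [Nat.card_congr eE.symm, Nat.card_congr (Equiv.subtypeEquiv eE.symm fun e =>
    rename_satisfiesEdge eV eE G φ e)]

variable [Fintype V] [Fintype V'] [DecidableEq A]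

theorem hammingDist_comp_equiv (φ φ' : V' → A) :
    hammingDist (φ ∘ eV) (φ' ∘ eV) = hammingDist φ φ' := by
  unfold hammingDist
  refine Finset.card_bij' (fun x _ => eV x) (fun x _ => eV.symm x) ?_ ?_ ?_ ?_ <;> simp

theorem rename_reconfValue (G : ConstraintGraph q V E A) (φ φ' : V' → A) :
    (G.rename eV eE).reconfValue φ φ' = G.reconfValue (φ ∘ eV) (φ' ∘ eV) := by
  unfold reconfValue
  congr 1
  ext r
  constructor
  · rintro ⟨T, s, ⟨h0, h1, h2⟩, rfl⟩
    refine ⟨T, fun t => s t ∘ eV, ⟨by simp only [h0], by simp only [h1], fun t => ?_⟩, ?_⟩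
    · rw [hammingDist_comp_equiv]; exact h2 t
    · simp only [seqValue, rename_value]
  · rintro ⟨T, s, ⟨h0, h1, h2⟩, rfl⟩
    refine ⟨T, fun t => s t ∘ eV.symm, ⟨by simp only [h0]; ext; simp,
      by simp only [h1]; ext; simp, fun t => ?_⟩, ?_⟩
    · rw [← hammingDist_comp_equiv eV]
      simpa [Function.comp_assoc] using h2 t
    · simp only [seqValue, rename_value, Function.comp_assoc, Equiv.symm_comp_self,
        Function.comp_id]

end Transport

end ConstraintGraph

/-! ### The new graph and completeness -/

namespace AlphabetReduction

open LongCode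

/-- Boolean functions on the pairs of symbols, which are numbered by `finFunctionFinEquiv`. -/
abbrev Fn (W : ℕ) : Type := Fin (W ^ 2) → ZMod 2

/-- The number of a pair of symbols. -/
def pairOf {W : ℕ} (a b : Fin W) : Fin (W ^ 2) := finFunctionFinEquiv ![a, b]

/-- A symbol as one of the first `W` pairs. -/
def up {W : ℕ} (a : Fin W) : Fin (W ^ 2) := Fin.castLE (Nat.le_self_pow two_ne_zero W) a

/-- Component `i` of a pair of symbols. -/
def proj {W : ℕ} (i : Fin 2) (p : Fin (W ^ 2)) : Fin (W ^ 2) := up (finFunctionFinEquiv.symm p i)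

theorem proj_pairOf_zero {W : ℕ} (a b : Fin W) : proj 0 (pairOf a b) = up a := by
  simp [proj, pairOf]

theorem proj_pairOf_one {W : ℕ} (a b : Fin W) : proj 1 (pairOf a b) = up b := by
  simp [proj, pairOf]

/-- Symbols are placed among the pairs so that words of vertices and words of hyperedges are indexed
by the same functions. Injectivity recovers the symbol when decoding. -/
theorem up_injective {W : ℕ} : Function.Injective (up : Fin W → Fin (W ^ 2)) :=
  Fin.castLE_injective (Nat.le_self_pow two_ne_zero W)

/-- The local condition of test `τ` on three bits. -/
def TestPred (τ x y z : ℕ) : Prop :=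
  if τ = 1 then x = y * z else if τ = 3 then (y + z) % 2 = 1 else (x + y + z) % 2 = 0

instance (τ x y z : ℕ) : Decidable (TestPred τ x y z) := by unfold TestPred; infer_instance

/-- The values accepted by the hyperedge of the selector values `i` and `j`, test `τ` and bit `k`:
those of two selectors, of the local view of the test, and of the queried word. -/
def Accepts (i j τ k a b c d : ℕ) : Prop :=
  a % 2 = i ∧ b % 2 = j → TestPred τ (c % 2) (c / 2 % 2) (c / 4 % 2) ∧ c / 2 ^ k % 2 = d

instance (i j τ k a b c d : ℕ) : Decidable (Accepts i j τ k a b c d) := by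
  unfold Accepts; infer_instance

variable {W : ℕ} (I : CSPReconfInstance 2 W)

/-- The vertices of the new graph: vertex, hyperedge, two selector values, kind, test, and three
functions. The kinds are: `0` selectors of the vertices, `1` long codes of the values of the
vertices, `2` long codes of the pairs of values of the hyperedges, `3` products of entries of the
latter, `4` local views of the tests. -/
abbrev Vert : Type :=
  (((((((Fin I.numVertices × Fin I.numEdges) × Fin 2) × Fin 2) × Fin 5) × Fin 6) × Fn W) × Fn W) ×
    Fn W

/-- The hyperedges of the new graph: hyperedge, two selector values, test, bit of the local view,
and three functions. -/
abbrev HEdge : Type :=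
  ((((((Fin I.numEdges × Fin 2) × Fin 2) × Fin 6) × Fin 3) × Fn W) × Fn W) × Fn W

/-- The vertex with the given components. -/
abbrev vert (u : Fin I.numVertices) (e : Fin I.numEdges) (i j : Fin 2) (κ : Fin 5) (τ : Fin 6)
    (f g h : Fn W) : Vert I :=
  ((((((((u, e), i), j), κ), τ), f), g), h)

/-- The kind of a vertex. -/
abbrev kind (x : Vert I) : Fin 5 := x.1.1.1.1.2

/-- The first hyperedge. -/
def edgeZero : Fin I.numEdges := ⟨0, I.numEdges_pos⟩

/-- The first vertex. -/
def vertZero : Fin I.numVertices := ⟨0, (I.graph.vertex (edgeZero I) 0).pos⟩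

/-- The selector of a vertex. -/
def selector (u : Fin I.numVertices) : Vert I := vert I u (edgeZero I) 0 0 0 0 0 0 0

/-- An entry of copy `i` of the long code of the value of a vertex. -/
def word (u : Fin I.numVertices) (i : Fin 2) (f : Fn W) : Vert I :=
  vert I u (edgeZero I) i 0 1 0 f 0 0

/-- An entry of a long code of the pair of values of a hyperedge. -/
def pairWord (e : Fin I.numEdges) (i j : Fin 2) (f : Fn W) : Vert I :=
  vert I (vertZero I) e i j 2 0 f 0 0

/-- The product of two entries of a long code of the pair of values of a hyperedge. -/
def prodWord (e : Fin I.numEdges) (i j : Fin 2) (f g : Fn W) : Vert I :=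
  vert I (vertZero I) e i j 3 0 f g 0

/-- The local view of a test. -/
def view (e : Fin I.numEdges) (i j : Fin 2) (τ : Fin 6) (f g h : Fn W) : Vert I :=
  vert I (vertZero I) e i j 4 τ f g h

/-- The constraint of a hyperedge as a function on pairs. -/
def relation (e : Fin I.numEdges) : Fn W :=
  fun p => if finFunctionFinEquiv.symm p ∈ I.graph.constraint e then 1 else 0

/-- The function that test `τ` adds to its random function. -/
def shift (e : Fin I.numEdges) (τ : ℕ) (f g : Fn W) : Fn W :=
  if τ = 0 then f else if τ = 2 then f * g else if τ = 3 then relation I e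
    else if τ = 4 then f ∘ proj 0 else f ∘ proj 1

/-- The first query of test `τ`. -/
def firstQuery (e : Fin I.numEdges) (i j : Fin 2) (τ : ℕ) (f g h : Fn W) : Vert I :=
  -- Test `1` uses `h` instead of `f`, so that the middle query is at `h` in all six tests.
  if τ = 1 then prodWord I e i j h g else if τ = 2 then prodWord I e i j f g
    else if τ = 4 then word I (I.graph.vertex e 0) i f
    else if τ = 5 then word I (I.graph.vertex e 1) j f else pairWord I e i j f

/-- The last query of test `τ`. -/
def lastQuery (e : Fin I.numEdges) (i j : Fin 2) (τ : ℕ) (f g h : Fn W) : Vert I :=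
  pairWord I e i j (if τ = 1 then g else h + shift I e τ f g)

/-- The query of test `τ` for bit `k` of the local view. -/
def query (e : Fin I.numEdges) (i j : Fin 2) (τ : ℕ) (k : Fin 3) (f g h : Fn W) : Vert I :=
  ![firstQuery I e i j τ f g h, pairWord I e i j h, lastQuery I e i j τ f g h] k

/-- Selectors have kind `0` and views kind `4`, so the query differs from the other vertices of its
hyperedge. -/
theorem kind_query (e : Fin I.numEdges) (i j : Fin 2) (τ : ℕ) (k : Fin 3) (f g h : Fn W) :
    kind I (query I e i j τ k f g h) ≠ 0 ∧ kind I (query I e i j τ k f g h) ≠ 4 := by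
  fin_cases k
  · show kind I (firstQuery I e i j τ f g h) ≠ 0 ∧ kind I (firstQuery I e i j τ f g h) ≠ 4
    unfold firstQuery
    split_ifs <;> simp [kind, prodWord, word, pairWord]
  · simp [kind, query, pairWord]
  · simp [kind, query, lastQuery, pairWord]

/-- The graph with alphabet size `8` and hyperedges of size `4`. -/
def newGraph : ConstraintGraph 4 (Vert I) (HEdge I) (Fin 8) where
  vertex := fun (((((((e, i), j), τ), k), f), g), h) =>
    ![selector I (I.graph.vertex e 0), selector I (I.graph.vertex e 1), view I e i j τ f g h,
      query I e i j τ k f g h]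
  vertex_injective := by
    rintro ⟨⟨⟨⟨⟨⟨⟨e, i⟩, j⟩, τ⟩, k⟩, f⟩, g⟩, h⟩
    have h01 : selector I (I.graph.vertex e 0) ≠ selector I (I.graph.vertex e 1) := by
      intro hc
      simp only [selector, Prod.mk.injEq, and_true] at hc
      exact absurd (I.graph.vertex_injective e hc) (by decide)
    obtain ⟨h0, h4⟩ := kind_query I e i j τ k f g h
    have hk : ∀ u, kind I (selector I u) = 0 := fun _ => rfl
    have hv : kind I (view I e i j τ f g h) = 4 := rfl
    have h2 : ∀ u, selector I u ≠ view I e i j τ f g h := fun u hc => by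
      have := congrArg (kind I) hc
      rw [hk, hv] at this
      exact absurd this (by decide)
    have h3 : ∀ u, selector I u ≠ query I e i j τ k f g h := fun u hc =>
      h0 (by rw [← hc, hk])
    have h5 : view I e i j τ f g h ≠ query I e i j τ k f g h := fun hc =>
      h4 (by rw [← hc, hv])
    intro a b hab
    fin_cases a <;> fin_cases b <;> first | rfl | (exfalso; revert hab; simp; try tauto)
  constraint := fun (((((((_, i), j), τ), k), _), _), _) =>
    {a : Fin 4 → Fin 8 | Accepts i j τ k (a 0) (a 1) (a 2) (a 3)}

theorem newGraph_satisfiesEdge (φ : Vert I → Fin 8) (e : Fin I.numEdges) (i j : Fin 2) (τ : Fin 6)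
    (k : Fin 3) (f g h : Fn W) :
    (newGraph I).SatisfiesEdge φ (((((((e, i), j), τ), k), f), g), h) ↔
      Accepts i j τ k (φ (selector I (I.graph.vertex e 0))) (φ (selector I (I.graph.vertex e 1)))
        (φ (view I e i j τ f g h)) (φ (query I e i j τ k f g h)) := by
  simp [ConstraintGraph.SatisfiesEdge, newGraph]

section Encoding

variable (ψ : Fin I.numVertices → Fin W)

/-- The pair of values of a hyperedge. -/
def pairVal (e : Fin I.numEdges) : Fin (W ^ 2) :=
  pairOf (ψ (I.graph.vertex e 0)) (ψ (I.graph.vertex e 1))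

/-- The first bit of the local view of a test. -/
def firstBit (e : Fin I.numEdges) (τ : ℕ) (f g h : Fn W) : ℕ :=
  if τ = 1 then (h (pairVal I ψ e)).val * (g (pairVal I ψ e)).val
    else if τ = 2 then (f (pairVal I ψ e)).val * (g (pairVal I ψ e)).val
    else if τ = 4 then (f (up (ψ (I.graph.vertex e 0)))).val
    else if τ = 5 then (f (up (ψ (I.graph.vertex e 1)))).val else (f (pairVal I ψ e)).val

/-- The last bit of the local view of a test. -/
def lastBit (e : Fin I.numEdges) (τ : ℕ) (f g h : Fn W) : ℕ :=
  if τ = 1 then (g (pairVal I ψ e)).val else ((h + shift I e τ f g) (pairVal I ψ e)).val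

/-- The value of a vertex in the encoding of an assignment. -/
def codeVal : Vert I → ℕ := fun ((((((((u, e), _), _), κ), τ), f), g), h) =>
  if (κ : ℕ) = 0 then 0 else if (κ : ℕ) = 1 then (f (up (ψ u))).val
    else if (κ : ℕ) = 2 then (f (pairVal I ψ e)).val
    else if (κ : ℕ) = 3 then (f (pairVal I ψ e)).val * (g (pairVal I ψ e)).val
    else firstBit I ψ e τ f g h + 2 * (h (pairVal I ψ e)).val + 4 * lastBit I ψ e τ f g h

theorem val_mul_val_lt (a b : ZMod 2) : a.val * b.val < 2 := by
  have := ZMod.val_lt a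
  have := ZMod.val_lt b
  interval_cases a.val <;> omega

theorem firstBit_lt (e : Fin I.numEdges) (τ : ℕ) (f g h : Fn W) : firstBit I ψ e τ f g h < 2 := by
  unfold firstBit
  split_ifs <;> first | exact val_mul_val_lt _ _ | exact ZMod.val_lt _

theorem lastBit_lt (e : Fin I.numEdges) (τ : ℕ) (f g h : Fn W) : lastBit I ψ e τ f g h < 2 := by
  unfold lastBit
  split_ifs <;> exact ZMod.val_lt _

theorem codeVal_lt (x : Vert I) : codeVal I ψ x < 8 := by
  obtain ⟨⟨⟨⟨⟨⟨⟨⟨u, e⟩, i⟩, j⟩, κ⟩, τ⟩, f⟩, g⟩, h⟩ := x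
  simp only [codeVal]
  have h1 := firstBit_lt I ψ e τ f g h
  have h2 := lastBit_lt I ψ e τ f g h
  have h3 := ZMod.val_lt (h (pairVal I ψ e))
  have h4 := ZMod.val_lt (f (pairVal I ψ e))
  have h5 := ZMod.val_lt (f (up (ψ u)))
  have h6 := val_mul_val_lt (f (pairVal I ψ e)) (g (pairVal I ψ e))
  split_ifs <;> omega

/-- The encoding of an assignment, with all selectors `0`. -/
def code (x : Vert I) : Fin 8 := ⟨codeVal I ψ x, codeVal_lt I ψ x⟩

end Encoding

/-- The vertices that are relevant for the selectors `s`. -/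
def Active (s : Fin I.numVertices → Fin 2) : Vert I → Prop :=
  fun ((((((((u, e), i), j), κ), _), _), _), _) =>
  (κ : ℕ) ≠ 0 ∧ if (κ : ℕ) = 1 then i = s u
    else i = s (I.graph.vertex e 0) ∧ j = s (I.graph.vertex e 1)

/-- The assignment has the selectors `s` and agrees with the encoding of `ψ` where it matters. -/
def Agrees (φ : Vert I → Fin 8) (s : Fin I.numVertices → Fin 2)
    (ψ : Fin I.numVertices → Fin W) : Prop :=
  (∀ u, (φ (selector I u) : ℕ) = s u) ∧ ∀ x, Active I s x → φ x = code I ψ x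

variable {I}

/-- In an encoding all queried bits are evaluations at the same pair or its components, and each
test becomes an identity over the field with two elements. Test `3` is the one that needs `hψ`: the
relation is `1` at the pair of values. -/
theorem testPred_bits {e : Fin I.numEdges} {ψ : Fin I.numVertices → Fin W}
    (hψ : I.graph.SatisfiesEdge ψ e) (τ : Fin 6) (f g h : Fn W) :
    TestPred τ (firstBit I ψ e τ f g h) (h (pairVal I ψ e)).val (lastBit I ψ e τ f g h) := by
  have hrel : relation I e (pairVal I ψ e) = 1 := by
    unfold relation
    rw [if_pos]
    simp only [pairVal, pairOf, Equiv.symm_apply_apply]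
    have : ![ψ (I.graph.vertex e 0), ψ (I.graph.vertex e 1)] =
        fun i => ψ (I.graph.vertex e i) := by
      funext i
      fin_cases i <;> rfl
    rw [this]
    exact hψ
  have h0 : proj 0 (pairVal I ψ e) = up (ψ (I.graph.vertex e 0)) := proj_pairOf_zero _ _
  have h1 : proj 1 (pairVal I ψ e) = up (ψ (I.graph.vertex e 1)) := proj_pairOf_one _ _
  have key : ∀ a b : ZMod 2, (a.val + b.val + (b + a).val) % 2 = 0 := by decide
  have key2 : ∀ a b c : ZMod 2, (a.val * b.val + c.val + (c + a * b).val) % 2 = 0 := by decide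
  have key3 : ∀ a : ZMod 2, (a.val + (a + 1).val) % 2 = 1 := by decide
  fin_cases τ
  · simp [TestPred, firstBit, lastBit, shift, key]
  · simp [TestPred, firstBit, lastBit]
  · simp [TestPred, firstBit, lastBit, shift, key2]
  · simp [TestPred, lastBit, shift, hrel, key3]
  · simp [TestPred, firstBit, lastBit, shift, key, h0]
  · simp [TestPred, firstBit, lastBit, shift, key, h1]

/-- A hyperedge is vacuous unless its selector values are the current ones, and then its view and
its query are active. -/
theorem Agrees.satisfies {φ : Vert I → Fin 8} {s : Fin I.numVertices → Fin 2}
    {ψ : Fin I.numVertices → Fin W} (h : Agrees I φ s ψ) (hψ : I.graph.Satisfies ψ) :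
    (newGraph I).Satisfies φ := by
  rintro ⟨⟨⟨⟨⟨⟨⟨e, i⟩, j⟩, τ⟩, k⟩, f⟩, g⟩, h'⟩
  rw [newGraph_satisfiesEdge]
  rintro ⟨hi, hj⟩
  rw [h.1] at hi hj
  rw [Nat.mod_eq_of_lt (s _).isLt] at hi hj
  have hi : i = s (I.graph.vertex e 0) := Fin.ext hi.symm
  have hj : j = s (I.graph.vertex e 1) := Fin.ext hj.symm
  have b1 := firstBit_lt I ψ e τ f g h'
  have b2 := ZMod.val_lt (h' (pairVal I ψ e))
  have b3 := lastBit_lt I ψ e τ f g h'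
  have hview : (φ (view I e i j τ f g h') : ℕ) = firstBit I ψ e τ f g h' +
      2 * (h' (pairVal I ψ e)).val + 4 * lastBit I ψ e τ f g h' := by
    rw [h.2 _ ⟨by simp [view], by simp [view, hi, hj]⟩]
    simp [code, codeVal, view]
  have hpair : ∀ f, (φ (pairWord I e i j f) : ℕ) = (f (pairVal I ψ e)).val := by
    intro f
    rw [h.2 _ ⟨by simp [pairWord], by simp [pairWord, hi, hj]⟩]
    simp [code, codeVal, pairWord]
  have hprod : ∀ f g, (φ (prodWord I e i j f g) : ℕ) =
      (f (pairVal I ψ e)).val * (g (pairVal I ψ e)).val := by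
    intro f g
    rw [h.2 _ ⟨by simp [prodWord], by simp [prodWord, hi, hj]⟩]
    simp [code, codeVal, prodWord]
  have hw0 : ∀ f, (φ (word I (I.graph.vertex e 0) i f) : ℕ) =
      (f (up (ψ (I.graph.vertex e 0)))).val := by
    intro f
    rw [h.2 _ ⟨by simp [word], by simp [word, hi]⟩]
    simp [code, codeVal, word]
  have hw1 : ∀ f, (φ (word I (I.graph.vertex e 1) j f) : ℕ) =
      (f (up (ψ (I.graph.vertex e 1)))).val := by
    intro f
    rw [h.2 _ ⟨by simp [word], by simp [word, hj]⟩]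
    simp [code, codeVal, word]
  rw [hview]
  have e1 : (firstBit I ψ e τ f g h' + 2 * (h' (pairVal I ψ e)).val +
      4 * lastBit I ψ e τ f g h') % 2 = firstBit I ψ e τ f g h' := by omega
  have e2 : (firstBit I ψ e τ f g h' + 2 * (h' (pairVal I ψ e)).val +
      4 * lastBit I ψ e τ f g h') / 2 % 2 = (h' (pairVal I ψ e)).val := by omega
  have e3 : (firstBit I ψ e τ f g h' + 2 * (h' (pairVal I ψ e)).val +
      4 * lastBit I ψ e τ f g h') / 4 % 2 = lastBit I ψ e τ f g h' := by omega
  refine ⟨?_, ?_⟩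
  · rw [e1, e2, e3]
    exact testPred_bits (hψ e) τ f g h'
  · fin_cases k
    · show _ / 2 ^ 0 % 2 = (φ (firstQuery I e i j τ f g h') : ℕ)
      rw [pow_zero, Nat.div_one, e1]
      unfold firstQuery firstBit
      split_ifs <;> simp only [hpair, hprod, hw0, hw1]
    · show _ / 2 ^ 1 % 2 = (φ (pairWord I e i j h') : ℕ)
      rw [pow_one, e2, hpair]
    · show _ / 2 ^ 2 % 2 = (φ (lastQuery I e i j τ f g h') : ℕ)
      rw [show 2 ^ 2 = 4 from rfl, e3, lastQuery, hpair, lastBit]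
      split_ifs <;> rfl

theorem agrees_code (ψ : Fin I.numVertices → Fin W) : Agrees I (code I ψ) 0 ψ :=
  ⟨fun _ => rfl, fun _ _ => rfl⟩

open Relation in
-- Agreement is a condition on each vertex separately, so all mixtures inherit it.
theorem Agrees.reachable {φ φ' : Vert I → Fin 8} {s : Fin I.numVertices → Fin 2}
    {ψ : Fin I.numVertices → Fin W} (h : Agrees I φ s ψ) (h' : Agrees I φ' s ψ)
    (hψ : I.graph.Satisfies ψ) : ReflTransGen (newGraph I).Move φ φ' := by
  refine (newGraph I).reachable_of_mixtures φ φ' fun χ hχ =>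
    Agrees.satisfies (s := s) (ψ := ψ) ⟨fun u => ?_, fun x hx => ?_⟩ hψ
  · rcases hχ (selector I u) with e | e <;> rw [e]
    exacts [h.1 u, h'.1 u]
  · rcases hχ x with e | e <;> rw [e]
    exacts [h.2 x hx, h'.2 x hx]

theorem kind_of_active {s : Fin I.numVertices → Fin 2} {x : Vert I} (h : Active I s x) :
    kind I x ≠ 0 := fun hc => h.1 (by rw [show x.1.1.1.1.2 = 0 from hc]; rfl)

open Relation in
/-- A change of the value of one vertex can be imitated. -/
theorem Agrees.exists_reachable {φ : Vert I → Fin 8} {s : Fin I.numVertices → Fin 2}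
    {ψ ψ' : Fin I.numVertices → Fin W} (h : Agrees I φ s ψ) (hψ : I.graph.Satisfies ψ)
    (hψ' : I.graph.Satisfies ψ') (u : Fin I.numVertices) (hu : ∀ v, v ≠ u → ψ v = ψ' v) :
    ∃ φ' s', Agrees I φ' s' ψ' ∧ ReflTransGen (newGraph I).Move φ φ' := by
  classical
  -- First the encoding of `ψ'` is written wherever the selectors `s` do not look.
  set φ₁ : Vert I → Fin 8 := fun x => if kind I x = 0 ∨ Active I s x then φ x else code I ψ' x
    with hφ₁
  have hsel : ∀ v, φ₁ (selector I v) = φ (selector I v) := fun v => if_pos (Or.inl rfl)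
  have h₁ : Agrees I φ₁ s ψ := by
    refine ⟨fun v => by rw [hsel, h.1], fun x hx => ?_⟩
    rw [← h.2 x hx]
    exact if_pos (Or.inr hx)
  set s' : Fin I.numVertices → Fin 2 := Function.update s u (s u + 1) with hs'
  -- Then one flip of the selector of `u` makes the new value count.
  set φ₂ : Vert I → Fin 8 := Function.update φ₁ (selector I u) (Fin.castLE (by norm_num) (s u + 1))
    with hφ₂
  have hne : ∀ a : Fin 2, a ≠ a + 1 := by decide
  have h₂ : Agrees I φ₂ s' ψ' := by
    refine ⟨fun v => ?_, fun x hx => ?_⟩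
    · by_cases hv : v = u
      · subst hv
        simp [hφ₂, hs']
      · have : selector I v ≠ selector I u := by
          intro hc
          simp only [selector, Prod.mk.injEq, and_true] at hc
          exact hv hc
        rw [hφ₂, Function.update_of_ne this, hs', Function.update_of_ne hv, h₁.1]
    · have hk := kind_of_active hx
      have hxs : x ≠ selector I u := by
        rintro rfl
        exact hk rfl
      rw [hφ₂, Function.update_of_ne hxs, hφ₁]
      by_cases hact : Active I s x
      · simp only [hact, or_true, if_true]
        rw [h.2 x hact]
        obtain ⟨⟨⟨⟨⟨⟨⟨⟨w, e⟩, i⟩, j⟩, κ⟩, τ⟩, f⟩, g⟩, k⟩ := x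
        -- What is active both before and after the flip depends only on vertices with unchanged
        -- selector, hence not on `u`, and there the two encodings coincide. What was inactive
        -- before has already been rewritten.
        have hold : ∀ v, s v = s' v → ψ v = ψ' v := by
          intro v hv
          refine hu v ?_
          rintro rfl
          rw [hs', Function.update_self] at hv
          exact hne _ hv
        obtain ⟨hκ, hact⟩ := hact
        obtain ⟨-, hx⟩ := hx
        refine Fin.ext ?_
        simp only [code, codeVal]
        by_cases h1 : (κ : ℕ) = 1
        · simp only [h1, if_true] at hact hx
          simp [h1, hold w (hact.symm.trans hx)]
        · simp only [h1, if_false] at hact hx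
          have p1 := hold _ (hact.1.symm.trans hx.1)
          have p2 := hold _ (hact.2.symm.trans hx.2)
          simp only [h1, if_false, hκ, firstBit, lastBit, pairVal, p1, p2]
      · exact if_neg (by tauto)
  refine ⟨φ₂, s', h₂, (h.reachable h₁ hψ).tail ⟨h₂.satisfies hψ', ?_⟩⟩
  exact ConstraintGraph.hammingDist_le_one_of_forall (selector I u) fun y hy =>
    (Function.update_of_ne hy _ _).symm

open Relation in
-- Once all copies carry `ψ`, the selectors can be reset in any order: each mixture agrees with `ψ`
-- with respect to its own selectors.
theorem Agrees.reachable_code {φ : Vert I → Fin 8} {s : Fin I.numVertices → Fin 2}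
    {ψ : Fin I.numVertices → Fin W} (h : Agrees I φ s ψ) (hψ : I.graph.Satisfies ψ) :
    ReflTransGen (newGraph I).Move φ (code I ψ) := by
  classical
  set φ₁ : Vert I → Fin 8 := fun x => if kind I x = 0 then φ x else code I ψ x with hφ₁
  have hsel : ∀ v, φ₁ (selector I v) = φ (selector I v) := fun v => if_pos rfl
  have hrest : ∀ x, kind I x ≠ 0 → φ₁ x = code I ψ x := fun x hx => if_neg hx
  have h₁ : Agrees I φ₁ s ψ :=
    ⟨fun v => by rw [hsel, h.1], fun x hx => hrest x (kind_of_active hx)⟩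
  refine (h.reachable h₁ hψ).trans ?_
  refine (newGraph I).reachable_of_mixtures _ _ fun χ hχ => ?_
  refine Agrees.satisfies (s := fun v => if χ (selector I v) = φ₁ (selector I v) then s v else 0)
    (ψ := ψ) ⟨fun v => ?_, fun x hx => ?_⟩ hψ
  · by_cases hv : χ (selector I v) = φ₁ (selector I v)
    · simp only [hv, if_true]
      exact h₁.1 v
    · simp only [hv, if_false]
      rw [(hχ _).resolve_left hv]
      rfl
  · rcases hχ x with e | e
    · rw [e, hrest x (kind_of_active hx)]
    · exact e

open Relation in
theorem reachable_code_of_seq {T : ℕ} {s : Fin (T + 1) → Fin I.numVertices → Fin W}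
    (hs : ConstraintGraph.IsReconfSeq I.ini I.tar s) (hsat : ∀ t, I.graph.Satisfies (s t)) :
    ReflTransGen (newGraph I).Move (code I I.ini) (code I I.tar) := by
  have : Nonempty (Fin I.numVertices) := ⟨vertZero I⟩
  have key : ∀ t : Fin (T + 1), ∃ φ σ, Agrees I φ σ (s t) ∧
      ReflTransGen (newGraph I).Move (code I I.ini) φ := by
    intro t
    induction t using Fin.induction with
    | zero => exact ⟨_, _, agrees_code _, by rw [hs.1]⟩
    | succ t ih =>
      obtain ⟨φ, σ, h, hr⟩ := ih
      obtain ⟨u, hu⟩ := ConstraintGraph.exists_of_hammingDist_le_one (hs.2.2 t)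
      obtain ⟨φ', σ', h', hr'⟩ := h.exists_reachable (hsat _) (hsat _) u hu
      exact ⟨φ', σ', h', hr.trans hr'⟩
  obtain ⟨φ, σ, h, hr⟩ := key (Fin.last T)
  rw [hs.2.1] at h
  exact hr.trans (h.reachable_code I.tar_satisfies)

instance : Nonempty (HEdge I) := ⟨(((((((edgeZero I, 0), 0), 0), 0), 0), 0), 0)⟩

theorem completeness (h : I.optValue = 1) :
    (newGraph I).reconfValue (code I I.ini) (code I I.tar) = 1 := by
  obtain ⟨T, s, hs, hval⟩ := (I.graph.reconfValue_isGreatest I.ini I.tar).1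
  have : Nonempty (Fin I.numEdges) := ⟨edgeZero I⟩
  have hsat : ∀ t, I.graph.Satisfies (s t) := by
    intro t
    rw [← I.graph.value_eq_one_iff]
    refine le_antisymm (I.graph.value_le_one _) ?_
    have := I.graph.seqValue_le s t
    rw [hval] at this
    exact h.symm.le.trans this
  obtain ⟨T', s', hs', hsat'⟩ := (newGraph I).exists_seq_of_reachable
    ((agrees_code I.ini).satisfies I.ini_satisfies) (reachable_code_of_seq hs hsat)
  exact (newGraph I).reconfValue_eq_one_of_seq hs' hsat'

end AlphabetReduction

/-! ### Decoding and soundness -/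

namespace AlphabetReduction

open LongCode Finset

variable {W : ℕ} (I : CSPReconfInstance 2 W)

/-- The selector values of an assignment. -/
def sel (φ : Vert I → Fin 8) (u : Fin I.numVertices) : Fin 2 :=
  ⟨φ (selector I u) % 2, Nat.mod_lt _ two_pos⟩

/-- A value as a bit. -/
def bit (φ : Vert I → Fin 8) (x : Vert I) : ZMod 2 := ((φ x : ℕ) : ZMod 2)

/-- The selected word of a vertex. -/
def selWord (φ : Vert I → Fin 8) (u : Fin I.numVertices) (f : Fn W) : ZMod 2 :=
  bit I φ (word I u (sel I φ u) f)

open Classical in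
/-- The symbol whose long code is close to a word, and `b` if there is none. -/
noncomputable def decodeWord (A : Fn W → ZMod 2) (b : Fin W) : Fin W :=
  if h : ∃ a : Fin W, Close A (up a) then h.choose else b

/-- The assignment decoded from the selected words. -/
noncomputable def decode (φ : Vert I → Fin 8) (u : Fin I.numVertices) : Fin W :=
  decodeWord (selWord I φ u) (I.ini u)

variable {I}

theorem decode_eq {φ : Vert I → Fin 8} {u : Fin I.numVertices} {a : Fin W}
    (h : Close (selWord I φ u) (up a)) : decode I φ u = a := by
  have hex : ∃ a : Fin W, Close (selWord I φ u) (up a) := ⟨a, h⟩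
  rw [decode, decodeWord, dif_pos hex]
  exact up_injective (hex.choose_spec.unique h)

theorem decode_code (ψ : Fin I.numVertices → Fin W) : decode I (code I ψ) = ψ := by
  funext u
  refine decode_eq ?_
  have : selWord I (code I ψ) u = fun f => f (up (ψ u)) := by
    funext f
    simp [selWord, bit, code, codeVal, word]
  rw [this]
  exact close_self _

/-- The decoded value at `u` depends only on the selector and the words of `u`, and all of these
have `u` as their first component. -/
theorem decode_congr {φ φ' : Vert I → Fin 8} {x : Vert I} (h : ∀ y, y ≠ x → φ y = φ' y)
    {u : Fin I.numVertices} (hu : u ≠ x.1.1.1.1.1.1.1.1) : decode I φ u = decode I φ' u := by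
  have hsel : sel I φ u = sel I φ' u := by
    refine Fin.ext ?_
    simp only [sel]
    rw [h]
    rintro rfl
    exact hu rfl
  have hword : selWord I φ u = selWord I φ' u := by
    funext f
    unfold selWord bit
    rw [hsel, h]
    rintro rfl
    exact hu rfl
  unfold decode
  rw [hword]

theorem testPred_cast {τ x y z : ℕ} (h : TestPred τ x y z) :
    if τ = 1 then (x : ZMod 2) = y * z else if τ = 3 then (y + z : ZMod 2) = 1
      else (x + y + z : ZMod 2) = 0 := by
  unfold TestPred at h
  split_ifs at h ⊢
  · rw [h]; push_cast; rfl
  · have := (ZMod.natCast_eq_natCast_iff' (y + z) 1 2).2 h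
    simpa using this
  · have := (ZMod.natCast_eq_natCast_iff' (x + y + z) 0 2).2 h
    simpa using this

/-- The equation of test `τ` for the queried bits. -/
def Passes (φ : Vert I → Fin 8) (e : Fin I.numEdges) (i j : Fin 2) (τ : Fin 6)
    (t : Triple (Fin (W ^ 2))) : Prop :=
  if (τ : ℕ) = 1 then bit I φ (query I e i j τ 0 t.1 t.2.1 t.2.2) =
      bit I φ (query I e i j τ 1 t.1 t.2.1 t.2.2) * bit I φ (query I e i j τ 2 t.1 t.2.1 t.2.2)
    else if (τ : ℕ) = 3 then bit I φ (query I e i j τ 1 t.1 t.2.1 t.2.2) +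
      bit I φ (query I e i j τ 2 t.1 t.2.1 t.2.2) = 1
    else bit I φ (query I e i j τ 0 t.1 t.2.1 t.2.2) +
      bit I φ (query I e i j τ 1 t.1 t.2.1 t.2.2) +
      bit I φ (query I e i j τ 2 t.1 t.2.1 t.2.2) = 0

/-- The hyperedges for `k = 0, 1, 2` share one view; its bits pass the test and equal the queried
entries. -/
theorem passes_of_satisfiesEdge {φ : Vert I → Fin 8} {e : Fin I.numEdges} {τ : Fin 6}
    {t : Triple (Fin (W ^ 2))}
    (h : ∀ k, (newGraph I).SatisfiesEdge φ (((((((e, sel I φ (I.graph.vertex e 0)),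
      sel I φ (I.graph.vertex e 1)), τ), k), t.1), t.2.1), t.2.2)) :
    Passes φ e (sel I φ (I.graph.vertex e 0)) (sel I φ (I.graph.vertex e 1)) τ t := by
  simp only [newGraph_satisfiesEdge] at h
  have h' := fun k => h k ⟨rfl, rfl⟩
  have := testPred_cast (h' 0).1
  have e0 := (h' 0).2
  have e1 := (h' 1).2
  have e2 := (h' 2).2
  simp only [Fin.val_zero, pow_zero, Nat.div_one] at e0
  simp only [Fin.val_one, pow_one] at e1
  simp only [Fin.val_two, show 2 ^ 2 = 4 from rfl] at e2
  rw [e0, e1, e2] at this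
  exact this

open Classical in
-- Each triple that fails a test violates one of three hyperedges, and distinct triples violate
-- distinct ones. If few hyperedges over `e` were violated, all six hypotheses of `tests_sound`
-- would hold, and the resulting `p` would be an allowed pair that consists of the decoded values.
theorem card_violated_ge {φ : Vert I → Fin 8} {e : Fin I.numEdges}
    (h : ¬ I.graph.SatisfiesEdge (decode I φ) e) :
    Fintype.card (Triple (Fin (W ^ 2))) ≤ 100 *
      #{x : HEdge I | ¬ (newGraph I).SatisfiesEdge φ x ∧ x.1.1.1.1.1.1.1 = e} := by
  by_contra! hlt
  set i := sel I φ (I.graph.vertex e 0) with hi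
  set j := sel I φ (I.graph.vertex e 1) with hj
  have hcard : ∀ (τ : Fin 6) (P : Triple (Fin (W ^ 2)) → Prop) [DecidablePred P],
      (∀ t, P t → ¬ Passes φ e i j τ t) → 100 * #{t | P t} <
        Fintype.card (Triple (Fin (W ^ 2))) := by
    intro τ P _ hP
    refine lt_of_le_of_lt (Nat.mul_le_mul_left _ ?_) hlt
    have hex : ∀ t, P t → ∃ k, ¬ (newGraph I).SatisfiesEdge φ
        (((((((e, i), j), τ), k), t.1), t.2.1), t.2.2) := by
      intro t ht
      by_contra! hc
      exact hP t ht (passes_of_satisfiesEdge hc)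
    choose! k hk using hex
    refine card_le_card_of_injOn (fun t => (((((((e, i), j), τ), k t), t.1), t.2.1), t.2.2))
      (fun t ht => ?_) (fun t _ t' _ htt => ?_)
    · rw [mem_coe, mem_filter] at ht ⊢
      exact ⟨mem_univ _, hk t ht.2, rfl⟩
    · simp only [Prod.mk.injEq] at htt
      exact Prod.ext htt.1.1.2 (Prod.ext htt.1.2 htt.2)
  obtain ⟨p, hp, h0, h1⟩ := tests_sound (relation I e) (proj 0) (proj 1)
    (selWord I φ (I.graph.vertex e 0)) (selWord I φ (I.graph.vertex e 1))
    (fun f => bit I φ (pairWord I e i j f)) (fun f g => bit I φ (prodWord I e i j f g))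
    (hcard 0 _ fun t ht hc => ht hc) (hcard 1 _ fun t ht hc => ht hc)
    (hcard 2 _ fun t ht hc => ht hc) (hcard 3 _ fun t ht hc => ht hc)
    (hcard 4 _ fun t ht hc => ht hc) (hcard 5 _ fun t ht hc => ht hc)
  apply h
  have hmem : finFunctionFinEquiv.symm p ∈ I.graph.constraint e := by
    by_contra hc
    rw [relation, if_neg hc] at hp
    exact absurd hp (by decide)
  have : (fun k => decode I φ (I.graph.vertex e k)) = finFunctionFinEquiv.symm p := by
    funext k
    fin_cases k
    exacts [decode_eq h0, decode_eq h1]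
  unfold ConstraintGraph.SatisfiesEdge
  rw [this]
  exact hmem

theorem one_sub_value_decode_le (φ : Vert I → Fin 8) :
    1 - I.graph.value (decode I φ) ≤ 7200 * (1 - (newGraph I).value φ) := by
  classical
  have : Nonempty (Fin I.numEdges) := ⟨edgeZero I⟩
  set N := Fintype.card (Fn W) with hN
  have hNpos : 0 < N := Fintype.card_pos
  have hT : Fintype.card (Triple (Fin (W ^ 2))) = N ^ 3 := by
    rw [Fintype.card_prod, Fintype.card_prod, ← hN]; ring
  -- `72 = 2 * 2 * 6 * 3` counts selector values, tests and bits. Together with the hundredth from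
  -- `card_violated_ge` it makes the factor `7200`.
  have hE : Fintype.card (HEdge I) = 72 * I.numEdges * N ^ 3 := by
    simp only [HEdge, Fintype.card_prod, Fintype.card_fin, ← hN]; ring
  have key := card_mul_le_sum (fun e => ¬ I.graph.SatisfiesEdge (decode I φ) e)
    (fun e => 100 * #{x : HEdge I | ¬ (newGraph I).SatisfiesEdge φ x ∧ x.1.1.1.1.1.1.1 = e})
    (N ^ 3) fun e he => hT ▸ card_violated_ge he
  rw [← mul_sum] at key
  have hsum : ∑ e, #{x : HEdge I | ¬ (newGraph I).SatisfiesEdge φ x ∧ x.1.1.1.1.1.1.1 = e} =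
      #{x : HEdge I | ¬ (newGraph I).SatisfiesEdge φ x} := by
    rw [card_eq_sum_card_fiberwise (f := fun x : HEdge I => x.1.1.1.1.1.1.1) (t := univ)
      (fun _ _ => by simp)]
    simp only [filter_filter]
  rw [hsum] at key
  rw [I.graph.one_sub_value, (newGraph I).one_sub_value, Nat.card_eq_fintype_card,
    Nat.card_eq_fintype_card, Nat.card_eq_fintype_card, Nat.card_eq_fintype_card, hE,
    Fintype.card_fin, Fintype.card_subtype, Fintype.card_subtype]
  have hm : (0 : ℝ) < I.numEdges := by exact_mod_cast I.numEdges_pos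
  have hN' : (0 : ℝ) < N := by exact_mod_cast hNpos
  push_cast
  rw [← mul_div_assoc, div_le_div_iff₀ hm (by positivity)]
  have key' : ((#{e | ¬ I.graph.SatisfiesEdge (decode I φ) e} : ℕ) : ℝ) * N ^ 3 ≤
      100 * (#{x : HEdge I | ¬ (newGraph I).SatisfiesEdge φ x} : ℕ) := by exact_mod_cast key
  nlinarith [mul_le_mul_of_nonneg_left key' (mul_nonneg (by norm_num : (0 : ℝ) ≤ 72) hm.le)]

theorem soundness : 1 - I.optValue ≤
    7200 * (1 - (newGraph I).reconfValue (code I I.ini) (code I I.tar)) := by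
  have hle : (newGraph I).reconfValue (code I I.ini) (code I I.tar) ≤
      1 - (1 - I.optValue) / 7200 := by
    refine csSup_le ((newGraph I).reconfValueSet_nonempty_bddAbove _ _).1 ?_
    rintro r ⟨T, s, ⟨h0, h1, h2⟩, rfl⟩
    have : Nonempty (Vert I) := ⟨selector I (vertZero I)⟩
    -- Decoding memberwise yields a reconfiguration sequence of the old instance, so some member has
    -- a decoded value at most `I.optValue`.
    have hseq : ConstraintGraph.IsReconfSeq I.ini I.tar fun t => decode I (s t) := by
      refine ⟨by simp only [h0, decode_code], by simp only [h1, decode_code], fun t => ?_⟩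
      obtain ⟨x, hx⟩ := ConstraintGraph.exists_of_hammingDist_le_one (h2 t)
      exact ConstraintGraph.hammingDist_le_one_of_forall _ fun u hu => decode_congr hx hu
    obtain ⟨t, ht⟩ := I.graph.seqValue_mem fun t => decode I (s t)
    have hopt : I.graph.value (decode I (s t)) ≤ I.optValue := by
      rw [ht]
      exact (I.graph.reconfValue_isGreatest I.ini I.tar).2 ⟨T, _, hseq, rfl⟩
    have := (newGraph I).seqValue_le s t
    have := one_sub_value_decode_le (s t)
    linarith
  linarith

/-- Soundness needs only `tildeKappa ≤ 1 / 7200`; the constant is much smaller. -/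
theorem tildeKappa_bounds : 0 < tildeKappa ∧ tildeKappa ≤ 1 / 14400 := by
  norm_num [tildeKappa, delta0, rho]

theorem reconfValue_lt {ε : ℝ} (h : I.optValue < 1 - ε) :
    (newGraph I).reconfValue (code I I.ini) (code I I.tar) < 1 - tildeKappa * ε := by
  have hs := soundness (I := I)
  obtain ⟨h0, h1⟩ := tildeKappa_bounds
  have hle : I.optValue ≤ 1 := by
    obtain ⟨T, s, -, hval⟩ := (I.graph.reconfValue_isGreatest I.ini I.tar).1
    obtain ⟨t, ht⟩ := I.graph.seqValue_mem s
    unfold CSPReconfInstance.optValue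
    rw [← hval, ← ht]
    exact I.graph.value_le_one _
  -- For negative `ε` the claimed bound exceeds `1`, and values are at most `1`.
  rcases lt_or_ge ε 0 with hε | hε
  · nlinarith [mul_pos h0 (neg_pos.2 hε)]
  · nlinarith [mul_le_mul_of_nonneg_right h1 hε]

end AlphabetReduction

/-! ### Derived arithmetic operations -/

namespace StackProg

namespace Ex

variable (inp env : List ℕ) (a b c d e x y : Ex)

theorem eval_inp : (Ex.inp a).eval inp env = inp.getD (a.eval inp env) 0 := rfl

/-- Product. -/
def mul : Ex := app2 (sum (var 0) (var 1)) a b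

theorem eval_mul : (mul a b).eval inp env = a.eval inp env * b.eval inp env := by
  simp [mul, eval]

/-- The condition `a = b` as a choice between `x` and `y`. -/
def ite : Ex :=
  add (mul (sub (const 1) (add (sub a b) (sub b a))) x)
    (mul (sub (const 1) (sub (const 1) (add (sub a b) (sub b a)))) y)

/-- The sum of the two truncated differences vanishes exactly for equal numbers, which turns the
comparison into a factor `0` or `1`. -/
theorem eval_ite : (ite a b x y).eval inp env =
    if a.eval inp env = b.eval inp env then x.eval inp env else y.eval inp env := by
  simp only [ite, eval, eval_mul]
  split_ifs with h
  · simp [h]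
  · rw [show 1 - (a.eval inp env - b.eval inp env + (b.eval inp env - a.eval inp env)) = 0 by
      omega]
    simp

theorem eval_ite_of {inp env : List ℕ} {a b x y : Ex} {m n k l : ℕ} (ha : a.eval inp env = m)
    (hb : b.eval inp env = n) (hx : x.eval inp env = k) (hy : y.eval inp env = l) :
    (ite a b x y).eval inp env = if m = n then k else l := by
  rw [eval_ite, hx, hy]
  simp only [ha, hb]

/-- Quotient. -/
def div : Ex :=
  app2 (sum (var 0) (mul (sub (const 1) (sub (mul (add (var 2) (const 1)) (var 1)) (var 0)))
    (sub (const 1) (sub (const 1) (var 1))))) a b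

/-- The quotient counts the `i` with `(i + 1) * b ≤ a`. The factor `1 - (1 - b)` provides for `a / 0
= 0`. -/
theorem sum_indicator_eq_div (a b : ℕ) :
    ∑ i ∈ Finset.range a, (1 - ((i + 1) * b - a)) * (1 - (1 - b)) = a / b := by
  rcases Nat.eq_zero_or_pos b with rfl | hb
  · simp
  · have h : ∀ i, (1 - ((i + 1) * b - a)) * (1 - (1 - b)) = if i < a / b then 1 else 0 := by
      intro i
      rw [show 1 - (1 - b) = 1 by omega, mul_one]
      have := Nat.le_div_iff_mul_le hb (x := i + 1) (y := a)
      split_ifs with hi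
      · have := this.1 hi
        omega
      · have := mt this.2 hi
        omega
    simp only [h, Finset.sum_boole, Nat.cast_id]
    have : ({i ∈ Finset.range a | i < a / b} : Finset ℕ) = Finset.range (a / b) := by
      ext i
      simp only [Finset.mem_filter, Finset.mem_range, and_iff_right_iff_imp]
      exact fun hi => hi.trans_le (Nat.div_le_self a b)
    rw [this, Finset.card_range]

theorem eval_div : (div a b).eval inp env = a.eval inp env / b.eval inp env := by
  simp only [div, eval, eval_mul]
  exact sum_indicator_eq_div _ _

/-- Remainder. -/
def mod : Ex := sub a (mul b (div a b))

theorem eval_mod : (mod a b).eval inp env = a.eval inp env % b.eval inp env := by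
  simp only [mod, eval, eval_mul, eval_div]
  rw [Nat.mod_def]

/-- The alphabet size. -/
def alphabet : Ex := .inp (const 0)

theorem eval_alphabet : alphabet.eval inp env = inp.getD 0 0 := rfl

/-- The power `2 ^ a`, for `a` up to the square of the alphabet size. -/
def pow2 : Ex :=
  app1 (iterW (const 1) (iterW (var 2) (add (var 4) (mul (var 4)
    (sub (const 1) (sub (add (add (mul (var 1) alphabet) (var 3)) (const 1)) (var 0))))))) a

/-- One round of `pow2`: the accumulator doubles as long as the round number `n` is below the
exponent. -/
theorem double_if_lt (p n : ℕ) :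
    2 ^ min p n + 2 ^ min p n * (1 - (n + 1 - p)) = 2 ^ min p (n + 1) := by
  rcases lt_or_ge n p with h | h
  · rw [show 1 - (n + 1 - p) = 1 by omega, min_eq_right h.le, min_eq_right (by omega), pow_succ]
    ring
  · rw [show 1 - (n + 1 - p) = 0 by omega, min_eq_left h, min_eq_left (by omega)]
    ring

/-- A power with variable exponent needs `iterW`, which runs for `W` rounds. Two nested iterations
give `W * W` rounds, numbered `i * W + j`, and larger exponents do not occur in the numbers of
functions on pairs. -/
theorem eval_pow2 : (pow2 a).eval inp env =
    2 ^ min (a.eval inp env) (inp.getD 0 0 * inp.getD 0 0) := by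
  simp only [pow2, eval, eval_mul, eval_alphabet]
  set W := inp.getD 0 0
  set p := a.eval inp env
  have inner : ∀ i k : ℕ, (Nat.rec (2 ^ min p (i * W)) (fun j acc => acc + acc *
      (1 - (i * W + j + 1 - p))) k : ℕ) = 2 ^ min p (i * W + k) := by
    intro i k
    induction k with
    | zero => rfl
    | succ k ih =>
      simp only [ih]
      exact double_if_lt p (i * W + k)
  have outer : ∀ k : ℕ, (Nat.rec 1 (fun i acc => Nat.rec acc (fun j acc => acc + acc *
      (1 - (i * W + j + 1 - p))) W) k : ℕ) = 2 ^ min p (k * W) := by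
    intro k
    induction k with
    | zero => simp
    | succ k ih =>
      simp only [ih, inner]
      rw [Nat.succ_mul]
  exact outer W

theorem eval_pow2_of_le {p : ℕ} (h : a.eval inp env = p) (hp : p ≤ inp.getD 0 0 ^ 2) :
    (pow2 a).eval inp env = 2 ^ p := by
  rw [eval_pow2, h, ← pow_two, min_eq_left hp]

/-- Bit `b` of `a`. -/
def testBit : Ex := mod (div a (pow2 b)) (const 2)

/-- The condition of a test on the local view. -/
def testPred : Ex :=
  ite a (const 1) (ite b (mul c d) (const 1) (const 0))
    (ite a (const 3) (mod (add c d) (const 2))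
      (sub (const 1) (mod (add (add b c) d) (const 2))))

theorem eval_testPred : (testPred a b c d).eval inp env =
    if AlphabetReduction.TestPred (a.eval inp env) (b.eval inp env) (c.eval inp env)
      (d.eval inp env) then 1 else 0 := by
  simp only [testPred, eval_ite, eval_mul, eval, eval_mod, AlphabetReduction.TestPred]
  split_ifs <;> omega

/-- The power `2 ^ a`, for `a` less than `3`. -/
def smallPow : Ex := ite a (const 0) (const 1) (ite a (const 1) (const 2) (const 4))

theorem eval_smallPow (h : a.eval inp env < 3) :
    (smallPow a).eval inp env = 2 ^ a.eval inp env := by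
  simp only [smallPow, eval_ite, eval]
  generalize a.eval inp env = k at h
  interval_cases k <;> rfl

/-- The condition `Accepts`. -/
def accepts (i j τ k : Ex) : Ex :=
  ite (mod a (const 2)) i (ite (mod b (const 2)) j
    (mul (testPred τ (mod c (const 2)) (mod (div c (const 2)) (const 2))
      (mod (div c (const 4)) (const 2)))
      (ite (mod (div c (smallPow k)) (const 2)) d (const 1) (const 0))) (const 1)) (const 1)

theorem eval_accepts (i j τ k : Ex) (hk : k.eval inp env < 3) :
    (accepts a b c d i j τ k).eval inp env =
      if AlphabetReduction.Accepts (i.eval inp env) (j.eval inp env) (τ.eval inp env)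
        (k.eval inp env) (a.eval inp env) (b.eval inp env) (c.eval inp env) (d.eval inp env)
      then 1 else 0 := by
  simp only [accepts, eval_ite, eval_mul, eval_mod, eval_div, eval_testPred, eval_smallPow _ _ _ hk,
    AlphabetReduction.Accepts]
  simp only [eval]
  by_cases h1 : a.eval inp env % 2 = i.eval inp env <;>
    by_cases h2 : b.eval inp env % 2 = j.eval inp env <;>
    by_cases h3 : c.eval inp env / 2 ^ k.eval inp env % 2 = d.eval inp env <;>
    by_cases h4 : AlphabetReduction.TestPred (τ.eval inp env) (c.eval inp env % 2)
      (c.eval inp env / 2 % 2) (c.eval inp env / 4 % 2) <;>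
    simp [h1, h2, h3, h4]

end Ex

end StackProg

/-! ### Numbering and the new instance -/

namespace AlphabetReduction

variable {W : ℕ}

/-- The numbering of the functions on pairs. -/
def fnEquiv (W : ℕ) : Fn W ≃ Fin (2 ^ W ^ 2) := finFunctionFinEquiv

/-- The number of a function. -/
def num (f : Fn W) : ℕ := fnEquiv W f

theorem num_lt (f : Fn W) : num f < 2 ^ W ^ 2 := (fnEquiv W f).isLt

/-- The values of a function are the binary digits of its number, so expressions can evaluate it by
`testBit` and assemble it by a sum. -/
theorem num_eq_sum (f : Fn W) : num f = ∑ p : Fin (W ^ 2), (f p).val * 2 ^ (p : ℕ) := rfl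

theorem num_zero : num (0 : Fn W) = 0 := by
  simp [num_eq_sum]

theorem num_div_mod (f : Fn W) (p : Fin (W ^ 2)) : num f / 2 ^ (p : ℕ) % 2 = (f p).val := by
  conv_rhs => rw [← (fnEquiv W).symm_apply_apply f]
  rfl

/-- The lexicographic numbering of the pairs of two numbered types. -/
def pairEquiv {α β : Type} {a b : ℕ} (eα : α ≃ Fin a) (eβ : β ≃ Fin b) : α × β ≃ Fin (a * b) :=
  (Equiv.prodCongr eα eβ).trans finProdFinEquiv

variable (I : CSPReconfInstance 2 W)

/-- The number of vertices. -/
def vertCount : ℕ :=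
  I.numVertices * I.numEdges * 2 * 2 * 5 * 6 * 2 ^ W ^ 2 * 2 ^ W ^ 2 * 2 ^ W ^ 2

/-- The number of hyperedges. -/
def hedgeCount : ℕ := I.numEdges * 2 * 2 * 6 * 3 * 2 ^ W ^ 2 * 2 ^ W ^ 2 * 2 ^ W ^ 2

/-- The numbering of the vertices. -/
def vertEquiv : Vert I ≃ Fin (vertCount I) :=
  pairEquiv (pairEquiv (pairEquiv (pairEquiv (pairEquiv (pairEquiv (pairEquiv finProdFinEquiv
    (.refl _)) (.refl _)) (.refl _)) (.refl _)) (fnEquiv W)) (fnEquiv W)) (fnEquiv W)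

/-- The numbering of the hyperedges. -/
def edgeEquiv : HEdge I ≃ Fin (hedgeCount I) :=
  pairEquiv (pairEquiv (pairEquiv (pairEquiv (pairEquiv (pairEquiv finProdFinEquiv
    (.refl _)) (.refl _)) (.refl _)) (fnEquiv W)) (fnEquiv W)) (fnEquiv W)

/-- A mixed radix expansion with `h` as its lowest digit; expressions can compute it and take it
apart. -/
theorem vertEquiv_apply (u : Fin I.numVertices) (e : Fin I.numEdges) (i j : Fin 2) (κ : Fin 5)
    (τ : Fin 6) (f g h : Fn W) :
    (vertEquiv I (vert I u e i j κ τ f g h) : ℕ) = num h + 2 ^ W ^ 2 * (num g + 2 ^ W ^ 2 * (num f +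
      2 ^ W ^ 2 * (τ + 6 * (κ + 5 * (j + 2 * (i + 2 * (e + I.numEdges * u))))))) := rfl

theorem edgeEquiv_apply (e : Fin I.numEdges) (i j : Fin 2) (τ : Fin 6) (k : Fin 3)
    (f g h : Fn W) :
    (edgeEquiv I (((((((e, i), j), τ), k), f), g), h) : ℕ) = num h + 2 ^ W ^ 2 * (num g +
      2 ^ W ^ 2 * (num f + 2 ^ W ^ 2 * (k + 3 * (τ + 6 * (j + 2 * (i + 2 * e)))))) := rfl

theorem code_satisfies {ψ : Fin I.numVertices → Fin W} (hψ : I.graph.Satisfies ψ) :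
    ((newGraph I).rename (vertEquiv I) (edgeEquiv I)).Satisfies
      (code I ψ ∘ (vertEquiv I).symm) := by
  rw [ConstraintGraph.rename_satisfies, Function.comp_assoc, Equiv.symm_comp_self,
    Function.comp_id]
  exact (agrees_code ψ).satisfies hψ

/-- The instance with alphabet size `8` and hyperedges of size `4`. -/
def newInstance : CSPReconfInstance 4 tildeW0 where
  numVertices := vertCount I
  numEdges := hedgeCount I
  numEdges_pos := (edgeEquiv I (((((((edgeZero I, 0), 0), 0), 0), 0), 0), 0)).pos
  graph := (newGraph I).rename (vertEquiv I) (edgeEquiv I)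
  ini := code I I.ini ∘ (vertEquiv I).symm
  tar := code I I.tar ∘ (vertEquiv I).symm
  ini_satisfies := code_satisfies I I.ini_satisfies
  tar_satisfies := code_satisfies I I.tar_satisfies

theorem newInstance_optValue :
    (newInstance I).optValue = (newGraph I).reconfValue (code I I.ini) (code I I.tar) := by
  have := (newGraph I).rename_reconfValue (vertEquiv I) (edgeEquiv I)
    (code I I.ini ∘ (vertEquiv I).symm) (code I I.tar ∘ (vertEquiv I).symm)
  rw [Function.comp_assoc, Function.comp_assoc, Equiv.symm_comp_self, Function.comp_id,
    Function.comp_id] at this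
  rw [← this]
  rfl

end AlphabetReduction

/-! ### Positions in the code of an instance -/

theorem List.getD_ofFn {α : Type} {n : ℕ} (f : Fin n → α) (i : Fin n) (d : α) :
    (List.ofFn f).getD i d = f i := by
  simp [List.getD_eq_getElem?_getD]

theorem List.getD_flatten {α : Type} {n : ℕ} (d : α) (l : List (List α))
    (h : ∀ x ∈ l, x.length = n) {i j : ℕ} (hi : i < l.length) (hj : j < n) :
    l.flatten.getD (i * n + j) d = (l.getD i []).getD j d := by
  induction l generalizing i with
  | nil => simp at hi
  | cons x l ih =>
    have hx : x.length = n := h x (by simp)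
    rw [List.flatten_cons]
    cases i with
    | zero => rw [List.getD_append _ _ _ _ (by omega)]; simp
    | succ i =>
      rw [List.getD_append_right _ _ _ _ (by rw [hx, Nat.succ_mul]; omega),
        show (i + 1) * n + j - x.length = i * n + j by rw [hx, Nat.succ_mul]; omega,
        ih (fun y hy => h y (by simp [hy])) (by simpa using hi)]
      simp

namespace CSPReconfInstance

variable {q W : ℕ} (I : CSPReconfInstance q W)

theorem length_edgeCode (e : Fin I.numEdges) : (I.edgeCode e).length = q + W ^ q := by
  simp [edgeCode]

theorem code_eq : I.code = [W, I.numVertices, I.numEdges] ++ ((List.ofFn I.edgeCode).flatten ++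
    (List.ofFn (fun v => (I.ini v : ℕ)) ++ List.ofFn (fun v => (I.tar v : ℕ)))) := by
  simp [code]

theorem length_edgeCodes :
    (List.ofFn I.edgeCode).flatten.length = I.numEdges * (q + W ^ q) := by
  simp [List.length_flatten, List.map_ofFn, Function.comp_def, length_edgeCode, List.ofFn_const]

/-- Three numbers precede the hyperedges, each of which takes `q + W ^ q` entries. -/
theorem code_getD_edge (e : Fin I.numEdges) {k : ℕ} (hk : k < q + W ^ q) :
    I.code.getD (3 + e * (q + W ^ q) + k) 0 = (I.edgeCode e).getD k 0 := by
  have hlen : (e : ℕ) * (q + W ^ q) + k < I.numEdges * (q + W ^ q) := by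
    calc (e : ℕ) * (q + W ^ q) + k < (e + 1) * (q + W ^ q) := by rw [Nat.succ_mul]; omega
      _ ≤ _ := Nat.mul_le_mul_right _ e.isLt
  rw [code_eq, List.getD_append_right _ _ _ _ (by simp; omega), List.getD_append _ _ _ _ (by
    rw [length_edgeCodes]; simp; omega)]
  rw [show 3 + (e : ℕ) * (q + W ^ q) + k - [W, I.numVertices, I.numEdges].length =
    e * (q + W ^ q) + k by simp; omega]
  rw [List.getD_flatten _ _ _ (by simp) hk, List.getD_ofFn]
  intro x hx
  obtain ⟨e, rfl⟩ := (List.mem_ofFn' _ _).1 hx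
  exact I.length_edgeCode e

theorem code_getD_vertex (e : Fin I.numEdges) (i : Fin q) :
    I.code.getD (3 + e * (q + W ^ q) + i) 0 = I.graph.vertex e i := by
  rw [code_getD_edge _ _ (by omega), edgeCode, List.getD_append _ _ _ _ (by simp)]
  exact List.getD_ofFn (fun i => (I.graph.vertex e i : ℕ)) i 0

theorem code_getD_ini (u : Fin I.numVertices) :
    I.code.getD (3 + I.numEdges * (q + W ^ q) + u) 0 = I.ini u := by
  rw [code_eq, List.getD_append_right _ _ _ _ (by simp; omega), List.getD_append_right _ _ _ _ (by
    rw [length_edgeCodes]; simp; omega), length_edgeCodes, List.getD_append _ _ _ _ (by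
    simp; omega)]
  rw [show 3 + I.numEdges * (q + W ^ q) + (u : ℕ) - [W, I.numVertices, I.numEdges].length -
    I.numEdges * (q + W ^ q) = u by simp; omega]
  exact List.getD_ofFn (fun v => (I.ini v : ℕ)) u 0

theorem code_getD_tar (u : Fin I.numVertices) :
    I.code.getD (3 + I.numEdges * (q + W ^ q) + (I.numVertices + u)) 0 = I.tar u := by
  rw [code_eq, List.getD_append_right _ _ _ _ (by simp; omega), List.getD_append_right _ _ _ _ (by
    rw [length_edgeCodes]; simp; omega), length_edgeCodes, List.getD_append_right _ _ _ _ (by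
    simp; omega)]
  rw [show 3 + I.numEdges * (q + W ^ q) + (I.numVertices + (u : ℕ)) -
    [W, I.numVertices, I.numEdges].length - I.numEdges * (q + W ^ q) -
    (List.ofFn fun v => (I.ini v : ℕ)).length = u by simp; omega]
  exact List.getD_ofFn (fun v => (I.tar v : ℕ)) u 0

end CSPReconfInstance

theorem AlphabetReduction.code_getD_relation {W : ℕ} (I : CSPReconfInstance 2 W)
    (e : Fin I.numEdges) (p : Fin (W ^ 2)) :
    I.code.getD (3 + e * (2 + W ^ 2) + (2 + p)) 0 = (relation I e p).val := by
  rw [I.code_getD_edge _ (by omega), CSPReconfInstance.edgeCode,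
    List.getD_append_right _ _ _ _ (by simp)]
  simp only [List.length_ofFn, Nat.add_sub_cancel_left]
  rw [List.getD_ofFn]
  unfold relation
  split_ifs <;> rfl

/-! ### Expressions for the new instance -/

namespace StackProg

namespace Ex

/-- The square of the alphabet size. -/
def pairCount : Ex := mul alphabet alphabet

/-- The number of functions on pairs. -/
def fnCount : Ex := pow2 pairCount

/-- The number of hyperedges. -/
def edgeCount : Ex := .inp (const 2)

/-- Entry `k` of the code of hyperedge `e`. -/
def edgeEntry (e k : Ex) : Ex :=
  .inp (add (add (const 3) (mul e (add (const 2) pairCount))) k)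

/-- The position of the values of the assignments. -/
def valuePos : Ex := add (const 3) (mul edgeCount (add (const 2) pairCount))

/-- The number of a vertex. -/
def vertex (u e i j κ τ f g h : Ex) : Ex :=
  add h (mul fnCount (add g (mul fnCount (add f (mul fnCount (add τ (mul (const 6)
    (add κ (mul (const 5) (add j (mul (const 2) (add i (mul (const 2)
      (add e (mul edgeCount u)))))))))))))))

/-- A selector. -/
def selectorVertex (u : Ex) : Ex :=
  vertex u (const 0) (const 0) (const 0) (const 0) (const 0) (const 0) (const 0) (const 0)

/-- An entry of the long code of the value of a vertex. -/
def wordVertex (u i f : Ex) : Ex :=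
  vertex u (const 0) i (const 0) (const 1) (const 0) f (const 0) (const 0)

/-- A vertex for a hyperedge. -/
def edgeVertex (κ e i j τ f g h : Ex) : Ex := vertex (const 0) e i j κ τ f g h

/-- The bit at `p` of the function of the last query. -/
def lastBit (e τ f g h p : Ex) : Ex :=
  ite τ (const 1) (testBit g p) (mod (add (testBit h p)
    (ite τ (const 0) (testBit f p) (ite τ (const 2) (mul (testBit f p) (testBit g p))
      (ite τ (const 3) (edgeEntry e (add (const 2) p))
        (ite τ (const 4) (testBit f (mod p alphabet)) (testBit f (div p alphabet))))))) (const 2))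

/-- The first query of a test. -/
def firstQuery (e i j τ f g h : Ex) : Ex :=
  ite τ (const 1) (edgeVertex (const 3) e i j (const 0) h g (const 0))
    (ite τ (const 2) (edgeVertex (const 3) e i j (const 0) f g (const 0))
      (ite τ (const 4) (wordVertex (edgeEntry e (const 0)) i f)
        (ite τ (const 5) (wordVertex (edgeEntry e (const 1)) j f)
          (edgeVertex (const 2) e i j (const 0) f (const 0) (const 0)))))

/-- The number of the function of the last query, where `p` is the variable of the summation. -/
def lastFn (e τ f g h p : Ex) : Ex :=
  sum pairCount (mul (lastBit e τ f g h p) (pow2 p))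

/-- The query of a test. -/
def query (e i j τ k f g h p : Ex) : Ex :=
  ite k (const 0) (firstQuery e i j τ f g h)
    (edgeVertex (const 2) e i j (const 0) (ite k (const 1) h (lastFn e τ f g h p))
      (const 0) (const 0))

/-- The pair of values of a hyperedge under an assignment. -/
def pairValue (look : Ex → Ex) (e : Ex) : Ex :=
  add (look (edgeEntry e (const 0))) (mul (look (edgeEntry e (const 1))) alphabet)

/-- The first bit of the local view of a test. -/
def firstBit (look : Ex → Ex) (e τ f g h : Ex) : Ex :=
  ite τ (const 1) (mul (testBit h (pairValue look e)) (testBit g (pairValue look e)))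
    (ite τ (const 2) (mul (testBit f (pairValue look e)) (testBit g (pairValue look e)))
      (ite τ (const 4) (testBit f (look (edgeEntry e (const 0))))
        (ite τ (const 5) (testBit f (look (edgeEntry e (const 1))))
          (testBit f (pairValue look e)))))

/-- The value of a vertex in the encoding of an assignment. -/
def codeValue (look : Ex → Ex) (u e κ τ f g h : Ex) : Ex :=
  ite κ (const 0) (const 0) (ite κ (const 1) (testBit f (look u))
    (ite κ (const 2) (testBit f (pairValue look e))
      (ite κ (const 3) (mul (testBit f (pairValue look e)) (testBit g (pairValue look e)))
        (add (add (firstBit look e τ f g h) (mul (const 2) (testBit h (pairValue look e))))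
          (mul (const 4) (lastBit e τ f g h (pairValue look e)))))))

end Ex

end StackProg

/-! ### Correctness of the expressions -/

namespace AlphabetReduction

open StackProg

variable {W : ℕ} {I : CSPReconfInstance 2 W} {env : List ℕ}

theorem eval_alphabet_code : Ex.alphabet.eval I.code env = W := rfl

theorem eval_pairCount : Ex.pairCount.eval I.code env = W ^ 2 := by
  rw [Ex.pairCount, Ex.eval_mul, eval_alphabet_code, pow_two]

theorem eval_pow2_code {p : Ex} (h : p.eval I.code env ≤ W ^ 2) :
    (Ex.pow2 p).eval I.code env = 2 ^ p.eval I.code env :=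
  Ex.eval_pow2_of_le _ _ _ rfl h

theorem eval_fnCount : Ex.fnCount.eval I.code env = 2 ^ W ^ 2 := by
  rw [Ex.fnCount, eval_pow2_code (by rw [eval_pairCount]), eval_pairCount]

theorem eval_edgeCount : Ex.edgeCount.eval I.code env = I.numEdges := rfl

theorem eval_edgeEntry_vertex {eE kE : Ex} {e : Fin I.numEdges} {k : Fin 2}
    (he : eE.eval I.code env = e) (hk : kE.eval I.code env = k) :
    (Ex.edgeEntry eE kE).eval I.code env = I.graph.vertex e k := by
  rw [← I.code_getD_vertex e k]
  simp only [Ex.edgeEntry, Ex.eval, Ex.eval_mul, eval_pairCount, he, hk]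

theorem eval_edgeEntry_relation {eE pE : Ex} {e : Fin I.numEdges} {p : Fin (W ^ 2)}
    (he : eE.eval I.code env = e) (hp : pE.eval I.code env = p) :
    (Ex.edgeEntry eE (.add (.const 2) pE)).eval I.code env = (relation I e p).val := by
  rw [← code_getD_relation I e p]
  simp only [Ex.edgeEntry, Ex.eval, Ex.eval_mul, eval_pairCount, he, hp]

theorem eval_testBit {fE pE : Ex} {f : Fn W} {p : Fin (W ^ 2)} (hf : fE.eval I.code env = num f)
    (hp : pE.eval I.code env = p) : (Ex.testBit fE pE).eval I.code env = (f p).val := by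
  rw [Ex.testBit, Ex.eval_mod, Ex.eval_div, eval_pow2_code (by rw [hp]; exact p.isLt.le), hf, hp]
  exact num_div_mod f p

section Edge

variable {uE eE iE jE κE τE kE fE gE hE pE : Ex} {u : Fin I.numVertices} {e : Fin I.numEdges}
  {i j : Fin 2} {κ : Fin 5} {τ : Fin 6} {k : Fin 3} {f g h : Fn W}

theorem eval_vertex (hu : uE.eval I.code env = u) (he : eE.eval I.code env = e)
    (hi : iE.eval I.code env = i) (hj : jE.eval I.code env = j) (hκ : κE.eval I.code env = κ)
    (hτ : τE.eval I.code env = τ) (hf : fE.eval I.code env = num f)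
    (hg : gE.eval I.code env = num g) (hh : hE.eval I.code env = num h) :
    (Ex.vertex uE eE iE jE κE τE fE gE hE).eval I.code env =
      vertEquiv I (vert I u e i j κ τ f g h) := by
  rw [vertEquiv_apply]
  simp only [Ex.vertex, Ex.eval_mul, Ex.eval, eval_fnCount, eval_edgeCount, hu, he, hi, hj, hκ, hτ,
    hf, hg, hh]

theorem eval_const_zero : (Ex.const 0).eval I.code env = num (0 : Fn W) := num_zero.symm

theorem eval_selectorVertex (hu : uE.eval I.code env = u) :
    (Ex.selectorVertex uE).eval I.code env = vertEquiv I (selector I u) :=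
  eval_vertex hu rfl rfl rfl rfl rfl eval_const_zero eval_const_zero eval_const_zero

theorem eval_wordVertex (hu : uE.eval I.code env = u) (hi : iE.eval I.code env = i)
    (hf : fE.eval I.code env = num f) :
    (Ex.wordVertex uE iE fE).eval I.code env = vertEquiv I (word I u i f) :=
  eval_vertex hu rfl hi rfl rfl rfl hf eval_const_zero eval_const_zero

theorem eval_edgeVertex (he : eE.eval I.code env = e)
    (hi : iE.eval I.code env = i) (hj : jE.eval I.code env = j) (hκ : κE.eval I.code env = κ)
    (hτ : τE.eval I.code env = τ) (hf : fE.eval I.code env = num f)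
    (hg : gE.eval I.code env = num g) (hh : hE.eval I.code env = num h) :
    (Ex.edgeVertex κE eE iE jE τE fE gE hE).eval I.code env =
      vertEquiv I (vert I (vertZero I) e i j κ τ f g h) :=
  eval_vertex rfl he hi hj hκ hτ hf hg hh

theorem val_add_mod (a b : ZMod 2) : (a + b).val = (a.val + b.val) % 2 := ZMod.val_add a b

theorem val_mul_eq : ∀ a b : ZMod 2, (a * b).val = a.val * b.val := by decide

theorem eval_lastBit {p : Fin (W ^ 2)} (he : eE.eval I.code env = e)
    (hτ : τE.eval I.code env = τ) (hf : fE.eval I.code env = num f)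
    (hg : gE.eval I.code env = num g) (hh : hE.eval I.code env = num h)
    (hp : pE.eval I.code env = p) :
    (Ex.lastBit eE τE fE gE hE pE).eval I.code env =
      ((if (τ : ℕ) = 1 then g else h + shift I e τ f g) p).val := by
  -- The pair of `a` and `b` has the number `a + W * b`, so its components are remainder and
  -- quotient. The quotient is already below `W`.
  have h0 : (Ex.testBit fE (.mod pE .alphabet)).eval I.code env = (f (proj 0 p)).val := by
    refine eval_testBit hf ?_
    rw [Ex.eval_mod, hp, eval_alphabet_code]
    show (p : ℕ) % W = p / W ^ 0 % W
    rw [pow_zero, Nat.div_one]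
  have h1 : (Ex.testBit fE (.div pE .alphabet)).eval I.code env = (f (proj 1 p)).val := by
    refine eval_testBit hf ?_
    rw [Ex.eval_div, hp, eval_alphabet_code]
    show (p : ℕ) / W = p / W ^ 1 % W
    rw [pow_one, Nat.mod_eq_of_lt]
    exact Nat.div_lt_of_lt_mul (by rw [← pow_two]; exact p.isLt)
  simp only [Ex.lastBit, Ex.eval_ite, Ex.eval_mod, Ex.eval, Ex.eval_mul, eval_testBit hf hp,
    eval_testBit hg hp, eval_testBit hh hp, eval_edgeEntry_relation he hp, h0, h1, hτ]
  unfold shift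
  split_ifs <;> simp only [Pi.add_apply, Pi.mul_apply, Function.comp_apply, val_add_mod, val_mul_eq]

theorem eval_pairWord (he : eE.eval I.code env = e) (hi : iE.eval I.code env = i)
    (hj : jE.eval I.code env = j) (hf : fE.eval I.code env = num f) :
    (Ex.edgeVertex (.const 2) eE iE jE (.const 0) fE (.const 0) (.const 0)).eval I.code env =
      vertEquiv I (pairWord I e i j f) :=
  eval_edgeVertex he hi hj rfl rfl hf eval_const_zero eval_const_zero

theorem eval_prodWord (he : eE.eval I.code env = e) (hi : iE.eval I.code env = i)
    (hj : jE.eval I.code env = j) (hf : fE.eval I.code env = num f)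
    (hg : gE.eval I.code env = num g) :
    (Ex.edgeVertex (.const 3) eE iE jE (.const 0) fE gE (.const 0)).eval I.code env =
      vertEquiv I (prodWord I e i j f g) :=
  eval_edgeVertex he hi hj rfl rfl hf hg eval_const_zero

theorem eval_firstQuery (he : eE.eval I.code env = e)
    (hi : iE.eval I.code env = i) (hj : jE.eval I.code env = j)
    (hτ : τE.eval I.code env = τ) (hf : fE.eval I.code env = num f)
    (hg : gE.eval I.code env = num g) (hh : hE.eval I.code env = num h) :
    (Ex.firstQuery eE iE jE τE fE gE hE).eval I.code env =
      vertEquiv I (firstQuery I e i j τ f g h) := by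
  have h3 := eval_wordVertex (eval_edgeEntry_vertex (kE := .const 0) (k := 0) he rfl) hi hf
  have h4 := eval_wordVertex (eval_edgeEntry_vertex (kE := .const 1) (k := 1) he rfl) hj hf
  have hc : ∀ c, (Ex.const c).eval I.code env = c := fun _ => rfl
  refine (Ex.eval_ite_of hτ (hc 1) (eval_prodWord he hi hj hh hg) (Ex.eval_ite_of hτ (hc 2)
    (eval_prodWord he hi hj hf hg) (Ex.eval_ite_of hτ (hc 4) h3 (Ex.eval_ite_of hτ (hc 5) h4
      (eval_pairWord he hi hj hf))))).trans ?_
  simp only [firstQuery, apply_ite (vertEquiv I), apply_ite Fin.val]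

/-- The number of a sum of functions is rebuilt from its binary digits. The hypotheses speak of
extended environments because the digits are computed under the summation sign. -/
theorem eval_lastFn (he : ∀ p, eE.eval I.code (env ++ [p]) = e)
    (hτ : ∀ p, τE.eval I.code (env ++ [p]) = τ) (hf : ∀ p, fE.eval I.code (env ++ [p]) = num f)
    (hg : ∀ p, gE.eval I.code (env ++ [p]) = num g) (hh : ∀ p, hE.eval I.code (env ++ [p]) = num h)
    (hp : ∀ p, pE.eval I.code (env ++ [p]) = p) :
    (Ex.lastFn eE τE fE gE hE pE).eval I.code env =
      num (if (τ : ℕ) = 1 then g else h + shift I e τ f g) := by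
  rw [num_eq_sum, Ex.lastFn, Ex.eval, eval_pairCount, Finset.sum_range]
  refine Finset.sum_congr rfl fun p _ => ?_
  rw [Ex.eval_mul, eval_lastBit (he p) (hτ p) (hf p) (hg p) (hh p) (hp p),
    eval_pow2_code (by rw [hp]; exact p.isLt.le), hp]

theorem eval_query (hi : iE.eval I.code env = i) (hj : jE.eval I.code env = j)
    (hk : kE.eval I.code env = k)
    (he : ∀ l, eE.eval I.code (env ++ l) = e) (hτ : ∀ l, τE.eval I.code (env ++ l) = τ)
    (hf : ∀ l, fE.eval I.code (env ++ l) = num f) (hg : ∀ l, gE.eval I.code (env ++ l) = num g)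
    (hh : ∀ l, hE.eval I.code (env ++ l) = num h) (hp : ∀ p, pE.eval I.code (env ++ [p]) = p) :
    (Ex.query eE iE jE τE kE fE gE hE pE).eval I.code env =
      vertEquiv I (query I e i j τ k f g h) := by
  have he' := he []
  have hτ' := hτ []
  have hf' := hf []
  have hg' := hg []
  have hh' := hh []
  rw [List.append_nil] at he' hτ' hf' hg' hh'
  rw [Ex.query, Ex.eval_ite, eval_firstQuery he' hi hj hτ' hf' hg' hh', hk]
  have hlast := eval_lastFn (fun _ => he _) (fun _ => hτ _) (fun _ => hf _) (fun _ => hg _)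
    (fun _ => hh _) hp
  fin_cases k
  · rfl
  · exact eval_pairWord he' hi hj (by rw [Ex.eval_ite, hk]; exact hh')
  · exact eval_pairWord he' hi hj (by rw [Ex.eval_ite, hk]; exact hlast)

variable {look : Ex → Ex} {ψ : Fin I.numVertices → Fin W}

theorem eval_pairValue (hlook : ∀ (uE : Ex) (u : Fin I.numVertices), uE.eval I.code env = u →
    (look uE).eval I.code env = ψ u) (he : eE.eval I.code env = e) :
    (Ex.pairValue look eE).eval I.code env = pairVal I ψ e := by
  rw [Ex.pairValue, Ex.eval, Ex.eval_mul,
    hlook _ _ (eval_edgeEntry_vertex (kE := .const 0) (k := 0) he rfl),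
    hlook _ _ (eval_edgeEntry_vertex (kE := .const 1) (k := 1) he rfl), eval_alphabet_code, pairVal,
    pairOf, finFunctionFinEquiv_apply]
  simp

theorem eval_codeValue (hlook : ∀ (uE : Ex) (u : Fin I.numVertices), uE.eval I.code env = u →
    (look uE).eval I.code env = ψ u) (hu : uE.eval I.code env = u)
    (he : eE.eval I.code env = e) (hκ : κE.eval I.code env = κ)
    (hτ : τE.eval I.code env = τ) (hf : fE.eval I.code env = num f)
    (hg : gE.eval I.code env = num g) (hh : hE.eval I.code env = num h) :
    (Ex.codeValue look uE eE κE τE fE gE hE).eval I.code env =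
      code I ψ (vert I u e i j κ τ f g h) := by
  have hP := eval_pairValue hlook he
  -- `up` does not change the number of a symbol, so the value that is looked up can serve as an
  -- argument of a function on pairs.
  have h0 : (look (.edgeEntry eE (.const 0))).eval I.code env = up (ψ (I.graph.vertex e 0)) :=
    hlook _ _ (eval_edgeEntry_vertex (k := 0) he rfl)
  have h1 : (look (.edgeEntry eE (.const 1))).eval I.code env = up (ψ (I.graph.vertex e 1)) :=
    hlook _ _ (eval_edgeEntry_vertex (k := 1) he rfl)
  have h2 : (look uE).eval I.code env = up (ψ u) := hlook _ _ hu
  have hfirst : (Ex.firstBit look eE τE fE gE hE).eval I.code env = firstBit I ψ e τ f g h := by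
    refine Ex.eval_ite_of hτ rfl ?_ (Ex.eval_ite_of hτ rfl ?_ (Ex.eval_ite_of hτ rfl
      (eval_testBit hf h0) (Ex.eval_ite_of hτ rfl (eval_testBit hf h1) (eval_testBit hf hP))))
    · rw [Ex.eval_mul, eval_testBit hh hP, eval_testBit hg hP]
    · rw [Ex.eval_mul, eval_testBit hf hP, eval_testBit hg hP]
  have hlast : (Ex.lastBit eE τE fE gE hE (.pairValue look eE)).eval I.code env =
      lastBit I ψ e τ f g h := by
    rw [eval_lastBit he hτ hf hg hh hP, lastBit]
    split_ifs <;> rfl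
  simp only [Ex.codeValue, Ex.eval_ite, eval_testBit hf hP, eval_testBit hg hP,
    eval_testBit hh hP, eval_testBit hf h2, hκ, Ex.eval_mul, Ex.eval, hfirst, hlast]
  simp only [code, codeVal]

end Edge

end AlphabetReduction

/-! ### Generating the code of the new instance -/

theorem List.flatMap_range_eq_flatten {α : Type} {n : ℕ} {F : Fin n → List α} {G : ℕ → List α}
    (h : ∀ i : Fin n, G i = F i) : (List.range n).flatMap G = (List.ofFn F).flatten := by
  rw [← List.map_coe_finRange_eq_range, List.ofFn_eq_map, List.flatMap_map, List.flatMap_def]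
  congr 1
  exact List.map_congr_left fun i _ => h i

theorem List.flatMap_range_eq_ofFn {α : Type} {n : ℕ} {F : Fin n → α} {G : ℕ → List α}
    (h : ∀ i : Fin n, G i = [F i]) : (List.range n).flatMap G = List.ofFn F := by
  rw [List.flatMap_range_eq_flatten h, List.ofFn_eq_map, List.ofFn_eq_map, ← List.flatMap_def,
    List.map_eq_flatMap]

theorem Nat.add_mul_mod_of_lt {r n : ℕ} (h : r < n) (q : ℕ) : (r + n * q) % n = r := by
  rw [Nat.add_mul_mod_self_left, Nat.mod_eq_of_lt h]

theorem Nat.add_mul_div_of_lt {r n : ℕ} (h : r < n) (q : ℕ) : (r + n * q) / n = q := by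
  rw [Nat.add_mul_div_left _ _ (by omega), Nat.div_eq_of_lt h, zero_add]

namespace StackProg

namespace Ex

/-- The variable without its first `k` digits, the digits being functions. -/
def dropFns : ℕ → Ex
  | 0 => var 0
  | k + 1 => div (dropFns k) fnCount

/-- Digit `k` of the variable, which is a function. -/
def fnDigit (k : ℕ) : Ex := mod (dropFns k) fnCount

/-- The hyperedge with the number given by the variable. -/
def edgeOfEdge : Ex :=
  div (div (div (div (dropFns 3) (const 3)) (const 6)) (const 2)) (const 2)

/-- The selector value of the first vertex. -/
def selOfEdge : Ex := mod (div (div (div (dropFns 3) (const 3)) (const 6)) (const 2)) (const 2)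

/-- The selector value of the second vertex. -/
def selOfEdge' : Ex := mod (div (div (dropFns 3) (const 3)) (const 6)) (const 2)

/-- The test. -/
def testOfEdge : Ex := mod (div (dropFns 3) (const 3)) (const 6)

/-- The bit of the local view. -/
def bitOfEdge : Ex := mod (dropFns 3) (const 3)

/-- The vertex of a vertex of the new graph. -/
def vertexOfVertex : Ex :=
  div (div (div (div (div (dropFns 3) (const 6)) (const 5)) (const 2)) (const 2)) edgeCount

/-- The hyperedge of a vertex of the new graph. -/
def edgeOfVertex : Ex :=
  mod (div (div (div (div (dropFns 3) (const 6)) (const 5)) (const 2)) (const 2)) edgeCount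

/-- The kind of a vertex of the new graph. -/
def kindOfVertex : Ex := mod (div (dropFns 3) (const 6)) (const 5)

/-- The test of a vertex of the new graph. -/
def testOfVertex : Ex := mod (dropFns 3) (const 6)

/-- The value at position `s` of the entry of a truth table that is given by the second variable. -/
def tableDigit (s : ℕ) : Ex := mod (div (var 1) (const (tildeW0 ^ s))) (const tildeW0)

/-- The product of `a` and three times the number of functions. -/
def mulFns (a : Ex) : Ex := mul (mul (mul a fnCount) fnCount) fnCount

/-- The number of vertices of the given instance. -/
def vertexCount : Ex := .inp (const 1)

/-- The number of vertices of the new graph. -/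
def newVertexCount : Ex :=
  mulFns (mul (mul (mul (mul (mul vertexCount edgeCount) (const 2)) (const 2)) (const 5)) (const 6))

/-- The number of hyperedges of the new graph. -/
def newEdgeCount : Ex :=
  mulFns (mul (mul (mul (mul edgeCount (const 2)) (const 2)) (const 6)) (const 3))

end Ex

namespace Gen

/-- The truth table of a hyperedge of the new graph. -/
def table : Gen :=
  .each (.const (tildeW0 ^ 4)) (.emit (.accepts (.tableDigit 0) (.tableDigit 1) (.tableDigit 2)
    (.tableDigit 3) .selOfEdge .selOfEdge' .testOfEdge .bitOfEdge))

/-- The code of a hyperedge of the new graph. -/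
def edge : Gen :=
  .seq (.emit (.selectorVertex (.edgeEntry .edgeOfEdge (.const 0))))
    (.seq (.emit (.selectorVertex (.edgeEntry .edgeOfEdge (.const 1))))
    (.seq (.emit (.edgeVertex (.const 4) .edgeOfEdge .selOfEdge .selOfEdge' .testOfEdge
      (.fnDigit 2) (.fnDigit 1) (.fnDigit 0)))
    (.seq (.emit (.query .edgeOfEdge .selOfEdge .selOfEdge' .testOfEdge .bitOfEdge
      (.fnDigit 2) (.fnDigit 1) (.fnDigit 0) (.var 1))) table)))

/-- The value of a vertex of the new graph. -/
def value (look : Ex → Ex) : Gen :=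
  .emit (.codeValue look .vertexOfVertex .edgeOfVertex .kindOfVertex .testOfVertex
    (.fnDigit 2) (.fnDigit 1) (.fnDigit 0))

/-- The code of the new instance. -/
def reduction : Gen :=
  .seq (.emit (.const tildeW0)) (.seq (.emit .newVertexCount) (.seq (.emit .newEdgeCount)
    (.seq (.each .newEdgeCount edge) (.seq
      (.each .newVertexCount (value fun u => .inp (.add .valuePos u)))
      (.each .newVertexCount (value fun u => .inp (.add .valuePos (.add .vertexCount u))))))))

end Gen

end StackProg

namespace AlphabetReduction

open StackProg

variable {W : ℕ} {I : CSPReconfInstance 2 W} {env : List ℕ}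

theorem eval_dropFns_succ (k : ℕ) : (Ex.dropFns (k + 1)).eval I.code env =
    (Ex.dropFns k).eval I.code env / 2 ^ W ^ 2 := by
  rw [Ex.dropFns, Ex.eval_div, eval_fnCount]

theorem eval_fnDigit (k : ℕ) : (Ex.fnDigit k).eval I.code env =
    (Ex.dropFns k).eval I.code env % 2 ^ W ^ 2 := by
  rw [Ex.fnDigit, Ex.eval_mod, eval_fnCount]

/-- Only the first variable enters, so the digits keep their values under further bound variables.
-/
theorem eval_fns {f g h : Fn W} {q : ℕ} (ht : env.getD 0 0 =
    num h + 2 ^ W ^ 2 * (num g + 2 ^ W ^ 2 * (num f + 2 ^ W ^ 2 * q))) :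
    (Ex.fnDigit 2).eval I.code env = num f ∧ (Ex.fnDigit 1).eval I.code env = num g ∧
      (Ex.fnDigit 0).eval I.code env = num h ∧ (Ex.dropFns 3).eval I.code env = q := by
  have h0 : (Ex.dropFns 0).eval I.code env = _ := ht
  have h1 := eval_dropFns_succ (I := I) (env := env) 0
  have h2 := eval_dropFns_succ (I := I) (env := env) 1
  have h3 := eval_dropFns_succ (I := I) (env := env) 2
  rw [h0, Nat.add_mul_div_of_lt (num_lt h)] at h1
  rw [h1, Nat.add_mul_div_of_lt (num_lt g)] at h2
  rw [h2, Nat.add_mul_div_of_lt (num_lt f)] at h3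
  rw [eval_fnDigit, eval_fnDigit, eval_fnDigit, h0, h1, h2, Nat.add_mul_mod_of_lt (num_lt f),
    Nat.add_mul_mod_of_lt (num_lt g), Nat.add_mul_mod_of_lt (num_lt h)]
  exact ⟨rfl, rfl, rfl, h3⟩

theorem eval_edge_digits {e : Fin I.numEdges} {i j : Fin 2} {τ : Fin 6} {k : Fin 3} {f g h : Fn W}
    (ht : env.getD 0 0 = edgeEquiv I (((((((e, i), j), τ), k), f), g), h)) :
    Ex.edgeOfEdge.eval I.code env = e ∧ Ex.selOfEdge.eval I.code env = i ∧
      Ex.selOfEdge'.eval I.code env = j ∧ Ex.testOfEdge.eval I.code env = τ ∧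
      Ex.bitOfEdge.eval I.code env = k := by
  rw [edgeEquiv_apply] at ht
  obtain ⟨-, -, -, h3⟩ := eval_fns (I := I) ht
  have hc : ∀ c, (Ex.const c).eval I.code env = c := fun _ => rfl
  simp only [Ex.edgeOfEdge, Ex.selOfEdge, Ex.selOfEdge', Ex.testOfEdge, Ex.bitOfEdge, Ex.eval_div,
    Ex.eval_mod, h3, hc]
  omega

theorem eval_vertex_digits {u : Fin I.numVertices} {e : Fin I.numEdges} {i j : Fin 2} {κ : Fin 5}
    {τ : Fin 6} {f g h : Fn W} (ht : env.getD 0 0 = vertEquiv I (vert I u e i j κ τ f g h)) :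
    Ex.vertexOfVertex.eval I.code env = u ∧ Ex.edgeOfVertex.eval I.code env = e ∧
      Ex.kindOfVertex.eval I.code env = κ ∧ Ex.testOfVertex.eval I.code env = τ := by
  rw [vertEquiv_apply] at ht
  obtain ⟨-, -, -, h3⟩ := eval_fns (I := I) ht
  have hc : ∀ c, (Ex.const c).eval I.code env = c := fun _ => rfl
  simp only [Ex.vertexOfVertex, Ex.edgeOfVertex, Ex.kindOfVertex, Ex.testOfVertex, Ex.eval_div,
    Ex.eval_mod, h3, hc, eval_edgeCount]
  -- Digits to constant bases are linear arithmetic. The base `I.numEdges` is not constant, and its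
  -- digit is split off separately.
  have hq : ((τ : ℕ) + 6 * (κ + 5 * (j + 2 * (i + 2 * (e + I.numEdges * u))))) / 6 / 5 / 2 / 2 =
      e + I.numEdges * u := by omega
  rw [hq, Nat.add_mul_div_of_lt e.isLt, Nat.add_mul_mod_of_lt e.isLt]
  omega

theorem edgeCode_four {A : ℕ} (J : CSPReconfInstance 4 A) (e : Fin J.numEdges) {v : Fin 4 → ℕ}
    {P : Fin (A ^ 4) → Prop} [DecidablePred P] (hv : ∀ i, (J.graph.vertex e i : ℕ) = v i)
    (hP : ∀ a, finFunctionFinEquiv.symm a ∈ J.graph.constraint e ↔ P a) :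
    J.edgeCode e =
      [v 0] ++ ([v 1] ++ ([v 2] ++ ([v 3] ++ List.ofFn fun a => if P a then 1 else 0))) := by
  have h4 : ∀ f : Fin 4 → ℕ, List.ofFn f = [f 0] ++ ([f 1] ++ ([f 2] ++ [f 3])) := fun _ => rfl
  rw [CSPReconfInstance.edgeCode, h4]
  simp only [hv, hP, List.append_assoc]

section Edge

variable {e : Fin I.numEdges} {i j : Fin 2} {τ : Fin 6} {k : Fin 3} {f g h : Fn W} {t : ℕ}

theorem eval_edge_vertices (ht : t = edgeEquiv I (((((((e, i), j), τ), k), f), g), h)) :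
    (Ex.selectorVertex (.edgeEntry .edgeOfEdge (.const 0))).eval I.code [t] =
        vertEquiv I (selector I (I.graph.vertex e 0)) ∧
      (Ex.selectorVertex (.edgeEntry .edgeOfEdge (.const 1))).eval I.code [t] =
        vertEquiv I (selector I (I.graph.vertex e 1)) ∧
      (Ex.edgeVertex (.const 4) .edgeOfEdge .selOfEdge .selOfEdge' .testOfEdge (.fnDigit 2)
        (.fnDigit 1) (.fnDigit 0)).eval I.code [t] = vertEquiv I (view I e i j τ f g h) ∧
      (Ex.query .edgeOfEdge .selOfEdge .selOfEdge' .testOfEdge .bitOfEdge (.fnDigit 2) (.fnDigit 1)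
        (.fnDigit 0) (.var 1)).eval I.code [t] = vertEquiv I (query I e i j τ k f g h) := by
  -- The digits are also needed inside the sum in `Ex.lastFn`, whose index is variable `1` because
  -- the environment here has one entry.
  have hd := fun l => eval_edge_digits (I := I) (env := [t] ++ l) ht
  have hf := fun l => eval_fns (I := I) (env := [t] ++ l) (ht.trans (edgeEquiv_apply ..))
  obtain ⟨he, hi, hj, hτ, hk⟩ := eval_edge_digits (I := I) (env := [t]) ht
  obtain ⟨hf0, hg0, hh0, -⟩ := eval_fns (I := I) (env := [t]) (ht.trans (edgeEquiv_apply ..))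
  refine ⟨?_, ?_, ?_, ?_⟩
  · exact eval_selectorVertex (eval_edgeEntry_vertex (kE := .const 0) (k := 0) he rfl)
  · exact eval_selectorVertex (eval_edgeEntry_vertex (kE := .const 1) (k := 1) he rfl)
  · exact eval_edgeVertex (κ := 4) he hi hj rfl hτ hf0 hg0 hh0
  · exact eval_query hi hj hk (fun l => (hd l).1) (fun l => (hd l).2.2.2.1) (fun l => (hf l).1)
      (fun l => (hf l).2.1) (fun l => (hf l).2.2.1) fun _ => rfl

theorem eval_edge_table (ht : t = edgeEquiv I (((((((e, i), j), τ), k), f), g), h))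
    (a : Fin (tildeW0 ^ 4)) :
    (Ex.accepts (.tableDigit 0) (.tableDigit 1) (.tableDigit 2) (.tableDigit 3) .selOfEdge
      .selOfEdge' .testOfEdge .bitOfEdge).eval I.code [t, a] =
      if Accepts i j τ k (finFunctionFinEquiv.symm a 0 : Fin tildeW0)
        (finFunctionFinEquiv.symm a 1 : Fin tildeW0) (finFunctionFinEquiv.symm a 2 : Fin tildeW0)
        (finFunctionFinEquiv.symm a 3 : Fin tildeW0) then 1 else 0 := by
  obtain ⟨-, hi, hj, hτ, hk⟩ := eval_edge_digits (I := I) (env := [t, a]) ht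
  rw [Ex.eval_accepts _ _ _ _ _ _ _ _ _ _ (by rw [hk]; exact k.isLt), hi, hj, hτ, hk]
  have hdig : ∀ s : Fin 4, (Ex.tableDigit s).eval I.code [t, a] =
      (finFunctionFinEquiv.symm a s : Fin tildeW0) := by
    intro s
    rw [Ex.tableDigit, Ex.eval_mod, Ex.eval_div]
    rfl
  rw [← hdig 0, ← hdig 1, ← hdig 2, ← hdig 3]
  rfl

theorem out_table (ht : t = edgeEquiv I (((((((e, i), j), τ), k), f), g), h)) :
    Gen.table.out I.code [t] = List.ofFn fun a : Fin (tildeW0 ^ 4) =>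
      if Accepts i j τ k (finFunctionFinEquiv.symm a 0 : Fin tildeW0)
        (finFunctionFinEquiv.symm a 1 : Fin tildeW0) (finFunctionFinEquiv.symm a 2 : Fin tildeW0)
        (finFunctionFinEquiv.symm a 3 : Fin tildeW0) then 1 else 0 := by
  rw [Gen.table, Gen.out]
  exact List.flatMap_range_eq_ofFn fun a => congrArg (fun b => [b]) (eval_edge_table ht a)

theorem mem_constraint (b : Fin 4 → Fin 8) :
    b ∈ (newGraph I).constraint (((((((e, i), j), τ), k), f), g), h) ↔
      Accepts i j τ k (b 0) (b 1) (b 2) (b 3) := by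
  simp [newGraph]

end Edge

theorem out_edge (y : Fin (newInstance I).numEdges) :
    Gen.edge.out I.code [(y : ℕ)] = (newInstance I).edgeCode y := by
  obtain ⟨x, hx⟩ : ∃ x, edgeEquiv I x = y := (edgeEquiv I).surjective y
  have hx' : (edgeEquiv I).symm y = x := (Equiv.symm_apply_eq _).2 hx.symm
  obtain ⟨⟨⟨⟨⟨⟨⟨e, i⟩, j⟩, τ⟩, k⟩, f⟩, g⟩, h⟩ := x
  have hv : ∀ a, ((newInstance I).graph.vertex y a : ℕ) =
      ![(vertEquiv I (selector I (I.graph.vertex e 0)) : ℕ),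
        vertEquiv I (selector I (I.graph.vertex e 1)), vertEquiv I (view I e i j τ f g h),
        vertEquiv I (query I e i j τ k f g h)] a := by
    intro a
    show (vertEquiv I ((newGraph I).vertex ((edgeEquiv I).symm y) a) : ℕ) = _
    rw [hx']
    fin_cases a <;> rfl
  have hP : ∀ a : Fin (tildeW0 ^ 4), finFunctionFinEquiv.symm a ∈
      (newInstance I).graph.constraint y ↔ Accepts i j τ k
        (finFunctionFinEquiv.symm a 0 : Fin tildeW0) (finFunctionFinEquiv.symm a 1 : Fin tildeW0)
        (finFunctionFinEquiv.symm a 2 : Fin tildeW0)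
        (finFunctionFinEquiv.symm a 3 : Fin tildeW0) := by
    intro a
    show _ ∈ (newGraph I).constraint ((edgeEquiv I).symm y) ↔ _
    rw [hx']
    exact mem_constraint _
  rw [edgeCode_four (newInstance I) y hv hP]
  -- The number is detached from `y`, so that `hx` can be rewritten in `ht` alone.
  obtain ⟨t, ht⟩ : ∃ t : ℕ, t = y := ⟨_, rfl⟩
  rw [← ht]
  rw [← hx] at ht
  obtain ⟨h0, h1, h2, h3⟩ := eval_edge_vertices ht
  rw [Gen.edge, Gen.out, Gen.out, Gen.out, Gen.out, Gen.out, Gen.out, Gen.out, Gen.out, h0, h1, h2,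
    h3, out_table ht]
  rfl

theorem out_value {look : Ex → Ex} {ψ : Fin I.numVertices → Fin W}
    (hlook : ∀ (env : List ℕ) (uE : Ex) (u : Fin I.numVertices), uE.eval I.code env = u →
      (look uE).eval I.code env = ψ u) (y : Fin (newInstance I).numVertices) :
    (Gen.value look).out I.code [(y : ℕ)] = [(code I ψ ((vertEquiv I).symm y) : ℕ)] := by
  obtain ⟨x, hx⟩ : ∃ x, vertEquiv I x = y := (vertEquiv I).surjective y
  rw [(Equiv.symm_apply_eq _).2 hx.symm]
  obtain ⟨⟨⟨⟨⟨⟨⟨⟨u, e⟩, i⟩, j⟩, κ⟩, τ⟩, f⟩, g⟩, h⟩ := x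
  obtain ⟨t, ht⟩ : ∃ t : ℕ, t = y := ⟨_, rfl⟩
  rw [← ht]
  rw [← hx] at ht
  obtain ⟨hu, he, hκ, hτ⟩ := eval_vertex_digits (I := I) (env := [t]) ht
  obtain ⟨hf, hg, hh, -⟩ := eval_fns (I := I) (env := [t]) (ht.trans (vertEquiv_apply ..))
  exact congrArg (fun a => [a]) (eval_codeValue (hlook _) hu he hκ hτ hf hg hh)

theorem eval_valuePos : Ex.valuePos.eval I.code env = 3 + I.numEdges * (2 + W ^ 2) := by
  simp only [Ex.valuePos, Ex.eval, Ex.eval_mul, eval_pairCount, eval_edgeCount]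

/-- The generator follows the order of the code, so the header, the hyperedges and the two
assignments are matched block by block. -/
theorem out_reduction (I : CSPReconfInstance 2 W) :
    Gen.reduction.out I.code [] = (newInstance I).code := by
  have hN : Ex.newVertexCount.eval I.code [] = (newInstance I).numVertices := by
    simp only [Ex.newVertexCount, Ex.mulFns, Ex.eval_mul, eval_fnCount, eval_edgeCount]
    rfl
  have hM : Ex.newEdgeCount.eval I.code [] = (newInstance I).numEdges := by
    simp only [Ex.newEdgeCount, Ex.mulFns, Ex.eval_mul, eval_fnCount, eval_edgeCount]
    rfl
  have hvalue : ∀ (look : Ex → Ex) (ψ : Fin I.numVertices → Fin W),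
      (∀ (env : List ℕ) (uE : Ex) (u : Fin I.numVertices), uE.eval I.code env = u →
        (look uE).eval I.code env = ψ u) →
      (Gen.each .newVertexCount (.value look)).out I.code [] =
        List.ofFn fun x : Fin (newInstance I).numVertices =>
          (code I ψ ((vertEquiv I).symm x) : ℕ) := by
    intro look ψ hlook
    have h := out_value hlook
    rw [Gen.out, hN]
    exact List.flatMap_range_eq_ofFn h
  have hini : (Gen.each .newVertexCount (.value fun u => .inp (.add .valuePos u))).out I.code [] =
      List.ofFn fun v => ((newInstance I).ini v : ℕ) := by
    refine hvalue _ I.ini fun env uE u hu => ?_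
    rw [← I.code_getD_ini u, Ex.eval_inp, Ex.eval, eval_valuePos, hu]
  have htar : (Gen.each .newVertexCount (.value fun u =>
      .inp (.add .valuePos (.add .vertexCount u)))).out I.code [] =
      List.ofFn fun v => ((newInstance I).tar v : ℕ) := by
    refine hvalue _ I.tar fun env uE u hu => ?_
    rw [← I.code_getD_tar u, Ex.eval_inp, Ex.eval, Ex.eval, eval_valuePos, hu, Ex.vertexCount,
      Ex.eval_inp]
    rfl
  have hedge : (Gen.each .newEdgeCount .edge).out I.code [] =
      (List.ofFn (newInstance I).edgeCode).flatten := by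
    rw [Gen.out, hM]
    exact List.flatMap_range_eq_flatten out_edge
  rw [(newInstance I).code_eq, Gen.reduction, Gen.out, Gen.out, Gen.out, Gen.out, Gen.out, Gen.out,
    Gen.out, Gen.out, hN, hM, hini, htar, hedge, Ex.eval, List.cons_append, List.cons_append,
    List.cons_append, List.nil_append, List.nil_append, List.nil_append, List.cons_append,
    List.cons_append, List.cons_append, List.nil_append]

theorem polyTime : PolyTimeForFixedAlphabet fun W (I : CSPReconfInstance 2 W) => newInstance I := by
  obtain ⟨M, p, h⟩ := Gen.reduction.exists_machine
  refine ⟨M, p, fun W I => ?_⟩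
  have := h I.code
  rw [out_reduction] at this
  -- The first number of `I.code` is `W`, so the bound indexed by the first input number is the one
  -- for `W`.
  exact this

end AlphabetReduction

theorem proposition3p8 :
    (0 < tildeKappa ∧ tildeKappa < 1) ∧
    ∃ f : (W : ℕ) → CSPReconfInstance 2 W → CSPReconfInstance 4 tildeW0,
      PolyTimeForFixedAlphabet f ∧
      ∀ (W : ℕ) (I : CSPReconfInstance 2 W),
        (I.optValue = 1 → (f W I).optValue = 1) ∧
        (∀ ε : ℝ, I.optValue < 1 - ε → (f W I).optValue < 1 - tildeKappa * ε) := by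
  obtain ⟨h0, h1⟩ := AlphabetReduction.tildeKappa_bounds
  refine ⟨⟨h0, h1.trans_lt (by norm_num)⟩, fun _ I => AlphabetReduction.newInstance I,
    AlphabetReduction.polyTime, fun W I => ⟨fun h => ?_, fun ε h => ?_⟩⟩
  · rw [AlphabetReduction.newInstance_optValue]
    exact AlphabetReduction.completeness h
  · rw [AlphabetReduction.newInstance_optValue]
    exact AlphabetReduction.reconfValue_lt h
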